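/- Let $k$ be an algebraically closed field of arbitrary characteristic and let $X$ be a normal, projective variety over $k$ (an integral scheme admitting a closed embedding into some $\mathbb{P}^N_k$) with a nontrivial action of the additive group $\mathbb{G}_a$. Let $L$ be a very ample line bundle on $X$ with a $\mathbb{G}_a$-linearization, and assume that the induced action of $\mathbb{G}_a(k)$ on $H^0(X,L)$ is trivial on a linear subspace $W\subset H^0(X,L)$ of codimension $1$. Then: (1) $X$ is a cone and the $\mathbb{G}_a$-action is along its generators. That is, for every closed embedding $\varphi: X\hookrightarrow\mathbb{P}^N$ over $k$ with $\varphi^*\mathcal{O}_{\mathbb{P}^N}(1)\cong L$ (for instance the embedding given by the complete linear system $|L|$) there is a closed point $v\in X$ such that for every closed point $x\in X$, $x\neq v$, the line $\ell_x\subset\mathbb{P}^N$ through $\varphi(v)$ and $\varphi(x)$ is contained in $\varphi(X)$; moreover $v$ is fixed by $\mathbb{G}_a$, and $\varphi(t\cdot x)\in \ell_x$ for every closed point $x\neq v$ of $X$ and every $t\in\mathbb{G}_a(k)$. (2) If $X$ is smooth of dimension $n$, then $(X,L)\cong(\mathbb{P}^n,\mathcal{O}_{\mathbb{P}^n}(1))$,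 that is, there is an isomorphism $e: X\to\mathbb{P}^n$ over $k$ with $e^*\mathcal{O}_{\mathbb{P}^n}(1)\cong L$. -/

import Mathlib

open CategoryTheory AlgebraicGeometry TopologicalSpace Opposite

universe u

namespace GaCone

noncomputable section

/-! ### The twisting sheaves on `Proj` of a graded ring -/

section Twist

variable {A : Type u} {σ : Type*} [CommRing A] [SetLike σ A] [AddSubgroupClass σ A]
variable (𝒜 : ℕ → σ) [GradedRing 𝒜] (d : ℕ)

/-- The localization of the graded ring at a homogeneous prime ideal. -/
abbrev LocAt (x : ProjectiveSpectrum 𝒜) : Type u :=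
  Localization.AtPrime x.asHomogeneousIdeal.toIdeal

/-- A function on `U` is a fraction of degree `d` if it is given by `r / s` with `r` and `s`
homogeneous, `deg r = deg s + d`, and `s` without zeros on `U`. -/
def twistPrelocal : TopCat.PrelocalPredicate
    (fun x : ProjectiveSpectrum.top 𝒜 => LocAt 𝒜 x) where
  pred {U} f := ∃ (i : ℕ) (r s : A) (_ : r ∈ 𝒜 (i + d)) (_ : s ∈ 𝒜 i)
    (hs : ∀ x : U, s ∉ x.1.asHomogeneousIdeal.toIdeal), ∀ x : U, f x = Localization.mk r ⟨s, hs x⟩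
  res := by
    rintro V U i f ⟨j, r, s, hr, hs, h, w⟩
    exact ⟨j, r, s, hr, hs, fun x => h (i x), fun x => w (i x)⟩

/-- Being locally a fraction of degree `d`. -/
def twistLocal : TopCat.LocalPredicate
    (fun x : ProjectiveSpectrum.top 𝒜 => LocAt 𝒜 x) :=
  (twistPrelocal 𝒜 d).sheafify

/-- The sections of `𝒪(d)` over `U`: functions that are locally fractions of degree `d`. -/
def twistSections (U : Opens (ProjectiveSpectrum.top 𝒜)) :
    AddSubgroup (∀ x : U, LocAt 𝒜 x.1) where
  carrier := {f | (twistLocal 𝒜 d).pred f}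
  zero_mem' := fun x => ⟨U, x.2, 𝟙 U, 0, 0, 1, zero_mem _, SetLike.one_mem_graded _,
    fun y => (Ideal.ne_top_iff_one _).1 (ProjectiveSpectrum.isPrime y.1).ne_top, fun y => by
      exact (Localization.mk_zero _).symm⟩
  add_mem' := by
    intro a b ha hb x
    obtain ⟨Va, ma, ia, ja, ra, sa, hra, hsa, hwa, wa⟩ := ha x
    obtain ⟨Vb, mb, ib, jb, rb, sb, hrb, hsb, hwb, wb⟩ := hb x
    refine ⟨Va ⊓ Vb, ⟨ma, mb⟩, Opens.infLELeft _ _ ≫ ia, ja + jb, sb * ra + sa * rb, sa * sb,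
      add_mem ?_ ?_, SetLike.mul_mem_graded hsa hsb,
      fun y h => ((ProjectiveSpectrum.isPrime y.1).mem_or_mem h).elim (hwa ⟨y.1, y.2.1⟩)
        (hwb ⟨y.1, y.2.2⟩), ?_⟩
    · have := SetLike.mul_mem_graded hsb hra
      rwa [show jb + (ja + d) = ja + jb + d by omega] at this
    · have := SetLike.mul_mem_graded hsa hrb
      rwa [show ja + (jb + d) = ja + jb + d by omega] at this
    · intro y
      have h1 := wa ⟨y.1, y.2.1⟩
      have h2 := wb ⟨y.1, y.2.2⟩
      refine (congrArg₂ (· + ·) h1 h2).trans ?_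
      dsimp only
      rw [Localization.add_mk]
      congr 1
      exact add_comm _ _
  neg_mem' := by
    intro a ha x
    obtain ⟨V, m, i, j, r, s, hr, hs, hw, w⟩ := ha x
    refine ⟨V, m, i, j, -r, s, neg_mem hr, hs, hw, fun y => ?_⟩
    refine (congrArg Neg.neg (w y)).trans ?_
    rw [Localization.neg_mk]

/-- `𝒪(U)` acts on the sections of `𝒪(d)` over `U` by pointwise multiplication. -/
instance twistModule (U : Opens (ProjectiveSpectrum.top 𝒜)) :
    Module Γ(Proj 𝒜, U) (twistSections 𝒜 d U) where
  smul g f := ⟨fun x => (g.1 x).val * f.1 x, by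
    intro x
    obtain ⟨Va, ma, ia, ja, ra, sa, hwa, wa⟩ := g.2 x
    obtain ⟨Vb, mb, ib, jb, rb, sb, hrb, hsb, hwb, wb⟩ := f.2 x
    refine ⟨Va ⊓ Vb, ⟨ma, mb⟩, Opens.infLELeft _ _ ≫ ia, ja + jb, ra.1 * rb, sa.1 * sb,
      ?_, SetLike.mul_mem_graded sa.2 hsb,
      fun y h => ((ProjectiveSpectrum.isPrime y.1).mem_or_mem h).elim (hwa ⟨y.1, y.2.1⟩)
        (hwb ⟨y.1, y.2.2⟩), ?_⟩
    · have := SetLike.mul_mem_graded ra.2 hrb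
      rwa [← add_assoc] at this
    · intro y
      have h1 := wa ⟨y.1, y.2.1⟩
      have h2 := wb ⟨y.1, y.2.2⟩
      refine (congrArg₂ (fun p q => HomogeneousLocalization.val p * q) h1 h2).trans ?_
      dsimp only
      rw [HomogeneousLocalization.val_mk, Localization.mk_mul]
      congr 1⟩
  one_smul f := Subtype.ext (funext fun x => by
    exact (congrArg (· * f.1 x) HomogeneousLocalization.val_one).trans (one_mul _))
  mul_smul g h f := Subtype.ext (funext fun x => by
    exact (congrArg (· * f.1 x) (HomogeneousLocalization.val_mul _ _)).trans (mul_assoc _ _ _))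
  smul_zero g := Subtype.ext (funext fun x => mul_zero _)
  smul_add g f f' := Subtype.ext (funext fun x => mul_add _ _ _)
  add_smul g h f := Subtype.ext (funext fun x => by
    exact (congrArg (· * f.1 x) (HomogeneousLocalization.val_add _ _)).trans (add_mul _ _ _))
  zero_smul f := Subtype.ext (funext fun x => by
    exact (congrArg (· * f.1 x) HomogeneousLocalization.val_zero).trans (zero_mul _))

/-- The presheaf of abelian groups underlying `𝒪(d)`. -/
def twistAb : TopCat.Presheaf Ab.{u} (ProjectiveSpectrum.top 𝒜) where
  obj U := AddCommGrpCat.of (twistSections 𝒜 d U.unop)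
  map {U V} i := AddCommGrpCat.ofHom
    { toFun := fun f => ⟨fun x => f.1 (i.unop x), (twistLocal 𝒜 d).res i.unop _ f.2⟩
      map_zero' := rfl
      map_add' := fun _ _ => rfl }

instance twistAbModule (U : (Proj 𝒜).Opensᵒᵖ) :
    Module ((Proj 𝒜).ringCatSheaf.obj.obj U) ((twistAb 𝒜 d).obj U) :=
  twistModule 𝒜 d U.unop

/-- Serre's twisting sheaf `𝒪(d)` on `Proj 𝒜`. -/
def twist : (Proj 𝒜).Modules where
  val := PresheafOfModules.ofPresheaf (R := (Proj 𝒜).ringCatSheaf.obj) (twistAb 𝒜 d)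
    (fun _ _ _ _ _ => rfl)
  isSheaf := by
    have h : TopCat.Presheaf.IsSheaf (twistAb 𝒜 d) :=
      (TopCat.Presheaf.isSheaf_iff_isSheaf_comp (forget Ab) _).mpr
        (TopCat.Presheaf.isSheaf_of_iso (NatIso.ofComponents (fun _ => Iso.refl _) (by cat_disch))
          (TopCat.subsheafToTypes (twistLocal 𝒜 d)).property)
    exact h

end Twist

/-! ### The additive group -/

section AdditiveGroup

variable (S : Scheme.{u})

/-- The functor `T ↦ (Γ(T, 𝒪_T), +)` on `S`-schemes. -/
def sectionsFunctor : (Over S)ᵒᵖ ⥤ AddGrpCat.{u} where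
  obj T := AddGrpCat.of Γ(T.unop.left, ⊤)
  map f := AddGrpCat.ofHom (f.unop.left.appTop.hom : _ →+ _)

/-- The affine line over `S`. -/
def Ga : Over S := Over.mk (𝔸(PUnit.{u+1}; S) ↘ S)

/-- The affine line represents the functor of global sections. -/
def gaRepresentableBy : (sectionsFunctor S ⋙ forget AddGrpCat.{u}).RepresentableBy (Ga S) where
  homEquiv {T} :=
    { toFun f := f.left.appTop (AffineSpace.coord S PUnit.unit)
      invFun a := Over.homMk (AffineSpace.homOfVector T.hom fun _ => a)
        (AffineSpace.homOfVector_over _ _)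
      left_inv f := by
        ext1
        apply AffineSpace.hom_ext
        · exact (AffineSpace.homOfVector_over _ _).trans (Over.w f).symm
        · intro i
          exact AffineSpace.homOfVector_appTop_coord _ _ _
      right_inv a := AffineSpace.homOfVector_appTop_coord _ _ _ }
  homEquiv_comp f g := rfl

/-- The group law of `𝔾ₐ`: addition of global sections. -/
instance : AddGrpObj (Ga S) :=
  AddGrpObj.ofRepresentableBy (Ga S) (sectionsFunctor S) (gaRepresentableBy S)

end AdditiveGroup

/-! ### Group actions and linearizations -/

open MonoidalCategory CartesianMonoidalCategory Scheme.Modules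

/-- The pullback of an isomorphism `f^* L ≅ g^* L` along `h`, as an isomorphism
`(h ≫ f)^* L ≅ (h ≫ g)^* L`. -/
def pullIso {T Y X : Scheme.{u}} (h : T ⟶ Y) {f g : Y ⟶ X} {L : X.Modules}
    (Φ : (pullback f).obj L ≅ (pullback g).obj L) {f' g' : T ⟶ X}
    (hf : h ≫ f = f') (hg : h ≫ g = g') : (pullback f').obj L ≅ (pullback g').obj L :=
  (pullbackCongr hf).symm.app L ≪≫ (pullbackComp h f).symm.app L ≪≫ (pullback h).mapIso Φ ≪≫
    (pullbackComp h g).app L ≪≫ (pullbackCongr hg).app L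

section Linearization

variable {S : Scheme.{u}} (G : Over S) [AddGrpObj G] (X : Over S) [AddModObj G X]

/-- The action morphism `(g, x) ↦ g x`. -/
def action : G ⊗ X ⟶ X := AddModObj.vadd (M := G) (X := X)

/-- The automorphism `x ↦ t x` of `X` given by an `S`-point `t` of `G`. -/
def pointAction (t : 𝟙_ (Over S) ⟶ G) : X ⟶ X :=
  lift (toUnit X ≫ t) (𝟙 X) ≫ action G X

/-- A `G`-linearization of `L`: an isomorphism `Φ : a^* L ≅ p^* L` on `G × X`, where `a` is the
action and `p` the projection, so that `Φ` has components `Φ(g, x) : L(g x) ≅ L(x)`, with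
the cocycle condition `Φ(g + h, x) = Φ(h, x) ∘ Φ(g, h x)` on `G × G × X`. -/
structure Linearization (L : X.left.Modules) where
  iso : (pullback (action G X).left).obj L ≅ (pullback (snd G X).left).obj L
  cocycle :
    pullIso (((α_ G G X).inv ≫ AddMonObj.add ▷ X).left) iso
        (f' := (G ◁ action G X ≫ action G X).left) (g' := (snd G (G ⊗ X) ≫ snd G X).left)
        (by
          rw [← Over.comp_left]
          congr 1
          rw [Category.assoc, Iso.inv_comp_eq]
          exact AddModObj.add_vadd (M := G) X)
        (by rw [← Over.comp_left]; congr 1; simp) =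
      pullIso (G ◁ action G X).left iso rfl
          (g' := (snd G (G ⊗ X) ≫ action G X).left)
          (by rw [← Over.comp_left]; congr 1; simp) ≪≫
        pullIso (snd G (G ⊗ X)).left iso rfl rfl

variable {G X} {L : X.left.Modules}

/-- The isomorphism `t^* L ≅ L` obtained by restricting a linearization to `{t} × X`. -/
def Linearization.isoAt (Φ : Linearization G X L) (t : 𝟙_ (Over S) ⟶ G) :
    (pullback (pointAction G X t).left).obj L ≅ L :=
  pullIso (lift (toUnit X ≫ t) (𝟙 X)).left Φ.iso rfl
    (g' := 𝟙 X.left) (by rw [← Over.comp_left, lift_snd]; rfl) ≪≫ (pullbackId X.left).app L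

/-- The global sections `H⁰(X, L)`. -/
def H0 {X : Scheme.{u}} (L : X.Modules) : Type u := Γ(L, ⊤)

instance {X : Scheme.{u}} (L : X.Modules) : AddCommGroup (H0 L) :=
  inferInstanceAs (AddCommGroup Γ(L, ⊤))

/-- The pullback of global sections. -/
def pullSection {X Y : Scheme.{u}} (f : X ⟶ Y) (L : Y.Modules) :
    H0 L →+ H0 ((pullback f).obj L) :=
  (((pullbackPushforwardAdjunction f).unit.app L).app ⊤).hom

/-- The action of the `S`-point `t` of the (commutative) group `G` on `H⁰(X, L)` induced by a
linearization: `(t s)(x) = Φ(t, x) (s (t x))`. -/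
def Linearization.act (Φ : Linearization G X L) (t : 𝟙_ (Over S) ⟶ G) : H0 L →+ H0 L :=
  AddMonoidHom.comp ((Φ.isoAt t).hom.app ⊤).hom (pullSection (pointAction G X t).left L)

end Linearization

/-- The structure map `k → Γ(X, 𝒪_X)` of a `k`-scheme. -/
def scalars {k : Type u} [Field k] (X : Over (Spec (.of k))) : k →+* Γ(X.left, ⊤) :=
  ((Scheme.ΓSpecIso (.of k)).inv ≫ X.hom.appTop).hom

/-- The global sections of a sheaf of modules on a `k`-scheme form a `k`-vector space. -/
instance {k : Type u} [Field k] (X : Over (Spec (.of k))) (L : X.left.Modules) :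
    Module k (H0 L) :=
  letI : Module Γ(X.left, ⊤) (H0 L) := inferInstanceAs (Module Γ(X.left, ⊤) Γ(L, ⊤))
  Module.compHom _ (scalars X)

/-! ### Projective space, lines and cones -/

section Projective

attribute [local instance] MvPolynomial.gradedAlgebra

variable (k : Type u) [Field k] (N : ℕ)

/-- The polynomial ring in `N + 1` variables, graded by degree. -/
abbrev coordRing : ℕ → Submodule k (MvPolynomial (Fin (N + 1)) k) :=
  MvPolynomial.homogeneousSubmodule (Fin (N + 1)) k

/-- Projective space `ℙᴺ` over `k`. -/
def Pn : Over (Spec (.of k)) :=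
  Over.mk (Y := Proj (coordRing k N)) (Proj.toSpecZero (coordRing k N) ≫
    Spec.map (CommRingCat.ofHom (algebraMap k (coordRing k N 0))))

/-- The sheaf `𝒪(1)` on `ℙᴺ`. -/
def O1 : (Pn k N).left.Modules := twist (coordRing k N) 1

variable {k N}

/-- The homogeneous polynomial `l` vanishes at the point `p` of `ℙᴺ`. -/
def Vanishes (l : MvPolynomial (Fin (N + 1)) k) (p : (Pn k N).left) : Prop :=
  l ∈ ProjectiveSpectrum.asHomogeneousIdeal (show ProjectiveSpectrum (coordRing k N) from p)

/-- The linear span of two points of `ℙᴺ`, i.e. the common zero set of the linear forms that vanish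
at both. If the field is algebraically closed and `p ≠ q` are closed points, this is the line
through `p` and `q`. -/
def line (p q : (Pn k N).left) : Set (Pn k N).left :=
  {z | ∀ l ∈ coordRing k N 1, Vanishes l p → Vanishes l q → Vanishes l z}

/-- `Z` is a cone with vertex `v`: with every other closed point it contains the line joining it
to `v`. These lines are the generators of the cone. -/
def IsConeWithVertex (Z : Set (Pn k N).left) (v : (Pn k N).left) : Prop :=
  IsClosed {v} ∧ v ∈ Z ∧ ∀ z ∈ Z, IsClosed {z} → z ≠ v → line v z ⊆ Z

variable (X : Over (Spec (.of k)))

/-- `X` is projective over `k`. -/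
def IsProjective : Prop := ∃ (N : ℕ) (φ : X ⟶ Pn k N), IsClosedImmersion φ.left

variable {X}

/-- `φ` is a closed embedding into projective space with `φ^* 𝒪(1) ≅ L`. -/
def IsEmbeddingBy (L : X.left.Modules) (φ : X ⟶ Pn k N) : Prop :=
  IsClosedImmersion φ.left ∧ Nonempty ((pullback φ.left).obj (O1 k N) ≅ L)

/-- `L` is very ample over `k`: it is the pullback of `𝒪(1)` under an immersion into some `ℙᴺ`. -/
def IsVeryAmple (L : X.left.Modules) : Prop :=
  ∃ (N : ℕ) (φ : X ⟶ Pn k N), IsImmersion φ.left ∧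
    Nonempty ((pullback φ.left).obj (O1 k N) ≅ L)

end Projective

/-- All local rings of `X` are integrally closed. -/
def IsNormal (X : Scheme.{u}) : Prop := ∀ x : X, IsIntegrallyClosed (X.presheaf.stalk x)

/-- `L` is locally isomorphic to the structure sheaf. -/
def IsLineBundle {X : Scheme.{u}} (L : X.Modules) : Prop :=
  ∀ x : X, ∃ U : X.Opens, x ∈ U ∧
    Nonempty (L.restrict U.ι ≅ SheafOfModules.unit (U : Scheme.{u}).ringCatSheaf)

end

end GaCone

open GaCone MonoidalCategory CartesianMonoidalCategory

namespace GaCone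

noncomputable section

/-! ### Sections on `Proj` -/

/-! Part (1). Choose a linear functional `χ` on `H⁰(X, L)` whose kernel lies in `W`. Composed with
the restriction of linear forms from `ℙᴺ`, it becomes a functional on linear forms, that is,
evaluation at a vector `P`. Forms vanishing at `P` restrict into `W`, so the group fixes their
restrictions, and they vanish at `t x` exactly when they vanish at `x` (`exists_direction`). Hence
`t x` lies on the line through `P` and `x`: if `x` has coordinates `w`, then `t x` has coordinates
`w + c P` (`exists_hasCoords_add`).

Since the action is nontrivial, some `t₀` moves the closed points of a nonempty, hence dense, open
set. The orbit of such a point is infinite, because it comes from the irreducible variety `𝔾ₐ` and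
is not a single point (`infinite_orbit`). So the line joining the point to `P` meets `X` infinitely
often and lies in `X`. The structure `IsConical` records this for a dense family of vectors;
polynomial identities then spread it to all closed points and show that `P` itself lies on `X`
(`exists_vertex`).

Part (2). The tangent space of a cone at its vertex contains all generators, so it is the whole
linear span. Let `r` be the projective dimension of the span. In an affine chart `𝔸ʳ` of the span
centred at the vertex, the equations of `X` have no constant and no linear terms
(`IsConical.eval_sum_pderiv`). Smoothness makes the differentials near the vertex free of rank `n`.
They are generated by `dx₁, …, dxᵣ`, and the first order expansion at the origin gives `r ≤ n`; so
`r = n` and the `dxᵢ` form a basis. For an equation `g`, the relation `∑ (∂ᵢ g) dxᵢ = 0` then says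
that all `∂ᵢ g` are equations too. A prime ideal stable under partial derivatives is zero: an
element of minimal degree would have zero derivatives, so it would be a constant or, in
characteristic `p`, a `p`-th power whose root also lies in the ideal (`eq_bot_of_pderiv_mem`,
`injective_of_standardSmooth`). Thus `X` is a linear subspace. Being reduced, it is identified with
the image of a linear embedding of `ℙⁿ` (`exists_iso_of_range_eq`), and `pullback_iso_of_linear`
matches the line bundles. -/

lemma isIso_map_homOfLE {X : Scheme.{u}} {C : Type*} [Category C] (F : X.Opensᵒᵖ ⥤ C)
    {U V : X.Opens} (h : U = V) : IsIso (F.map (homOfLE h.le).op) := by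
  subst h
  have : homOfLE (le_refl U) = 𝟙 U := rfl
  rw [this]
  infer_instance

section ProjSections

variable {A : Type u} {σ : Type*} [CommRing A] [SetLike σ A] [AddSubgroupClass σ A]
variable (𝒜 : ℕ → σ) [GradedRing 𝒜]

lemma mem_basicOpen_iff_isUnit {U : (Proj 𝒜).Opens} (s : Γ(Proj 𝒜, U)) (x : Proj 𝒜) (hx : x ∈ U) :
    x ∈ (Proj 𝒜).basicOpen s ↔ IsUnit (s.1 ⟨x, hx⟩) := by
  rw [Scheme.mem_basicOpen (Proj 𝒜) s x hx]
  have h := Proj.stalkIso'_germ 𝒜 U x hx s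
  rw [← h]
  exact (isUnit_map_iff (Proj.stalkIso' 𝒜 x) _).symm

lemma mem_basicOpen_iff_isUnit_val {U : (Proj 𝒜).Opens} (s : Γ(Proj 𝒜, U)) (x : Proj 𝒜)
    (hx : x ∈ U) : x ∈ (Proj 𝒜).basicOpen s ↔ IsUnit (s.1 ⟨x, hx⟩).val := by
  have : x.asHomogeneousIdeal.toIdeal.IsPrime := x.isPrime
  rw [mem_basicOpen_iff_isUnit 𝒜 _ x hx]
  exact (HomogeneousLocalization.isUnit_iff_isUnit_val _ _ _).symm

lemma isUnit_mk_atPrime_iff (x : ProjectiveSpectrum 𝒜) (r t : A) (ht : t ∈ x.asHomogeneousIdeal.toIdeal.primeCompl) :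
    IsUnit (Localization.mk r ⟨t, ht⟩ : LocAt 𝒜 x) ↔ r ∉ x.asHomogeneousIdeal := by
  have : x.asHomogeneousIdeal.toIdeal.IsPrime := x.isPrime
  rw [Localization.mk_eq_mk']
  exact IsLocalization.AtPrime.isUnit_mk'_iff _ x.asHomogeneousIdeal.toIdeal r ⟨t, ht⟩

lemma awayToSection_val {f : A} {d : ℕ} (hf : f ∈ 𝒜 d) {n : ℕ} (a : A) (ha : a ∈ 𝒜 (n • d))
    (x : Proj 𝒜) (hx : x ∈ Proj.basicOpen 𝒜 f) :
    (((Proj.awayToSection 𝒜 f).hom (HomogeneousLocalization.Away.mk 𝒜 hf n a ha)).1 ⟨x, hx⟩).val =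
      (Localization.mk a ⟨f ^ n, fun h => hx (x.isPrime.mem_of_pow_mem _ h)⟩ : LocAt 𝒜 x) := by
  refine (ProjectiveSpectrum.Proj.awayToSection_apply 𝒜 f _ _).trans ?_
  rw [HomogeneousLocalization.Away.val_mk, Localization.mk_eq_mk', IsLocalization.map_mk',
    Localization.mk_eq_mk']
  rfl

lemma mem_basicOpen_awayToSection {f : A} {d : ℕ} (hf : f ∈ 𝒜 d) {n : ℕ} (a : A)
    (ha : a ∈ 𝒜 (n • d)) (x : Proj 𝒜) (hx : x ∈ Proj.basicOpen 𝒜 f) :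
    x ∈ (Proj 𝒜).basicOpen
      ((Proj.awayToSection 𝒜 f).hom (HomogeneousLocalization.Away.mk 𝒜 hf n a ha)) ↔
      a ∉ x.asHomogeneousIdeal := by
  rw [mem_basicOpen_iff_isUnit_val 𝒜 _ x hx, awayToSection_val]
  exact isUnit_mk_atPrime_iff 𝒜 x a _ _

/-- `Proj.toSpecZero` is built from the chart `D₊(1)`, which is all of `Proj`. Unwinding it there
shows that an element of degree zero becomes the fraction `c / 1` at every point. -/
lemma toSpecZero_section_val (c : 𝒜 0) (x : Proj 𝒜) :
    HomogeneousLocalization.val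
      ((show Γ(Proj 𝒜, ⊤) from
        ((Scheme.ΓSpecIso (.of (𝒜 0))).inv ≫ (Proj.toSpecZero 𝒜).appTop).hom c).1 ⟨x, trivial⟩) =
      algebraMap _ _ (c : A) := by
  have key : (Scheme.ΓSpecIso (.of (𝒜 0))).inv ≫ (Proj.toSpecZero 𝒜).appTop =
      CommRingCat.ofHom (HomogeneousLocalization.fromZeroRingHom 𝒜 (Submonoid.powers (1 : A))) ≫
        Proj.awayToSection 𝒜 1 ≫
          (Proj 𝒜).presheaf.map (eqToHom (Proj.basicOpen_one 𝒜).symm).op := by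
    rw [Proj.toSpecZero]
    simp only [Scheme.Hom.comp_appTop, Category.assoc]
    rw [← Category.assoc, ← Scheme.ΓSpecIso_inv_naturality, Category.assoc]
    congr 1
    have h := Proj.basicOpenToSpec_app_top 𝒜 1
    have e : (Proj.basicOpen 𝒜 1).ι ≫ (Scheme.topIso (Proj 𝒜)).inv ≫
        (Scheme.isoOfEq _ (Proj.basicOpen_one 𝒜)).inv = 𝟙 _ := by
      rw [← Category.assoc, Iso.comp_inv_eq, Iso.comp_inv_eq]
      simp
    have e' := congrArg (fun f : (Proj.basicOpen 𝒜 1).toScheme ⟶ (Proj.basicOpen 𝒜 1).toScheme =>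
      f.appTop) e
    simp only [Scheme.Hom.comp_appTop, Scheme.Hom.id_appTop, Category.assoc] at e'
    have h' : (Proj.basicOpenToSpec 𝒜 1).appTop = _ := h
    rw [h']
    simp only [Category.assoc, Iso.inv_hom_id_assoc]
    congr 1
    have : Mono (Scheme.Hom.appTop (Proj.basicOpen 𝒜 1).ι) := by
      rw [Scheme.Opens.ι_appTop]
      have := isIso_map_homOfLE (Proj 𝒜).presheaf (U := (Proj.basicOpen 𝒜 1).ι ''ᵁ ⊤) (V := ⊤)
        (by simp)
      exact @IsIso.mono_of_iso _ _ _ _ _ this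
    rw [← cancel_mono (Scheme.Hom.appTop (Proj.basicOpen 𝒜 1).ι)]
    simp only [Category.assoc]
    rw [e', Category.comp_id, Scheme.Opens.topIso_inv, Scheme.Opens.ι_appTop]
    ext s
    rfl
  rw [key]
  refine (ProjectiveSpectrum.Proj.awayToSection_apply 𝒜 1 _
    ⟨x, (Proj.basicOpen_one 𝒜).ge (Set.mem_univ x)⟩).trans ?_
  have : HomogeneousLocalization.val ((CommRingCat.ofHom
      (HomogeneousLocalization.fromZeroRingHom 𝒜 (Submonoid.powers (1 : A)))).hom' c) =
      algebraMap A (Localization (Submonoid.powers (1 : A))) c := by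
    rw [← Localization.mk_one_eq_algebraMap]
    exact HomogeneousLocalization.val_mk _
  rw [this, IsLocalization.map_eq]
  rfl

end ProjSections

/-! ### Constants on projective space, and linear forms as sections of `𝒪(1)`. -/

section Scalars
attribute [local instance] MvPolynomial.gradedAlgebra
variable {k : Type u} [Field k] {N : ℕ}

lemma scalars_Pn_val (c : k) (x : (Pn k N).left) :
    HomogeneousLocalization.val
      ((show Γ(Proj (coordRing k N), ⊤) from scalars (Pn k N) c).1 ⟨x, trivial⟩) =
      algebraMap _ _ (MvPolynomial.C (σ := Fin (N + 1)) c) := by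
  refine Eq.trans ?_ (toSpecZero_section_val (coordRing k N) (algebraMap k (coordRing k N 0) c) x)
  have h : (Scheme.ΓSpecIso (.of k)).inv ≫ (Pn k N).hom.appTop =
      CommRingCat.ofHom (algebraMap k (coordRing k N 0)) ≫
        (Scheme.ΓSpecIso (.of (coordRing k N 0))).inv ≫ (Proj.toSpecZero (coordRing k N)).appTop := by
    rw [← Category.assoc, Scheme.ΓSpecIso_inv_naturality]
    rfl
  rw [scalars, h]
  rfl

/-- The value of a section of `𝒪(1)` in the localization at a point. -/
def secVal {U : (Pn k N).left.Opens} (f : Γ(O1 k N, U)) (x : (Pn k N).left) (hx : x ∈ U) :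
    LocAt (coordRing k N) x :=
  (show twistSections (coordRing k N) 1 U from f).1 ⟨x, hx⟩

/-- A linear form as a global section of `𝒪(1)`. -/
def linSectionFun (l : coordRing k N 1) : H0 (O1 k N) :=
  (⟨fun x => algebraMap _ _ (l : MvPolynomial (Fin (N + 1)) k), fun x =>
    ⟨⊤, trivial, 𝟙 _, 0, l, 1, by simp, SetLike.GradedOne.one_mem,
      fun y => (Ideal.ne_top_iff_one _).1 (ProjectiveSpectrum.isPrime y.1).ne_top, fun y =>
        (Localization.mk_one_eq_algebraMap _).symm⟩⟩ :
      twistSections (coordRing k N) 1 ⊤)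

lemma secVal_ext {U : (Pn k N).left.Opens} {f g : Γ(O1 k N, U)}
    (h : ∀ x hx, secVal f x hx = secVal g x hx) : f = g :=
  Subtype.ext (funext fun x => h x.1 x.2)

lemma secVal_smul {U : (Pn k N).left.Opens} (a : Γ((Pn k N).left, U)) (f : Γ(O1 k N, U))
    (x : (Pn k N).left) (hx : x ∈ U) :
    secVal (a • f) x hx =
      ((show Γ(Proj (coordRing k N), U) from a).1 ⟨x, hx⟩).val * secVal f x hx := rfl

lemma secVal_linSectionFun (l : coordRing k N 1) (x : (Pn k N).left) :
    secVal (U := ⊤) (linSectionFun l) x trivial =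
      algebraMap _ _ (l : MvPolynomial (Fin (N + 1)) k) := rfl

lemma H0_smul_def {X : Over (Spec (.of k))} (L : X.left.Modules) (c : k) (s : H0 L) :
    c • s = (scalars X c • (show Γ(L, ⊤) from s) : Γ(L, ⊤)) := rfl

/-- The global section of `𝒪(1)` given by a linear form. -/
def linSection : coordRing k N 1 →ₗ[k] H0 (O1 k N) where
  toFun l := linSectionFun l
  map_add' l l' := secVal_ext (U := ⊤) fun x _ => by
    rw [secVal_linSectionFun]
    exact map_add _ _ _
  map_smul' c l := secVal_ext (U := ⊤) fun x _ => by
    rw [secVal_linSectionFun, RingHom.id_apply, H0_smul_def, secVal_smul, secVal_linSectionFun]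
    erw [scalars_Pn_val]
    rw [← map_mul, ← MvPolynomial.smul_eq_C_mul]
    rfl

end Scalars

/-! ### Vanishing of sections along a morphism -/

section Vanishing
open Scheme.Modules

/-- A global section of `L` vanishes along `f : Y ⟶ X` if it is killed by all morphisms from `L` to
pushforwards along `f`, equivalently, if its pullback along `f` is zero. -/
def VanishesAlong {X Y : Scheme.{u}} (f : Y ⟶ X) {L : X.Modules} (s : H0 L) : Prop :=
  ∀ (F : Y.Modules) (β : L ⟶ (pushforward f).obj F), β.app ⊤ s = 0

lemma VanishesAlong.map {X Y : Scheme.{u}} {f : Y ⟶ X} {L L' : X.Modules} {s : H0 L}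
    (h : VanishesAlong f s) (e : L ⟶ L') : VanishesAlong f (L := L') (e.app ⊤ s) :=
  fun F β => h F (e ≫ β)

lemma vanishesAlong_iso {X Y : Scheme.{u}} (f : Y ⟶ X) {L L' : X.Modules} (s : H0 L)
    (e : L ≅ L') : VanishesAlong f (L := L') (e.hom.app ⊤ s) ↔ VanishesAlong f s := by
  refine ⟨fun h => ?_, fun h => h.map e.hom⟩
  have h' := h.map e.inv
  have e1 : e.inv.app ⊤ (e.hom.app ⊤ s) = s := by
    have := congrArg (fun g : L ⟶ L => g.app ⊤ s) e.hom_inv_id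
    exact this
  rwa [e1] at h'

/-- Both directions are the adjunction between pullback and pushforward. Testing against morphisms
into pushforwards thus gives a notion of vanishing that composes without any description of the
sections of a pullback. -/
lemma vanishesAlong_comp {X Y Z : Scheme.{u}} (p : Z ⟶ Y) (f : Y ⟶ X) {L : X.Modules} (s : H0 L) :
    VanishesAlong (p ≫ f) s ↔ VanishesAlong p (pullSection f L s) := by
  constructor
  · intro h F γ
    exact h F (((pullbackPushforwardAdjunction f).homEquiv L _ γ) ≫
      (pushforwardComp p f).hom.app F)
  · intro h F β
    let β' : L ⟶ (pushforward f).obj ((pushforward p).obj F) :=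
      β ≫ (pushforwardComp p f).inv.app F
    have h1 := h F (((pullbackPushforwardAdjunction f).homEquiv L _).symm β')
    have h2 : ((pullbackPushforwardAdjunction f).homEquiv L _
      (((pullbackPushforwardAdjunction f).homEquiv L _).symm β')).app ⊤ s = 0 := h1
    rw [Equiv.apply_symm_apply] at h2
    exact h2

/-- A morphism of modules, from additive maps on sections. -/
def moduleHomMk {X : Scheme.{u}} {M N : X.Modules} (φ : ∀ U : X.Opens, Γ(M, U) →+ Γ(N, U))
    (hsmul : ∀ U (r : Γ(X, U)) (m : Γ(M, U)), φ U (r • m) = r • φ U m)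
    (hres : ∀ U V (i : V ⟶ U) (m : Γ(M, U)),
      φ V (M.presheaf.map i.op m) = N.presheaf.map i.op (φ U m)) : M ⟶ N :=
  ⟨PresheafOfModules.homMk
    { app := fun U => AddCommGrpCat.ofHom (φ U.unop)
      naturality := fun U V i => by
        ext m
        exact hres _ _ i.unop m }
    (fun U r m => hsmul U.unop r m)⟩

/-- The structure sheaf, as a module. -/
def structureModule (X : Scheme.{u}) : X.Modules := SheafOfModules.unit X.ringCatSheaf

end Vanishing

/-! ### Linear forms generate `𝒪(1)` where they do not vanish; vanishing of a linear form at a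
rational point. -/

section Division
attribute [local instance] MvPolynomial.gradedAlgebra
open Scheme.Modules
variable {k : Type u} [Field k] {N : ℕ}

/-- A point of `ℙᴺ` as a homogeneous prime ideal. -/
abbrev homPrime (x : (Pn k N).left) : ProjectiveSpectrum (coordRing k N) := x

/-- The section of `𝒪(1)` over `U` given by a linear form. -/
def linOn (l : coordRing k N 1) (U : (Pn k N).left.Opens) : Γ(O1 k N, U) :=
  (O1 k N).presheaf.map (homOfLE le_top : U ⟶ ⊤).op (linSection l)

lemma secVal_linOn (l : coordRing k N 1) (U : (Pn k N).left.Opens) (x : (Pn k N).left)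
    (hx : x ∈ U) : secVal (linOn l U) x hx =
      algebraMap _ _ (l : MvPolynomial (Fin (N + 1)) k) := rfl

lemma res_linOn (l : coordRing k N 1) {U V : (Pn k N).left.Opens} (i : V ⟶ U) :
    (O1 k N).presheaf.map i.op (linOn l U) = linOn l V := rfl

/-- The open set where the form `l` does not vanish. -/
def nonvanishing (l : MvPolynomial (Fin (N + 1)) k) : (Pn k N).left.Opens :=
  Proj.basicOpen (coordRing k N) l

lemma algebraMap_isUnit_of_mem {l : MvPolynomial (Fin (N + 1)) k} {x : (Pn k N).left}
    (hx : x ∈ nonvanishing l) :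
    IsUnit (algebraMap (MvPolynomial (Fin (N + 1)) k) (LocAt (coordRing k N) x) l) :=
  IsLocalization.map_units (M := (homPrime x).asHomogeneousIdeal.toIdeal.primeCompl) _ ⟨l, hx⟩

lemma smul_linOn_injective (l : coordRing k N 1) {U : (Pn k N).left.Opens}
    (hU : U ≤ nonvanishing l.1) {g g' : Γ((Pn k N).left, U)}
    (h : g • linOn l U = g' • linOn l U) : g = g' := by
  refine Subtype.ext (funext fun x => HomogeneousLocalization.val_injective _ ?_)
  have h1 := congrArg (fun f : Γ(O1 k N, U) => secVal f x.1 x.2) h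
  exact (algebraMap_isUnit_of_mem (hU x.2)).mul_left_injective h1

lemma exists_smul_linOn (l : coordRing k N 1) {U : (Pn k N).left.Opens}
    (hU : U ≤ nonvanishing l.1) (f : Γ(O1 k N, U)) : ∃ g : Γ((Pn k N).left, U),
      g • linOn l U = f := by
  have hf := (show twistSections (coordRing k N) 1 U from f).2
  choose V hxV iV j r s hr hs hsV hV using hf
  have hsl (x : U) (y : (Pn k N).left) (hy : y ∈ V x) :
      s x * l.1 ∈ (homPrime y).asHomogeneousIdeal.toIdeal.primeCompl :=
    fun h => ((ProjectiveSpectrum.isPrime _).mem_or_mem h).elim (hsV x ⟨y, hy⟩)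
      (hU ((iV x).le hy))
  -- If `f = r / s` near `x`, then `f / l = r / (s l)`, a fraction of degree zero. These local
  -- quotients agree on overlaps because `l` is a unit there.
  let q (x : U) (y : (Pn k N).left) (hy : y ∈ V x) :
    HomogeneousLocalization.AtPrime (coordRing k N) (homPrime y).asHomogeneousIdeal.toIdeal :=
    HomogeneousLocalization.mk ⟨j x + 1, ⟨r x, hr x⟩,
      ⟨s x * l.1, SetLike.mul_mem_graded (hs x) l.2⟩, hsl x y hy⟩
  have hq (x : U) (y : (Pn k N).left) (hy : y ∈ V x) :
      (q x y hy).val * algebraMap _ _ l.1 = secVal f y ((iV x).le hy) := by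
    refine Eq.trans ?_ (hV x ⟨y, hy⟩).symm
    rw [HomogeneousLocalization.val_mk, ← Localization.mk_one_eq_algebraMap, Localization.mk_mul,
      Localization.mk_eq_mk_iff, Localization.r_iff_exists]
    refine ⟨1, ?_⟩
    simp
    ring
  refine ⟨(⟨fun x => q x x.1 (hxV x), fun x => ⟨V x, hxV x, iV x, j x + 1, ⟨r x, hr x⟩,
    ⟨s x * l.1, SetLike.mul_mem_graded (hs x) l.2⟩, fun y => hsl x y.1 y.2, fun y => ?_⟩⟩ :
      (ProjectiveSpectrum.Proj.structureSheaf (coordRing k N)).1.obj (op U)), ?_⟩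
  · refine HomogeneousLocalization.val_injective _ ?_
    refine (algebraMap_isUnit_of_mem (hU ((iV x).le y.2))).mul_left_injective ?_
    exact (hq _ _ (hxV _)).trans (hq x y.1 y.2).symm
  · refine secVal_ext fun x hx => ?_
    exact hq ⟨x, hx⟩ x (hxV ⟨x, hx⟩)

/-- The quotient of a section of `𝒪(1)` by a linear form without zeros. -/
def divLin (l : coordRing k N 1) {U : (Pn k N).left.Opens}
    (hU : U ≤ nonvanishing l.1) (f : Γ(O1 k N, U)) : Γ((Pn k N).left, U) :=
  (exists_smul_linOn l hU f).choose

lemma divLin_smul (l : coordRing k N 1) {U : (Pn k N).left.Opens}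
    (hU : U ≤ nonvanishing l.1) (f : Γ(O1 k N, U)) : divLin l hU f • linOn l U = f :=
  (exists_smul_linOn l hU f).choose_spec

lemma divLin_eq (l : coordRing k N 1) {U : (Pn k N).left.Opens}
    (hU : U ≤ nonvanishing l.1) {f : Γ(O1 k N, U)} {g : Γ((Pn k N).left, U)}
    (h : g • linOn l U = f) : divLin l hU f = g :=
  smul_linOn_injective l hU ((divLin_smul l hU f).trans h.symm)

lemma divLin_add (l : coordRing k N 1) {U : (Pn k N).left.Opens}
    (hU : U ≤ nonvanishing l.1) (f g : Γ(O1 k N, U)) :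
    divLin l hU (f + g) = divLin l hU f + divLin l hU g :=
  divLin_eq l hU (by rw [add_smul, divLin_smul, divLin_smul])

lemma divLin_smul_left (l : coordRing k N 1) {U : (Pn k N).left.Opens}
    (hU : U ≤ nonvanishing l.1) (r : Γ((Pn k N).left, U)) (f : Γ(O1 k N, U)) :
    divLin l hU (r • f) = r * divLin l hU f :=
  divLin_eq l hU (by rw [mul_smul, divLin_smul])

lemma divLin_res (l : coordRing k N 1) {U V : (Pn k N).left.Opens}
    (hU : U ≤ nonvanishing l.1) (i : V ⟶ U) (f : Γ(O1 k N, U)) :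
    divLin l (i.le.trans hU) ((O1 k N).presheaf.map i.op f) =
      (Pn k N).left.presheaf.map i.op (divLin l hU f) :=
  divLin_eq l _ (by
    rw [← res_linOn l i, ← Scheme.Modules.map_smul, divLin_smul])

variable {T : Scheme.{u}} (q : T ⟶ (Pn k N).left) (l : coordRing k N 1)
  (hq : ∀ U : (Pn k N).left.Opens, q ⁻¹ᵁ U ≤ q ⁻¹ᵁ (U ⊓ nonvanishing l.1))

/-- Evaluation of sections of `𝒪(1)` along a morphism to the locus where `l` does not vanish, by
division by `l`. -/
def evalSection (U : (Pn k N).left.Opens) : Γ(O1 k N, U) →+ Γ(T, q ⁻¹ᵁ U) :=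
  AddMonoidHom.mk' (fun f => (q.appLE (U ⊓ nonvanishing l.1) (q ⁻¹ᵁ U) (hq U)).hom
    (divLin l inf_le_right ((O1 k N).presheaf.map (homOfLE inf_le_left).op f)))
    (fun f g => by rw [map_add, divLin_add, map_add])

lemma evalSection_smul (U : (Pn k N).left.Opens) (r : Γ((Pn k N).left, U)) (m : Γ(O1 k N, U)) :
    evalSection q l hq U (r • m) = (q.app U).hom r * evalSection q l hq U m := by
  simp only [evalSection, AddMonoidHom.mk'_apply]
  rw [Scheme.Modules.map_smul, divLin_smul_left, map_mul]
  refine congrArg (· * _) ?_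
  have := Scheme.Hom.map_appLE q (hq U) (homOfLE (inf_le_left (a := U) (b := nonvanishing l.1))).op
  refine Eq.trans (congrArg (fun φ => φ.hom r) this) ?_
  rw [Scheme.Hom.appLE_eq_app]

lemma evalSection_res {U V : (Pn k N).left.Opens} (i : V ⟶ U) (m : Γ(O1 k N, U)) :
    evalSection q l hq V ((O1 k N).presheaf.map i.op m) =
      T.presheaf.map ((Opens.map q.base).map i).op (evalSection q l hq U m) := by
  simp only [evalSection, AddMonoidHom.mk'_apply]
  have h1 : (O1 k N).presheaf.map (homOfLE (inf_le_left (a := V) (b := nonvanishing l.1))).op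
      ((O1 k N).presheaf.map i.op m) = (O1 k N).presheaf.map
        (homOfLE (inf_le_inf_right (nonvanishing l.1) i.le)).op
        ((O1 k N).presheaf.map (homOfLE inf_le_left).op m) := rfl
  rw [h1, divLin_res l inf_le_right]
  have h2 := Scheme.Hom.map_appLE q (hq V)
    (homOfLE (inf_le_inf_right (nonvanishing l.1) i.le)).op
  have h2' := fun z => congrArg (fun φ => φ.hom z) h2
  refine (h2' _).trans ?_
  have h3 := Scheme.Hom.appLE_map q (hq U) ((Opens.map q.base).map i).op
  have h3' := fun z => congrArg (fun φ => φ.hom z) h3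
  exact (h3' _).symm

/-- Evaluation of sections of `𝒪(1)` as a morphism of modules. -/
def evalHom : O1 k N ⟶ (pushforward q).obj (structureModule T) :=
  moduleHomMk (evalSection q l hq) (evalSection_smul q l hq)
    (fun _ _ i m => evalSection_res q l hq i m)

/-- The morphism `evalHom` carries `l` to `1`, so it witnesses that `l` does not vanish along `q`.
-/
lemma evalHom_linSection :
    (evalHom q l hq).app ⊤ (linSection l) = (1 : Γ(T, q ⁻¹ᵁ ⊤)) := by
  have h : divLin l (inf_le_right : ⊤ ⊓ nonvanishing l.1 ≤ _)
    ((O1 k N).presheaf.map (homOfLE inf_le_left).op (linSection l)) = 1 :=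
      divLin_eq l _ (one_smul _ _)
  refine (congrArg (q.appLE (⊤ ⊓ nonvanishing l.1) (q ⁻¹ᵁ ⊤) (hq ⊤)).hom h).trans ?_
  exact map_one _

/-- A prime containing all variables would contain the irrelevant ideal. -/
lemma exists_variable_notMem (x : (Pn k N).left) :
    ∃ i, ¬ Vanishes (MvPolynomial.X i) x := by
  by_contra! h
  refine (homPrime x).not_irrelevant_le fun f hf => ?_
  have hspan : Ideal.span (MvPolynomial.X '' Set.univ) ≤ (homPrime x).asHomogeneousIdeal.toIdeal :=
    Ideal.span_le.2 (by rintro _ ⟨i, -, rfl⟩; exact h i)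
  refine hspan (MvPolynomial.mem_ideal_span_X_image.2 fun m hm => ?_)
  by_contra! h0
  have hm0 : m = 0 := Finsupp.ext fun i => h0 i trivial
  have hf0 := (HomogeneousIdeal.mem_irrelevant_iff _ _).1 hf
  rw [hm0, MvPolynomial.mem_support_iff] at hm
  apply hm
  have h1 := congrArg (MvPolynomial.coeff 0) hf0
  rw [GradedRing.proj_apply] at h1
  erw [MvPolynomial.decomposition.decompose'_apply] at h1
  simpa [MvPolynomial.coeff_homogeneousComponent] using h1

lemma not_vanishes_of_smul_eq {l m : coordRing k N 1} {U : (Pn k N).left.Opens}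
    {g : Γ((Pn k N).left, U)} (hg : g • linOn m U = linOn l U) {x : (Pn k N).left} (hxU : x ∈ U)
    (hm : ¬ Vanishes m.1 x) (hx : x ∈ (Pn k N).left.basicOpen g) : ¬ Vanishes l.1 x := by
  have hy2 := (mem_basicOpen_iff_isUnit_val (coordRing k N) g x hxU).1 hx
  have h4 : IsUnit (algebraMap _ (LocAt (coordRing k N) x) l.1) := by
    rw [← secVal_linOn l U _ hxU, ← hg, secVal_smul]
    exact hy2.mul (algebraMap_isUnit_of_mem hm)
  rw [← Localization.mk_one_eq_algebraMap] at h4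
  exact (isUnit_mk_atPrime_iff _ _ _ _ _).1 h4

/-- If `l` is nonzero at the point, division by `l` is a morphism that does not kill it. If `l` is
zero there, write `l = g m` near the point with `m` a nonvanishing variable: the pullback of `g` to
`Spec k` is zero, since its nonvanishing locus is empty and `Spec k` is reduced, so every test
morphism kills `l`. -/
lemma vanishesAlong_linSection_iff (q : Spec (.of k) ⟶ (Pn k N).left) (l : coordRing k N 1)
    (p : Spec (.of k)) :
    VanishesAlong q (linSection l) ↔ Vanishes l.1 (q p) := by
  have huniv : ∀ U : (Pn k N).left.Opens, q p ∈ U →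
      q ⁻¹ᵁ U = ⊤ := fun U hU => by
    ext y
    rw [Subsingleton.elim y p]
    exact ⟨fun _ => trivial, fun _ => hU⟩
  constructor
  · intro h
    by_contra hl
    have hq : ∀ U : (Pn k N).left.Opens, q ⁻¹ᵁ U ≤ q ⁻¹ᵁ (U ⊓ nonvanishing l.1) := fun U x hx => by
      rw [Subsingleton.elim x p] at hx ⊢
      exact ⟨hx, hl⟩
    have h1 := h _ (evalHom q l hq)
    rw [evalHom_linSection] at h1
    exact one_ne_zero (α := Γ(Spec (.of k), ⊤)) h1
  · intro hl F β
    obtain ⟨i, hi⟩ := exists_variable_notMem (q p)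
    let m : coordRing k N 1 := ⟨MvPolynomial.X i, MvPolynomial.isHomogeneous_X k i⟩
    obtain ⟨g, hg⟩ := exists_smul_linOn m (le_refl _) (linOn l (nonvanishing m.1))
    have hU : q ⁻¹ᵁ (nonvanishing m.1) = ⊤ := huniv _ hi
    have hg0 : q.app (nonvanishing m.1) g = 0 := by
      rw [← basicOpen_eq_bot_iff, ← Scheme.preimage_basicOpen, ← le_bot_iff]
      intro y hy
      rw [Subsingleton.elim y p] at hy
      exact not_vanishes_of_smul_eq hg hi hi hy hl
    have h5 : β.app _ (linOn l (nonvanishing m.1)) = 0 := by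
      rw [← hg, Hom.app_smul]
      have : ∀ z : Γ(F, q ⁻¹ᵁ (nonvanishing m.1)), (q.app (nonvanishing m.1) g) • z = 0 := by
        intro z; rw [hg0, zero_smul]
      exact this _
    have h6 : F.presheaf.map (homOfLE (le_top : q ⁻¹ᵁ nonvanishing m.1 ≤ ⊤)).op
        (β.app ⊤ (linSection l)) = 0 := by
      refine Eq.trans ?_ h5
      have := β.mapPresheaf.naturality (homOfLE (le_top : nonvanishing m.1 ≤ ⊤)).op
      exact (congrArg (fun φ => φ (linSection l)) this).symm
    have := isIso_map_homOfLE F.presheaf hU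
    have hinj : Function.Injective (F.presheaf.map (homOfLE hU.le).op) :=
      ((ConcreteCategory.isIso_iff_bijective _).1 this).1
    exact hinj (h6.trans (map_zero _).symm)

end Division

/-! ### Coordinates of points -/

section Polynomials
open MvPolynomial

lemma aeval_mul_of_isHomogeneous {σ k R : Type*} [CommRing k] [CommRing R] [Algebra k R]
    {f : MvPolynomial σ k} {d : ℕ} (hf : f.IsHomogeneous d) (t : R) (v : σ → R) :
    aeval (fun i => t * v i) f = t ^ d * aeval v f := by
  rw [aeval_def, aeval_def, eval₂_eq, eval₂_eq, Finset.mul_sum]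
  refine Finset.sum_congr rfl fun m hm => ?_
  have hd := hf.degree_eq_sum_deg_support hm
  simp only [mul_pow, Finset.prod_mul_distrib]
  rw [Finset.prod_pow_eq_pow_sum, ← hd]
  ring

lemma eval_mul_of_isHomogeneous {σ k : Type*} [CommRing k] {f : MvPolynomial σ k} {d : ℕ}
    (hf : f.IsHomogeneous d) (t : k) (v : σ → k) :
    eval (fun i => t * v i) f = t ^ d * eval v f := by
  simpa [aeval_eq_eval] using aeval_mul_of_isHomogeneous hf t v

/-- A polynomial that vanishes at infinitely many points of a line vanishes on the line. -/
lemma eval_line_eq_zero {σ k : Type*} [Field k] {f : MvPolynomial σ k} {u v : σ → k}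
    (h : {b : k | eval (fun i => u i + b * v i) f = 0}.Infinite) (b : k) :
    eval (fun i => u i + b * v i) f = 0 := by
  let g : Polynomial k := aeval (fun i => Polynomial.C (u i) + Polynomial.X * Polynomial.C (v i)) f
  have hg (b : k) : g.eval b = eval (fun i => u i + b * v i) f := by
    have : (Polynomial.aeval b).comp (aeval (fun i => Polynomial.C (u i) +
        Polynomial.X * Polynomial.C (v i))) = aeval (R := k) fun i => u i + b * v i := by
      ext i
      simp only [AlgHom.comp_apply, aeval_X, map_add, map_mul, Polynomial.aeval_C,
        Polynomial.aeval_X, Algebra.algebraMap_self, RingHom.id_apply]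
    have h2 := DFunLike.congr_fun this f
    rwa [aeval_eq_eval] at h2
  have : g = 0 := Polynomial.eq_zero_of_infinite_isRoot g (h.mono fun b hb => (hg b).trans hb)
  rw [← hg, this, Polynomial.eval_zero]

end Polynomials

section Points
attribute [local instance] MvPolynomial.gradedAlgebra
open MvPolynomial
variable {k : Type u} [Field k] {N : ℕ}

lemma vanishes_iff_components (f : MvPolynomial (Fin (N + 1)) k) (x : (Pn k N).left) :
    Vanishes f x ↔ ∀ d, Vanishes (homogeneousComponent d f) x :=
  mem_iff_homogeneousComponent_mem (homPrime x).asHomogeneousIdeal.isHomogeneous f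

lemma eq_of_vanishes_iff {x y : (Pn k N).left}
    (h : ∀ d, ∀ f ∈ coordRing k N d, Vanishes f x ↔ Vanishes f y) : x = y := by
  have : homPrime x = homPrime y := by
    refine ProjectiveSpectrum.ext (HomogeneousIdeal.ext (Ideal.ext fun f => ?_))
    refine (vanishes_iff_components f x).trans (Iff.trans ?_ (vanishes_iff_components f y).symm)
    exact forall_congr' fun d => h d _ (homogeneousComponent_isHomogeneous d f)
  exact this

/-- `w` is a vector of homogeneous coordinates of `z`. -/
def HasCoords (z : (Pn k N).left) (w : Fin (N + 1) → k) : Prop :=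
  ∀ d, ∀ f ∈ coordRing k N d, Vanishes f z ↔ eval w f = 0

lemma HasCoords.ne_zero {z : (Pn k N).left} {w : Fin (N + 1) → k} (h : HasCoords z w) :
    ∃ i, w i ≠ 0 := by
  obtain ⟨i, hi⟩ := exists_variable_notMem z
  refine ⟨i, fun h0 => hi ((h 1 _ (isHomogeneous_X k i)).2 (by simpa using h0))⟩

lemma HasCoords.eq {z z' : (Pn k N).left} {w : Fin (N + 1) → k} (h : HasCoords z w)
    (h' : HasCoords z' w) : z = z' :=
  eq_of_vanishes_iff fun d f hf => (h d f hf).trans (h' d f hf).symm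

lemma HasCoords.smul {z : (Pn k N).left} {w : Fin (N + 1) → k} (h : HasCoords z w) {c : k}
    (hc : c ≠ 0) : HasCoords z (fun i => c * w i) := fun d f hf => by
  rw [h d f hf, eval_mul_of_isHomogeneous hf]
  simp [hc]

/-- Modulo the prime of `z` each variable is `w i` times `X j`, so a form `f` of degree `d` becomes
`f(w)` times `X j ^ d`. As `X j` is not in the prime, only the scalar `f(w)` decides. -/
lemma hasCoords_of_linear {z : (Pn k N).left} {w : Fin (N + 1) → k} {j : Fin (N + 1)}
    (hj : ¬ Vanishes (X j) z) (h : ∀ i, Vanishes (X i - C (w i) * X j) z) : HasCoords z w := by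
  intro d f hf
  let I := (homPrime z).asHomogeneousIdeal.toIdeal
  have hI : I.IsPrime := (homPrime z).isPrime
  have key : Ideal.Quotient.mk I f = Ideal.Quotient.mk I (C (eval w f) * X j ^ d) := by
    have h1 : Ideal.Quotient.mkₐ k I = aeval (fun i => Ideal.Quotient.mk I (X j) *
        algebraMap k (MvPolynomial (Fin (N + 1)) k ⧸ I) (w i)) := by
      ext i
      rw [aeval_X]
      have := Ideal.Quotient.eq.2 (h i)
      refine this.trans ?_
      rw [map_mul, mul_comm]
      rfl
    have h2 := DFunLike.congr_fun h1 f
    rw [aeval_mul_of_isHomogeneous hf] at h2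
    refine h2.trans ?_
    rw [map_mul, map_pow, mul_comm]
    congr 1
    have h3 : aeval (fun i => algebraMap k (MvPolynomial (Fin (N + 1)) k ⧸ I) (w i)) f =
      algebraMap k _ (aeval w f) := aeval_algebraMap_apply _ w f
    rw [h3, aeval_eq_eval]
    rfl
  have h1 : Vanishes f z ↔ C (eval w f) * X j ^ d ∈ I := by
    rw [← Ideal.Quotient.eq_zero_iff_mem, ← key, Ideal.Quotient.eq_zero_iff_mem]
    rfl
  rw [h1]
  constructor
  · intro h
    by_contra h0
    rcases hI.mem_or_mem h with h | h
    · have hu : IsUnit (C (eval w f) : MvPolynomial (Fin (N + 1)) k) := (IsUnit.mk0 _ h0).map C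
      exact hI.ne_top (Ideal.eq_top_of_isUnit_mem _ h hu)
    · exact hj (hI.mem_of_pow_mem _ h)
  · intro h
    rw [h, C_0, zero_mul]
    exact zero_mem _

/-- The section factors through a chart `D₊(X j)` and so corresponds to a ring homomorphism `ε` to
`k`; the coordinates are `ε (X i / X j)`. That `q` is a section of the structure morphism makes `ε`
the identity on constants. -/
lemma exists_hasCoords_of_section (q : Spec (.of k) ⟶ (Pn k N).left) (hq : q ≫ (Pn k N).hom = 𝟙 _)
    (y : Spec (.of k)) : ∃ w, HasCoords (q y) w := by
  obtain ⟨j, hj⟩ := exists_variable_notMem (q y)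
  have hXj : (X j : MvPolynomial (Fin (N + 1)) k) ∈ coordRing k N 1 := isHomogeneous_X k j
  have hXm (i) : (X i : MvPolynomial (Fin (N + 1)) k) ∈ coordRing k N (1 • 1) := isHomogeneous_X k i
  let ι := Proj.awayι (coordRing k N) (X j) hXj one_pos
  have hr : Set.range q ⊆ Set.range ι := by
    rintro _ ⟨y', rfl⟩
    rw [Subsingleton.elim y' y]
    have := Proj.opensRange_awayι (coordRing k N) (X j) hXj one_pos
    have h2 : q y ∈ ι.opensRange := this ▸ hj
    exact h2
  let q' := IsOpenImmersion.lift ι q hr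
  have hq' : q' ≫ ι = q := IsOpenImmersion.lift_fac ι q hr
  let ε := (Spec.preimage q').hom
  have hε : Spec.map (CommRingCat.ofHom ε) = q' := Spec.map_preimage q'
  have hconst (c : k) : ε (HomogeneousLocalization.fromZeroRingHom (coordRing k N) _
      (algebraMap k (coordRing k N 0) c)) = c := by
    have h1 : Spec.map (CommRingCat.ofHom ((ε.comp
        (HomogeneousLocalization.fromZeroRingHom (coordRing k N) _)).comp
          (algebraMap k (coordRing k N 0)))) = 𝟙 _ := by
      rw [← hq, ← hq', ← hε, CommRingCat.ofHom_comp, CommRingCat.ofHom_comp, Spec.map_comp,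
        Spec.map_comp]
      have := Proj.awayι_toSpecZero (coordRing k N) (X j) hXj one_pos
      rw [← this]
      simp only [Category.assoc]
      rfl
    rw [← Spec.map_id] at h1
    exact congrArg (fun φ => φ.hom c) (Spec.map_injective h1)
  have hvan (f : coordRing k N 1) : Vanishes f.1 (q y) ↔
      ε (HomogeneousLocalization.Away.mk (coordRing k N) hXj 1 f.1 (by simp)) = 0 := by
    have h1 : q y ∈ Proj.basicOpen (coordRing k N) f.1 ↔
        q' y ∈ ι ⁻¹ᵁ Proj.basicOpen (coordRing k N) f.1 := by
      rw [← hq']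
      rfl
    rw [Proj.awayι_preimage_basicOpen (coordRing k N) hXj one_pos f.2 one_pos] at h1
    have h2 : HomogeneousLocalization.Away.isLocalizationElem hXj f.2 =
        HomogeneousLocalization.Away.mk (coordRing k N) hXj 1 f.1 (by simp) := by
      simp only [HomogeneousLocalization.Away.isLocalizationElem, pow_one]
    rw [h2, ← hε] at h1
    have h3 : (PrimeSpectrum.asIdeal y) = ⊥ := (Ideal.eq_bot_or_top _).resolve_right
      (PrimeSpectrum.isPrime y).ne_top
    have h4 : ε (HomogeneousLocalization.Away.mk (coordRing k N) hXj 1 f.1 (by simp)) ∈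
        PrimeSpectrum.asIdeal y ↔ Vanishes f.1 (q y) := not_iff_not.1 h1.symm
    rw [← h4, h3, Ideal.mem_bot]
  let w (i : Fin (N + 1)) : k := ε (HomogeneousLocalization.Away.mk (coordRing k N) hXj 1 (X i) (hXm i))
  refine ⟨w, hasCoords_of_linear hj fun i => ?_⟩
  have hl : X i - C (w i) * X j ∈ coordRing k N 1 :=
    sub_mem (isHomogeneous_X k i) (isHomogeneous_C_mul_X _ j)
  refine (hvan ⟨_, hl⟩).2 ?_
  have : HomogeneousLocalization.Away.mk (coordRing k N) hXj 1 (X i - C (w i) * X j)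
      (by simpa using hl) =
      HomogeneousLocalization.Away.mk (coordRing k N) hXj 1 (X i) (hXm i) -
      HomogeneousLocalization.fromZeroRingHom (coordRing k N) _
      (algebraMap k (coordRing k N 0) (w i)) := by
    refine HomogeneousLocalization.val_injective _ ?_
    rw [HomogeneousLocalization.val_sub, HomogeneousLocalization.Away.val_mk,
      HomogeneousLocalization.Away.val_mk]
    have h0 : (HomogeneousLocalization.fromZeroRingHom (coordRing k N) (Submonoid.powers (X j))
      (algebraMap k (coordRing k N 0) (w i))).val =
        algebraMap (MvPolynomial (Fin (N + 1)) k) (Localization (Submonoid.powers (X j)))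
          (C (w i)) := by
      rw [← Localization.mk_one_eq_algebraMap]
      exact HomogeneousLocalization.val_mk _
    rw [h0, ← Localization.mk_one_eq_algebraMap, Localization.sub_mk, Localization.mk_eq_mk_iff,
      Localization.r_iff_exists]
    exact ⟨1, by simp; ring⟩
  rw [this, map_sub, hconst, sub_self]

lemma algebraMap_coordRing_zero_bijective :
    Function.Bijective (algebraMap k (coordRing k N 0)) := by
  refine ⟨fun a b h => C_injective (Fin (N + 1)) k (congrArg Subtype.val h), fun f => ?_⟩
  have : f.1 ∈ homogeneousSubmodule (Fin (N + 1)) k 0 := f.2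
  rw [homogeneousSubmodule_zero, Submodule.mem_one] at this
  obtain ⟨c, hc⟩ := this
  exact ⟨c, Subtype.ext hc⟩

instance : IsProper (Pn k N).hom := by
  have h1 : IsIso (Spec.map (CommRingCat.ofHom (algebraMap k (coordRing k N 0)))) := by
    have : IsIso (CommRingCat.ofHom (algebraMap k (coordRing k N 0))) :=
      (ConcreteCategory.isIso_iff_bijective _).2 algebraMap_coordRing_zero_bijective
    infer_instance
  have : IsScalarTower k (coordRing k N 0) (MvPolynomial (Fin (N + 1)) k) :=
    IsScalarTower.of_algebraMap_eq (R := k) (S := coordRing k N 0)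
      (A := MvPolynomial (Fin (N + 1)) k) fun _ => rfl
  have h2 : Algebra.FiniteType (coordRing k N 0) (MvPolynomial (Fin (N + 1)) k) :=
    Algebra.FiniteType.of_restrictScalars_finiteType k _ _
  have h3 : IsProper (Proj.toSpecZero (coordRing k N) ≫
    Spec.map (CommRingCat.ofHom (algebraMap k (coordRing k N 0)))) := inferInstance
  exact h3

lemma exists_hasCoords [IsAlgClosed k] {z : (Pn k N).left} (hz : IsClosed {z}) :
    ∃ w, HasCoords z w := by
  have h := exists_hasCoords_of_section (pointOfClosedPoint (Pn k N).hom z hz)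
    (pointOfClosedPoint_comp _ _ _) (IsLocalRing.closedPoint k)
  have h2 := pointOfClosedPoint_apply (Pn k N).hom z hz (IsLocalRing.closedPoint k)
  exact h2 ▸ h

end Points

/-! ### Cones -/

section Cones
attribute [local instance] MvPolynomial.gradedAlgebra
open MvPolynomial
variable {k : Type u} [Field k] {N : ℕ}

/-- The parametrization `x_i ↦ T w_i` of the line spanned by `w`. -/
def coordsHom (w : Fin (N + 1) → k) : MvPolynomial (Fin (N + 1)) k →ₐ[k] Polynomial k :=
  aeval (fun i => Polynomial.X * Polynomial.C (w i))

lemma coordsHom_of_isHomogeneous (w : Fin (N + 1) → k) {d : ℕ} {f : MvPolynomial (Fin (N + 1)) k}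
    (hf : f.IsHomogeneous d) : coordsHom w f = Polynomial.monomial d (eval w f) := by
  rw [coordsHom, aeval_mul_of_isHomogeneous hf]
  have h : aeval (fun i => Polynomial.C (w i)) f = algebraMap k (Polynomial k) (aeval w f) :=
    aeval_algebraMap_apply (Polynomial k) w f
  rw [h, aeval_eq_eval, ← Polynomial.C_mul_X_pow_eq_monomial, mul_comm]
  rfl

lemma coeff_coordsHom (w : Fin (N + 1) → k) (d : ℕ) (f : MvPolynomial (Fin (N + 1)) k) :
    (coordsHom w f).coeff d = eval w (homogeneousComponent d f) := by
  conv_lhs => rw [← sum_homogeneousComponent f, map_sum, Polynomial.finsetSum_coeff]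
  simp only [coordsHom_of_isHomogeneous w (homogeneousComponent_isHomogeneous _ f),
    Polynomial.coeff_monomial, Finset.sum_ite_eq']
  split_ifs with hd
  · rfl
  · rw [homogeneousComponent_eq_zero d f (by simpa using hd), map_zero]

lemma coordsHom_eq_zero_iff (w : Fin (N + 1) → k) (f : MvPolynomial (Fin (N + 1)) k) :
    coordsHom w f = 0 ↔ ∀ d, eval w (homogeneousComponent d f) = 0 := by
  simp_rw [← coeff_coordsHom, Polynomial.ext_iff, Polynomial.coeff_zero]

/-- The homogeneous prime ideal of the point with homogeneous coordinates `w`. -/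
def coordsPrime (w : Fin (N + 1) → k) {j : Fin (N + 1)} (hw : w j ≠ 0) :
    ProjectiveSpectrum (coordRing k N) where
  asHomogeneousIdeal :=
    ⟨RingHom.ker (coordsHom w), by
      intro d f hf
      have h1 : (DirectSum.decompose (coordRing k N) f d : MvPolynomial (Fin (N + 1)) k) =
        homogeneousComponent d f := decomposition.decompose'_apply f d
      have h2 := (coordsHom_eq_zero_iff w f).1 hf d
      rw [h1, RingHom.mem_ker]
      refine (coordsHom_of_isHomogeneous w (homogeneousComponent_isHomogeneous d f)).trans ?_
      rw [h2, Polynomial.monomial_zero_right]⟩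
  isPrime := RingHom.ker_isPrime _
  not_irrelevant_le h := by
    have h1 : X j ∈ HomogeneousIdeal.irrelevant (coordRing k N) :=
      HomogeneousIdeal.mem_irrelevant_of_mem _ one_pos (isHomogeneous_X k j)
    have h2 : coordsHom w (X j) = 0 := h h1
    rw [coordsHom, aeval_X, mul_eq_zero, Polynomial.C_eq_zero] at h2
    exact h2.elim Polynomial.X_ne_zero hw

lemma exists_point_hasCoords (w : Fin (N + 1) → k) {j : Fin (N + 1)} (hw : w j ≠ 0) :
    ∃ z : (Pn k N).left, HasCoords z w := by
  refine ⟨coordsPrime w hw, fun d f hf => ?_⟩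
  have h : Vanishes f (coordsPrime w hw) ↔ coordsHom w f = 0 := Iff.rfl
  rw [h, coordsHom_of_isHomogeneous w hf, Polynomial.monomial_eq_zero_iff]

lemma HasCoords.vanishes {z : (Pn k N).left} {w : Fin (N + 1) → k} (hz : HasCoords z w)
    {f : MvPolynomial (Fin (N + 1)) k} (hf : Vanishes f z) : eval w f = 0 := by
  rw [← sum_homogeneousComponent f, map_sum]
  refine Finset.sum_eq_zero fun d _ => ?_
  exact (hz d _ (homogeneousComponent_isHomogeneous d f)).1 ((vanishes_iff_components f z).1 hf d)

/-- A specialization of `z` satisfies the same linear equations `X i = (w i / w j) X j`, hence has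
the same coordinates and equals `z`. -/
lemma HasCoords.isClosed {z : (Pn k N).left} {w : Fin (N + 1) → k} (hz : HasCoords z w) :
    IsClosed {z} := by
  obtain ⟨j, hj⟩ := hz.ne_zero
  refine isClosed_of_closure_subset fun y hy => ?_
  have hle : homPrime z ≤ homPrime y := (ProjectiveSpectrum.le_iff_mem_closure _ _ _).2 hy
  have hlin (i) : Vanishes (X i - C (w i / w j) * X j) y := by
    refine hle ((hz 1 _ (sub_mem (isHomogeneous_X k i) (isHomogeneous_C_mul_X _ j))).2 ?_)
    simp [hj]
  have hjy : ¬ Vanishes (X j) y := by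
    intro h
    obtain ⟨i, hi⟩ := exists_variable_notMem y
    refine hi ?_
    have := add_mem (hlin i) ((homPrime y).asHomogeneousIdeal.toIdeal.mul_mem_left (C (w i / w j)) h)
    rwa [sub_add_cancel] at this
  have h1 := hasCoords_of_linear hjy hlin
  have h2 : HasCoords z (fun i => w i / w j) := by
    have := hz.smul (inv_ne_zero hj)
    simpa only [div_eq_inv_mul] using this
  exact h1.eq h2

/-- The linear forms giving the coordinates of a linear map. -/
def linearForms {n m : ℕ} (pr : (Fin (n + 1) → k) →ₗ[k] (Fin (m + 1) → k)) (i : Fin (m + 1)) :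
    MvPolynomial (Fin (n + 1)) k := ∑ j, C (pr (Pi.single j 1) i) * X j

lemma eval_linearForms {n m : ℕ} (pr : (Fin (n + 1) → k) →ₗ[k] (Fin (m + 1) → k))
    (i : Fin (m + 1)) (v : Fin (n + 1) → k) : eval v (linearForms pr i) = pr v i := by
  conv_rhs => rw [pi_eq_sum_univ' v, map_sum, Finset.sum_apply]
  rw [linearForms, map_sum]
  refine Finset.sum_congr rfl fun j _ => ?_
  simp [mul_comm]

lemma linearForms_mem {n m : ℕ} (pr : (Fin (n + 1) → k) →ₗ[k] (Fin (m + 1) → k))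
    (i : Fin (m + 1)) : linearForms pr i ∈ coordRing k n 1 :=
  sum_mem fun _ _ => isHomogeneous_C_mul_X _ _

lemma eval_aeval_linearForms {n m : ℕ} (pr : (Fin (n + 1) → k) →ₗ[k] (Fin (m + 1) → k))
    (f : MvPolynomial (Fin (m + 1)) k) (v : Fin (n + 1) → k) :
    eval v (aeval (linearForms pr) f) = eval (pr v) f := by
  have h3 : (aeval v : MvPolynomial (Fin (n + 1)) k →ₐ[k] k).comp (aeval (linearForms pr)) =
      aeval (pr v) := by
    ext i
    simp [aeval_eq_eval, eval_linearForms]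
  have h4 := DFunLike.congr_fun h3 f
  rwa [AlgHom.comp_apply, aeval_eq_eval, aeval_eq_eval] at h4

lemma sub_aeval_mem {σ R : Type*} [CommRing R] (I : Ideal (MvPolynomial σ R))
    (g : σ → MvPolynomial σ R) (h : ∀ i, X i - g i ∈ I) (f : MvPolynomial σ R) :
    f - aeval g f ∈ I := by
  rw [← Ideal.Quotient.eq]
  have : (Ideal.Quotient.mkₐ R I) = (Ideal.Quotient.mkₐ R I).comp (aeval g) := by
    ext i
    simpa using Ideal.Quotient.eq.2 (h i)
  exact DFunLike.congr_fun this f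

/-- The hypothesis on `y` says that it satisfies the linear equations `v = pr v`. Modulo its ideal,
`f` agrees with `f ∘ pr`, which is the zero polynomial because it vanishes at all vectors over an
infinite field. -/
lemma vanishes_of_projection [Infinite k] (pr : (Fin (N + 1) → k) →ₗ[k] (Fin (N + 1) → k))
    {y : (Pn k N).left} (h : ∀ i, Vanishes (X i - linearForms pr i) y)
    {f : MvPolynomial (Fin (N + 1)) k} (hf : ∀ v, eval (pr v) f = 0) : Vanishes f y := by
  have h1 := sub_aeval_mem (homPrime y).asHomogeneousIdeal.toIdeal (linearForms pr) h f
  have h2 : aeval (linearForms pr) f = 0 := by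
    refine MvPolynomial.funext fun v => ?_
    rw [eval_aeval_linearForms, hf, map_zero]
  rwa [h2, sub_zero] at h1

/-- A dense family of vectors of the subvariety with generic point `η` such that infinitely many
points of the line joining each of them to `P` lie on the subvariety. -/
structure IsConical (η : (Pn k N).left) (P : Fin (N + 1) → k) (D : Set (Fin (N + 1) → k)) :
    Prop where
  nonempty : D.Nonempty
  dense : ∀ d, ∀ f ∈ coordRing k N d, Vanishes f η ↔ ∀ w ∈ D, eval w f = 0
  infinite : ∀ w ∈ D, {c : k | ∀ d, ∀ f ∈ coordRing k N d, Vanishes f η →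
    eval (fun i => w i + c * P i) f = 0}.Infinite

variable {η : (Pn k N).left} {P : Fin (N + 1) → k} {D : Set (Fin (N + 1) → k)}

lemma IsConical.eval_add (h : IsConical η P D) {d : ℕ} {f : MvPolynomial (Fin (N + 1)) k}
    (hf : f ∈ coordRing k N d) (hη : Vanishes f η) {w : Fin (N + 1) → k} (hw : w ∈ D) (c : k) :
    eval (fun i => w i + c * P i) f = 0 :=
  eval_line_eq_zero ((h.infinite w hw).mono fun c (hc : ∀ d, ∀ f ∈ coordRing k N d,
    Vanishes f η → eval (fun i => w i + c * P i) f = 0) => hc d f hf hη) c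

lemma IsConical.eval_smul_add (h : IsConical η P D) {f : MvPolynomial (Fin (N + 1)) k}
    (hη : Vanishes f η) {w : Fin (N + 1) → k} (hw : w ∈ D) {b : k} (hb : b ≠ 0) (c : k) :
    eval (fun i => b * w i + c * P i) f = 0 := by
  rw [← sum_homogeneousComponent f, map_sum]
  refine Finset.sum_eq_zero fun d _ => ?_
  have hd := homogeneousComponent_isHomogeneous d f
  have h1 := h.eval_add hd ((vanishes_iff_components f η).1 hη d) hw (c / b)
  have h2 : (fun i => b * w i + c * P i) = fun i => b * (w i + c / b * P i) := by
    ext i; field_simp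
  rw [h2, eval_mul_of_isHomogeneous hd, h1, mul_zero]

/-- This extends the density of `D` from homogeneous to arbitrary polynomials: vanishing at all
nonzero multiples of `w` forces each homogeneous component to vanish at `w`. -/
lemma IsConical.vanishes_of_forall [Infinite k] (h : IsConical η P D)
    {f : MvPolynomial (Fin (N + 1)) k}
    (hf : ∀ w ∈ D, ∀ b : k, b ≠ 0 → eval (fun i => b * w i) f = 0) : Vanishes f η := by
  rw [vanishes_iff_components]
  intro d
  rw [h.dense d _ (homogeneousComponent_isHomogeneous d f)]
  intro w hw
  have hg (b : k) : (coordsHom w f).eval b = eval (fun i => b * w i) f := by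
    have : (Polynomial.aeval b).comp (coordsHom w) = aeval (R := k) fun i => b * w i := by
      ext i
      simpa [coordsHom] using mul_comm _ _
    have h2 := DFunLike.congr_fun this f
    rwa [aeval_eq_eval] at h2
  have hg0 : coordsHom w f = 0 := by
    refine Polynomial.eq_zero_of_infinite_isRoot _ (Set.Infinite.mono (s := {0}ᶜ) ?_ ?_)
    · intro b hb
      exact (hg b).trans (hf w hw b hb)
    · exact (Set.finite_singleton 0).infinite_compl
  exact (coordsHom_eq_zero_iff w f).1 hg0 d

/-- The ideal of the cone is stable under translation along `P`. Stated as an ideal membership, the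
cone property is no longer tied to the dense family `D` and can be specialized to every point of the
variety. -/
lemma IsConical.translate [Infinite k] (h : IsConical η P D) {f : MvPolynomial (Fin (N + 1)) k}
    (hη : Vanishes f η) (m : MvPolynomial (Fin (N + 1)) k) :
    Vanishes (aeval (fun i => X i + m * C (P i)) f) η := by
  refine h.vanishes_of_forall fun w hw b hb => ?_
  have h1 := h.eval_smul_add hη hw hb (eval (fun i => b * w i) m)
  have h2 : (aeval (fun i => b * w i) : MvPolynomial (Fin (N + 1)) k →ₐ[k] k).comp
      (aeval (fun i => X i + m * C (P i))) =
        aeval (fun i => b * w i + eval (fun i => b * w i) m * P i) := by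
    ext i
    simp [aeval_eq_eval]
  have h3 := DFunLike.congr_fun h2 f
  rw [AlgHom.comp_apply, aeval_eq_eval, aeval_eq_eval] at h3
  exact h3.trans h1

/-- Along the line `P + b w` the polynomial vanishes for all `b ≠ 0`, hence also at `b = 0`. -/
lemma IsConical.eval_vertex [Infinite k] (h : IsConical η P D)
    {f : MvPolynomial (Fin (N + 1)) k} (hη : Vanishes f η) : eval P f = 0 := by
  obtain ⟨w, hw⟩ := h.nonempty
  have h1 := eval_line_eq_zero (f := f) (u := P) (v := w) (Set.Infinite.mono (s := {0}ᶜ) (fun b hb => by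
    have := h.eval_smul_add hη hw hb 1
    simpa [add_comm] using this) (Set.finite_singleton 0).infinite_compl) 0
  simpa using h1

lemma IsConical.vanishes_vertex [Infinite k] (h : IsConical η P D) {p : (Pn k N).left}
    (hp : HasCoords p P) {f : MvPolynomial (Fin (N + 1)) k} (hη : Vanishes f η) :
    Vanishes f p := by
  rw [vanishes_iff_components]
  intro d
  exact (hp d _ (homogeneousComponent_isHomogeneous d f)).2
    (h.eval_vertex ((vanishes_iff_components f η).1 hη d))

/-- The points of the line joining a point of a cone to the vertex lie on the cone. -/
lemma IsConical.vanishes_line [Infinite k] (h : IsConical η P D) {p z y : (Pn k N).left}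
    (hp : HasCoords p P) {w : Fin (N + 1) → k} (hz : HasCoords z w)
    (hηz : ∀ f, Vanishes f η → Vanishes f z) (hy : y ∈ line p z)
    {f : MvPolynomial (Fin (N + 1)) k} (hf : Vanishes f η) : Vanishes f y := by
  have hw (c : k) {g : MvPolynomial (Fin (N + 1)) k} (hg : Vanishes g η) :
      eval (fun i => w i + c * P i) g = 0 := by
    have h1 := hz.vanishes (hηz _ (h.translate hg (C c)))
    have h2 : (aeval w : MvPolynomial (Fin (N + 1)) k →ₐ[k] k).comp
      (aeval (fun i => X i + C c * C (P i))) = aeval (fun i => w i + c * P i) := by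
        ext i
        simp [aeval_eq_eval]
    have h3 := DFunLike.congr_fun h2 g
    rw [AlgHom.comp_apply, aeval_eq_eval, aeval_eq_eval] at h3
    exact h3.symm.trans h1
  have hall (a b : k) : eval (fun i => a * P i + b * w i) f = 0 := by
    -- For `b = 0` the vector is a multiple of `P`, and the claim is that the vertex lies on the
    -- variety. Otherwise one can divide by `b`.
    rcases eq_or_ne b 0 with rfl | hb
    · have h1 := h.vanishes_vertex hp hf
      have h2 := (coordsHom_eq_zero_iff P f).2 fun d => by
        refine (hp d _ (homogeneousComponent_isHomogeneous d f)).1 ?_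
        exact (vanishes_iff_components f p).1 h1 d
      have h3 : (Polynomial.aeval a).comp (coordsHom P) = aeval (R := k) fun i => a * P i := by
        ext i
        simpa [coordsHom] using mul_comm _ _
      have h4 := DFunLike.congr_fun h3 f
      rw [AlgHom.comp_apply, h2, map_zero, aeval_eq_eval] at h4
      simpa using h4.symm
    · rw [← sum_homogeneousComponent f, map_sum]
      refine Finset.sum_eq_zero fun d _ => ?_
      have hd := homogeneousComponent_isHomogeneous d f
      have h1 := hw (a / b) ((vanishes_iff_components f η).1 hf d)
      have h2 : (fun i => a * P i + b * w i) = fun i => b * (w i + a / b * P i) := by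
        ext i
        field_simp
        ring
      rw [h2, eval_mul_of_isHomogeneous hd, h1, mul_zero]
  -- A linear projection onto the span of `P` and `w`. The forms `X i - pr'ᵢ` vanish at both
  -- vectors, so by the definition of `line` they vanish at `y`, and `f` needs to be checked only on
  -- the span.
  obtain ⟨pr, hpr⟩ := LinearMap.exists_extend
    (LinearMap.id : Submodule.span k {P, w} →ₗ[k] Submodule.span k {P, w})
  let pr' := (Submodule.span k {P, w}).subtype ∘ₗ pr
  have hpr' (v) (hv : v ∈ Submodule.span k {P, w}) : pr' v = v :=
    congrArg Subtype.val (LinearMap.congr_fun hpr ⟨v, hv⟩)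
  have hmem (i) : X i - linearForms pr' i ∈ coordRing k N 1 :=
    sub_mem (isHomogeneous_X k i) (linearForms_mem pr' i)
  refine vanishes_of_projection pr' (fun i => hy _ (hmem i) ((hp 1 _ (hmem i)).2 ?_)
    ((hz 1 _ (hmem i)).2 ?_)) fun v => ?_
  · rw [map_sub, eval_X, eval_linearForms, hpr' _ (Submodule.subset_span (by simp)), sub_self]
  · rw [map_sub, eval_X, eval_linearForms, hpr' _ (Submodule.subset_span (by simp)), sub_self]
  · obtain ⟨a, b, hab⟩ := Submodule.mem_span_pair.1 (pr v).2
    have : pr' v = fun i => a * P i + b * w i := hab.symm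
    rw [this]
    exact hall a b

end Cones

/-! ### Orbits -/

section Points
variable {k : Type u} [Field k]
lemma left_congr {A B : Over (Spec (.of k))} {f g : A ⟶ B} (h : f = g) (z : A.left) :
    f.left z = g.left z := by
  rw [h]

variable {G X : Over (Spec (.of k))} [AddGrpObj G] [AddModObj G X]

lemma lift_action (t : 𝟙_ (Over (Spec (.of k))) ⟶ G) (p : 𝟙_ (Over (Spec (.of k))) ⟶ X) :
    lift t p ≫ action G X = p ≫ pointAction G X t := by
  have : toUnit (𝟙_ (Over (Spec (.of k)))) = 𝟙 _ := Subsingleton.elim _ _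
  rw [pointAction, ← Category.assoc, comp_lift, Category.comp_id, ← Category.assoc, comp_toUnit,
    this, Category.id_comp]

lemma pointAction_zero : pointAction G X (AddMonObj.zero : 𝟙_ (Over (Spec (.of k))) ⟶ G) = 𝟙 X := by
  have h : lift (toUnit X ≫ (AddMonObj.zero : 𝟙_ (Over (Spec (.of k))) ⟶ G)) (𝟙 X) =
      (λ_ X).inv ≫ (AddMonObj.zero : 𝟙_ (Over (Spec (.of k))) ⟶ G) ▷ X := by
    ext1 <;> simp
  rw [pointAction, h, Category.assoc, Iso.inv_comp_eq, Category.comp_id]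
  exact AddModObj.zero_vadd (M := G) X

end Points

section Orbits
variable {k : Type u} [Field k] [IsAlgClosed k]

/-- The rational point given by a closed point. -/
def pointAt (X : Over (Spec (.of k))) [LocallyOfFiniteType X.hom] (x : X.left) (hx : IsClosed {x}) :
    𝟙_ (Over (Spec (.of k))) ⟶ X :=
  Over.homMk (pointOfClosedPoint X.hom x hx) (pointOfClosedPoint_comp _ _ _)

lemma pointAt_apply (X : Over (Spec (.of k))) [LocallyOfFiniteType X.hom] (x : X.left)
    (hx : IsClosed {x}) (y : Spec (.of k)) : (pointAt X x hx).left y = x :=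
  pointOfClosedPoint_apply X.hom x hx y

lemma isClosed_point {X : Over (Spec (.of k))} [LocallyOfFiniteType X.hom]
    (p : 𝟙_ (Over (Spec (.of k))) ⟶ X) (y : Spec (.of k)) : IsClosed {p.left y} := by
  have h := (pointEquivClosedPoint X.hom ⟨p.left, Over.w p⟩).2
  have h2 : IsLocalRing.closedPoint k = y := Subsingleton.elim (α := Spec (.of k)) _ _
  rw [← h2]
  exact h

lemma point_ext {X : Over (Spec (.of k))} [LocallyOfFiniteType X.hom]
    {p q : 𝟙_ (Over (Spec (.of k))) ⟶ X} (y : Spec (.of k)) (h : p.left y = q.left y) : p = q := by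
  have h2 : IsLocalRing.closedPoint k = y := Subsingleton.elim (α := Spec (.of k)) _ _
  subst h2
  exact Over.OverMorphism.ext (ext_of_apply_closedPoint_eq X.hom (Over.w p) (Over.w q) h)

variable {G X : Over (Spec (.of k))} [AddGrpObj G] [AddModObj G X]
variable [LocallyOfFiniteType X.hom]

/-- A morphism that acts trivially on all closed points for all closed points of the group is
trivial. -/
lemma action_eq_snd [LocallyOfFiniteType G.hom] [IsReduced (G ⊗ X).left] [IsSeparated X.hom]
    (h : ∀ (t : 𝟙_ (Over (Spec (.of k))) ⟶ G) (x : X.left), IsClosed {x} →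
      (pointAction G X t).left x = x) : action G X = snd G X := by
  have h0 : LocallyOfFiniteType (G ⊗ X).hom := by
    rw [Over.tensorObj_hom]
    infer_instance
  have h1 : LocallyOfFiniteType ((action G X).left ≫ X.hom) := by
    rw [Over.w]
    exact h0
  refine Over.OverMorphism.ext (ext_of_apply_eq X.hom Set.univ isClosed_univ.isLocallyClosed
    dense_univ (fun z _ hz => ?_) ((Over.w _).trans (Over.w _).symm))
  -- A closed point of `G × X` is rational, so it is a pair `(t, x)` of rational points, to which
  -- the hypothesis applies.
  let q := pointAt (G ⊗ X) z hz
  let y : Spec (.of k) := IsLocalRing.closedPoint k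
  have hq : q = lift (q ≫ fst G X) (q ≫ snd G X) := by ext1 <;> simp
  have h2 : q ≫ action G X = (q ≫ snd G X) ≫ pointAction G X (q ≫ fst G X) := by
    conv_lhs => rw [hq]
    exact lift_action _ _
  have h3 := left_congr h2 y
  have h4 : q.left y = z := pointAt_apply _ _ _ _
  have h5 : (q ≫ snd G X).left y = (snd G X).left z := congrArg (snd G X).left h4
  have h6 : (q ≫ action G X).left y = (action G X).left z := congrArg (action G X).left h4
  have h7 := h (q ≫ fst G X) ((q ≫ snd G X).left y) (isClosed_point _ _)
  exact h6.symm.trans (h3.trans (h7.trans h5))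

/-- The orbit of a closed point that is moved by some group element is infinite. -/
lemma infinite_orbit [LocallyOfFiniteType G.hom] [IrreducibleSpace G.left] {x : X.left}
    (hx : IsClosed {x}) {t₀ : 𝟙_ (Over (Spec (.of k))) ⟶ G}
    (h : (pointAction G X t₀).left x ≠ x) :
    (Set.range fun t : 𝟙_ (Over (Spec (.of k))) ⟶ G => (pointAction G X t).left x).Infinite := by
  intro hfin
  let p := pointAt X x hx
  let o : G ⟶ X := lift (𝟙 G) (toUnit G ≫ p) ≫ action G X
  let y : Spec (.of k) := IsLocalRing.closedPoint k
  have ho (t : 𝟙_ (Over (Spec (.of k))) ⟶ G) : o.left (t.left y) = (pointAction G X t).left x := by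
    have h1 : t ≫ o = p ≫ pointAction G X t := by
      have : toUnit (𝟙_ (Over (Spec (.of k)))) = 𝟙 _ := Subsingleton.elim _ _
      rw [← lift_action, ← Category.assoc, comp_lift, Category.comp_id, ← Category.assoc,
        comp_toUnit, this, Category.id_comp]
    have h2 := left_congr h1 y
    have h3 : p.left y = x := pointAt_apply _ _ _ _
    exact h2.trans (congrArg (pointAction G X t).left h3)
  have hJ : JacobsonSpace G.left := LocallyOfFiniteType.jacobsonSpace G.hom
  have hcl (g : G.left) (hg : IsClosed {g}) :
      o.left g ∈ Set.range fun t : 𝟙_ (Over (Spec (.of k))) ⟶ G => (pointAction G X t).left x :=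
    ⟨pointAt G g hg, by
      have := ho (pointAt G g hg)
      rw [pointAt_apply] at this
      exact this.symm⟩
  -- The closed points are dense in `G`, hence irreducible, and so is their image under the orbit
  -- map.
  have h1 : IsIrreducible (closedPoints G.left) := by
    rw [← isIrreducible_iff_closure, closure_closedPoints]
    exact IrreducibleSpace.isIrreducible_univ _
  have h2 : o.left '' closedPoints G.left ⊆ closedPoints X.left := by
    rintro _ ⟨g, hg, rfl⟩
    have h3 : (pointAt G g hg ≫ o).left y = o.left g := congrArg o.left (pointAt_apply G g hg y)
    rw [mem_closedPoints_iff, ← h3]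
    exact isClosed_point _ _
  -- A finite set of closed points is discrete, and an irreducible discrete set has at most one
  -- point. Since the orbit contains `x`, the image of `t = 0`, no element could move `x`.
  have h3 : (o.left '' closedPoints G.left).Subsingleton :=
    ((hfin.subset (by rintro _ ⟨g, hg, rfl⟩; exact hcl g hg)).isDiscrete_of_subset_closedPoints
      h2).subsingleton_of_isPreirreducible (h1.image _ o.left.continuous.continuousOn).isPreirreducible
  have h4 (t : 𝟙_ (Over (Spec (.of k))) ⟶ G) : (pointAction G X t).left x ∈
      o.left '' closedPoints G.left := ⟨t.left y, isClosed_point t y, ho t⟩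
  refine h ((h3 (h4 t₀) (h4 AddMonObj.zero)).trans ?_)
  rw [pointAction_zero]
  rfl

/-- The points that are moved by a group element form an open set. -/
lemma exists_opens_moved [IsSeparated X.hom] (t : 𝟙_ (Over (Spec (.of k))) ⟶ G) :
    ∃ U : X.left.Opens, ∀ x, IsClosed {x} → (x ∈ U ↔ (pointAction G X t).left x ≠ x) := by
  -- The fixed locus is the equalizer of `t` and the identity, which is closed because `X` is
  -- separated.
  let ι := Limits.equalizer.ι (pointAction G X t) (𝟙 X)
  refine ⟨⟨(Set.range ι.left)ᶜ, ι.left.isClosedEmbedding.isClosed_range.isOpen_compl⟩,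
    fun x hx => not_iff_not.2 ⟨?_, fun h => ?_⟩⟩
  · rintro ⟨z, hz⟩
    have h1 : ι ≫ pointAction G X t = ι ≫ 𝟙 X := Limits.equalizer.condition _ _
    have h2 := left_congr h1 z
    rw [Category.comp_id] at h2
    have h3 : (ι ≫ pointAction G X t).left z = (pointAction G X t).left x :=
      congrArg (pointAction G X t).left hz
    exact h3.symm.trans (h2.trans hz)
  · let y : Spec (.of k) := IsLocalRing.closedPoint k
    have h3 : (pointAt X x hx).left y = x := pointAt_apply _ _ _ _
    have h1 : pointAt X x hx ≫ pointAction G X t = pointAt X x hx ≫ 𝟙 X := by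
      refine point_ext y ?_
      rw [Category.comp_id]
      exact (congrArg (pointAction G X t).left h3).trans (h.trans h3.symm)
    refine ⟨(Limits.equalizer.lift _ h1).left y, ?_⟩
    have h2 : Limits.equalizer.lift _ h1 ≫ ι = _ := Limits.equalizer.lift_ι _ h1
    exact (left_congr h2 y).trans h3

end Orbits

/-! ### Geometric properties of `𝔾ₐ` needed for the orbit argument. -/

section AdditiveGroup
variable {k : Type u} [Field k] [IsAlgClosed k]

instance : LocallyOfFiniteType (Ga (Spec (.of k))).hom :=
  inferInstanceAs (LocallyOfFiniteType (𝔸(PUnit.{u+1}; Spec (.of k)) ↘ Spec (.of k)))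

instance : IrreducibleSpace (Ga (Spec (.of k))).left :=
  inferInstanceAs (IrreducibleSpace 𝔸(PUnit.{u+1}; Spec (.of k)))

instance (X : Over (Spec (.of k))) [IsIntegral X.left] [LocallyOfFiniteType X.hom] :
    IsReduced (Ga (Spec (.of k)) ⊗ X).left := by
  have : IsLocallyNoetherian X.left := LocallyOfFiniteType.isLocallyNoetherian X.hom
  have : IsIntegral (Limits.pullback (𝔸(PUnit.{u+1}; Spec (.of k)) ↘ Spec (.of k)) X.hom) :=
    inferInstance
  exact inferInstanceAs (IsReduced
    (Limits.pullback (𝔸(PUnit.{u+1}; Spec (.of k)) ↘ Spec (.of k)) X.hom))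

end AdditiveGroup

/-! ### Linear forms and the action -/

section LinearForms
attribute [local instance] MvPolynomial.gradedAlgebra
open MvPolynomial
variable {k : Type u} [Field k] {N : ℕ}

lemma scalars_comp {X Y : Over (Spec (.of k))} (f : X ⟶ Y) (c : k) :
    f.left.appTop.hom (scalars Y c) = scalars X c := by
  have h : f.left.appTop.hom.comp (scalars Y) = scalars X := by
    have h1 : Y.hom.appTop ≫ f.left.appTop = X.hom.appTop := by
      rw [← Scheme.Hom.comp_appTop, Over.w f]
    simp only [scalars, ← h1]
    rfl
  exact RingHom.congr_fun h c

lemma pullSection_smul {X Y : Over (Spec (.of k))} (f : X ⟶ Y) (L : Y.left.Modules) (c : k)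
    (s : H0 L) : pullSection f.left L (c • s) =
      (c • (show H0 (X := X.left) _ from pullSection f.left L s) : H0 _) := by
  rw [H0_smul_def, H0_smul_def, ← scalars_comp f]
  exact Scheme.Modules.Hom.app_smul _ _ _

lemma hom_app_top_smul {X : Over (Spec (.of k))} {L L' : X.left.Modules} (e : L ⟶ L') (c : k)
    (s : H0 L) : (show H0 L' from e.app ⊤ (c • s : H0 L)) = c • (show H0 L' from e.app ⊤ s) :=
  Scheme.Modules.Hom.app_smul _ _ _

/-- The restriction of linear forms to a projective variety. -/
def restrictForms {X : Over (Spec (.of k))} {L : X.left.Modules} (φ : X ⟶ Pn k N)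
    (ψ : (Scheme.Modules.pullback φ.left).obj (O1 k N) ≅ L) : coordRing k N 1 →ₗ[k] H0 L where
  toFun l := ψ.hom.app ⊤ (pullSection φ.left _ (linSection l))
  map_add' l l' := by
    rw [map_add, map_add]
    exact map_add _ _ _
  map_smul' c l := by
    rw [map_smul, pullSection_smul]
    exact hom_app_top_smul _ _ _

lemma vanishesAlong_restrictForms_iff {X : Over (Spec (.of k))} {L : X.left.Modules}
    (φ : X ⟶ Pn k N) (ψ : (Scheme.Modules.pullback φ.left).obj (O1 k N) ≅ L) (l : coordRing k N 1)
    (p : Spec (.of k) ⟶ X.left) (y : Spec (.of k)) :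
    VanishesAlong p (restrictForms φ ψ l) ↔ Vanishes l.1 (φ.left (p y)) := by
  refine (vanishesAlong_iso p _ ψ).trans ?_
  rw [← vanishesAlong_comp]
  exact vanishesAlong_linSection_iff _ _ _

/-- Up to the isomorphism supplied by the linearization, the translate of `s` is the pullback of `s`
along `t`, and isomorphisms do not affect vanishing. -/
lemma vanishesAlong_act_iff {S : Scheme.{u}} {G X : Over S} [AddGrpObj G] [AddModObj G X]
    {L : X.left.Modules} (Φ : Linearization G X L) (t : 𝟙_ (Over S) ⟶ G) (s : H0 L)
    {T : Scheme.{u}} (p : T ⟶ X.left) :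
    VanishesAlong p (Φ.act t s) ↔ VanishesAlong (p ≫ (pointAction G X t).left) s := by
  rw [vanishesAlong_comp]
  exact vanishesAlong_iso p _ (Φ.isoAt t)

lemma exists_functional {V : Type*} [AddCommGroup V] [Module k V] (W : Submodule k V)
    (hW : Module.finrank k (V ⧸ W) = 1) : ∃ χ : V →ₗ[k] k, ∀ s, χ s = 0 → s ∈ W := by
  obtain ⟨e⟩ := Module.nonempty_linearEquiv_iff_finrank_eq_one.2 hW
  refine ⟨e.symm.toLinearMap ∘ₗ W.mkQ, fun s hs => ?_⟩
  rw [LinearMap.comp_apply, LinearEquiv.coe_coe, LinearEquiv.map_eq_zero_iff] at hs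
  exact (Submodule.Quotient.mk_eq_zero W).1 hs

lemma linear_eq_sum {l : MvPolynomial (Fin (N + 1)) k} (hl : l ∈ coordRing k N 1) :
    l = ∑ i, C (coeff (Finsupp.single i 1) l) * X i := by
  change l ∈ homogeneousSubmodule _ _ 1 at hl
  rw [homogeneousSubmodule_one_eq_span_X] at hl
  induction hl using Submodule.span_induction with
  | mem x hx =>
    obtain ⟨j, rfl⟩ := hx
    rw [Finset.sum_eq_single j (fun i _ hi => ?_) (by simp)]
    · simp
    · rw [coeff_X, if_neg (fun h => hi ((Finsupp.single_left_injective one_ne_zero) h).symm), C_0,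
        zero_mul]
  | zero => simp
  | add x y _ _ hx hy =>
    conv_lhs => rw [hx, hy]
    simp only [coeff_add, C_add, add_mul, Finset.sum_add_distrib]
  | smul c x _ hx =>
    conv_lhs => rw [hx]
    simp only [coeff_smul, Finset.smul_sum, smul_eq_mul, C_mul, C_mul', smul_mul_assoc]

/-- This is how the hyperplane `W` produces a vector: a functional on linear forms is evaluation at
the vector of its values on the coordinates. -/
lemma functional_eq_eval (θ : coordRing k N 1 →ₗ[k] k) (l : coordRing k N 1) :
    θ l = eval (fun i => θ ⟨X i, isHomogeneous_X k i⟩) l.1 := by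
  have h1 : l = ∑ i, coeff (Finsupp.single i 1) l.1 • (⟨X i, isHomogeneous_X k i⟩ : coordRing k N 1) := by
    refine Subtype.ext ((linear_eq_sum l.2).trans ?_)
    rw [AddSubmonoidClass.coe_finsetSum]
    simp [C_mul']
  conv_rhs => rw [linear_eq_sum l.2, map_sum]
  conv_lhs => rw [h1, map_sum]
  simp

/-- The group action fixes the linear forms that vanish at a suitable vector. -/
lemma exists_direction [IsAlgClosed k] {G X : Over (Spec (.of k))} [AddGrpObj G] [AddModObj G X]
    [LocallyOfFiniteType X.hom]
    {L : X.left.Modules} (Φ : Linearization G X L)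
    (W : Submodule k (H0 L)) (hW : Module.finrank k (H0 L ⧸ W) = 1)
    (hfix : ∀ t : 𝟙_ (Over (Spec (.of k))) ⟶ G, ∀ s ∈ W, Φ.act t s = s)
    (φ : X ⟶ Pn k N) (ψ : (Scheme.Modules.pullback φ.left).obj (O1 k N) ≅ L) :
    ∃ P : Fin (N + 1) → k, ∀ l ∈ coordRing k N 1, eval P l = 0 →
      ∀ (t : 𝟙_ (Over (Spec (.of k))) ⟶ G) (x : X.left), IsClosed {x} →
        (Vanishes l (φ.left ((pointAction G X t).left x)) ↔ Vanishes l (φ.left x)) := by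
  obtain ⟨χ, hχ⟩ := exists_functional W hW
  refine ⟨fun i => χ (restrictForms φ ψ ⟨MvPolynomial.X i, isHomogeneous_X k i⟩), fun l hl hP t x hx => ?_⟩
  have h1 := functional_eq_eval (χ ∘ₗ restrictForms φ ψ) ⟨l, hl⟩
  -- As `l(P) = 0`, the restriction of `l` is killed by `χ`, so it lies in `W` and is invariant.
  have h2 := hfix t _ (hχ _ (h1.trans hP))
  let y : Spec (.of k) := IsLocalRing.closedPoint k
  have h3 : (pointAt X x hx).left y = x := pointAt_apply _ _ _ _
  have h4 := vanishesAlong_restrictForms_iff φ ψ ⟨l, hl⟩ (pointAt X x hx).left y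
  have h5 := vanishesAlong_restrictForms_iff φ ψ ⟨l, hl⟩
    ((pointAt X x hx).left ≫ (pointAction G X t).left) y
  rw [← vanishesAlong_act_iff, h2, h4, Scheme.Hom.comp_apply, h3] at h5
  exact h5.symm

/-- Two points at which the same linear forms through `P` vanish lie on a line through `P`. -/
lemma exists_hasCoords_add {P w w' : Fin (N + 1) → k} {z z' : (Pn k N).left}
    (hw : HasCoords z w) (hw' : HasCoords z' w')
    (h : ∀ l ∈ coordRing k N 1, eval P l = 0 → (Vanishes l z' ↔ Vanishes l z)) :
    ∃ c, HasCoords z' (fun i => w i + c * P i) := by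
  -- Every functional killing `P` and `w` also kills `w'`; by duality `w'` lies in the span of `w`
  -- and `P`.
  have hfun (g : Module.Dual k (Fin (N + 1) → k)) (hP : g P = 0) : g w' = 0 ↔ g w = 0 := by
    let l := linearForms (LinearMap.pi fun _ => g) (0 : Fin (N + 1))
    have hl : l ∈ coordRing k N 1 := linearForms_mem _ _
    have he (v) : eval v l = g v := eval_linearForms _ _ _
    have := h l hl ((he P).trans hP)
    rwa [hw 1 l hl, hw' 1 l hl, he, he] at this
  have h1 : w' ∈ Submodule.span k {w, P} := by
    by_contra hn
    obtain ⟨g, hg, hg'⟩ := Submodule.exists_le_ker_of_notMem hn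
    exact hg ((hfun g (hg' (Submodule.subset_span (by simp)))).2
      (hg' (Submodule.subset_span (by simp))))
  obtain ⟨a, b, rfl⟩ := Submodule.mem_span_pair.1 h1
  -- If `a = 0`, then `w'` is a multiple of `P`. Every functional killing `P` then kills `w` too, so
  -- all three vectors are proportional, the points coincide and `c = 0` works.
  by_cases ha : a = 0
  · subst ha
    have h2 : w ∈ Submodule.span k {P} := by
      by_contra hn
      obtain ⟨g, hg, hg'⟩ := Submodule.exists_le_ker_of_notMem hn
      have hgP : g P = 0 := hg' (Submodule.subset_span (by simp))
      exact hg ((hfun g hgP).1 (by simp [hgP]))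
    obtain ⟨c, rfl⟩ := Submodule.mem_span_singleton.1 h2
    obtain ⟨i, hi⟩ := hw.ne_zero
    obtain ⟨j, hj⟩ := hw'.ne_zero
    have hc : c ≠ 0 := fun hc => hi (by simp [hc])
    have hb : b ≠ 0 := fun hb => hj (by simp [hb])
    refine ⟨0, ?_⟩
    have := hw'.smul (c := c / b) (div_ne_zero hc hb)
    convert this using 2 with i
    simp
    field_simp
  · refine ⟨b / a, ?_⟩
    have := hw'.smul (inv_ne_zero ha)
    convert this using 2 with i
    simp
    field_simp

end LinearForms

/-! ### Orbits on lines through `P` make the variety a cone. -/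

section Main
attribute [local instance] MvPolynomial.gradedAlgebra
open MvPolynomial
variable {k : Type u} [Field k] {N : ℕ} {G X : Over (Spec (.of k))}

lemma vanishes_genericPoint [IrreducibleSpace X.left] (φ : X ⟶ Pn k N)
    {f : MvPolynomial (Fin (N + 1)) k} (h : Vanishes f (φ.left (genericPoint X.left)))
    (x : X.left) : Vanishes f (φ.left x) := by
  have h1 : genericPoint X.left ⤳ x := genericPoint_specializes x
  have h2 : homPrime (φ.left (genericPoint X.left)) ≤ homPrime (φ.left x) :=
    (ProjectiveSpectrum.le_iff_mem_closure _ _ _).2 (h1.map φ.left.continuous).mem_closure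
  exact h2 h

/-- On a scheme of finite type over a field, every nonempty open set contains a closed point; apply
this to the part of `U` where `f` does not vanish. -/
lemma vanishes_genericPoint_of_closedPoints [IrreducibleSpace X.left] [LocallyOfFiniteType X.hom]
    (φ : X ⟶ Pn k N) {U : X.left.Opens} (hU : (U : Set X.left).Nonempty)
    {f : MvPolynomial (Fin (N + 1)) k} (h : ∀ x ∈ U, IsClosed {x} → Vanishes f (φ.left x)) :
    Vanishes f (φ.left (genericPoint X.left)) := by
  have hJ : JacobsonSpace X.left := LocallyOfFiniteType.jacobsonSpace X.hom
  by_contra hf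
  let V : X.left.Opens := U ⊓ φ.left ⁻¹ᵁ nonvanishing f
  have hη : genericPoint X.left ∈ V :=
    ⟨((genericPoint_spec X.left).mem_open_set_iff U.2).2 (by simpa using hU), hf⟩
  obtain ⟨x, hx, hxc⟩ := nonempty_inter_closedPoints (Z := (V : Set X.left)) ⟨_, hη⟩
    V.2.isLocallyClosed
  exact hx.2 (h x hx.1 hxc)

/-- A projective variety on which a group acts non-trivially but fixes all linear forms vanishing
at `P` is a cone with vertex `P`, and the group acts along the generators. -/
theorem exists_vertex [IsAlgClosed k] [AddGrpObj G] [AddModObj G X] [IsIntegral X.left] [IsProper X.hom]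
    [LocallyOfFiniteType G.hom] [IrreducibleSpace G.left] [IsReduced (G ⊗ X).left]
    (hnontriv : action G X ≠ snd G X) (φ : X ⟶ Pn k N) (hφ : IsClosedImmersion φ.left)
    {P : Fin (N + 1) → k} (hP : ∀ l ∈ coordRing k N 1, eval P l = 0 →
      ∀ (t : 𝟙_ (Over (Spec (.of k))) ⟶ G) (x : X.left), IsClosed {x} →
        (Vanishes l (φ.left ((pointAction G X t).left x)) ↔ Vanishes l (φ.left x))) :
    ∃ (v : X.left) (D : Set (Fin (N + 1) → k)), HasCoords (φ.left v) P ∧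
      IsConical (φ.left (genericPoint X.left)) P D ∧
      IsConeWithVertex (Set.range φ.left) (φ.left v) ∧
      (∀ t : 𝟙_ (Over (Spec (.of k))) ⟶ G, (pointAction G X t).left v = v) ∧
      (∀ t : 𝟙_ (Over (Spec (.of k))) ⟶ G, ∀ x : X.left, IsClosed {x} → x ≠ v →
        φ.left ((pointAction G X t).left x) ∈ line (φ.left v) (φ.left x)) := by
  have hinj : Function.Injective φ.left := φ.left.isClosedEmbedding.injective
  have hcl (x : X.left) : IsClosed {x} ↔ IsClosed {φ.left x} := by
    rw [← Set.image_singleton, φ.left.isClosedEmbedding.isClosed_iff_image_isClosed]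
  have hact (t : 𝟙_ (Over (Spec (.of k))) ⟶ G) (x : X.left) (hx : IsClosed {x}) :
      IsClosed {(pointAction G X t).left x} := by
    have h1 : (pointAt X x hx ≫ pointAction G X t).left (IsLocalRing.closedPoint k) =
      (pointAction G X t).left x := congrArg (pointAction G X t).left (pointAt_apply X x hx _)
    rw [← h1]
    exact isClosed_point _ _
  have hcoords (x : X.left) (hx : IsClosed {x}) : ∃ w, HasCoords (φ.left x) w :=
    exists_hasCoords ((hcl x).1 hx)
  have horbit (t : 𝟙_ (Over (Spec (.of k))) ⟶ G) (x : X.left) (hx : IsClosed {x})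
      {w : Fin (N + 1) → k} (hw : HasCoords (φ.left x) w) :
      ∃ c, HasCoords (φ.left ((pointAction G X t).left x)) (fun i => w i + c * P i) := by
    obtain ⟨w', hw'⟩ := hcoords _ (hact t x hx)
    exact exists_hasCoords_add hw hw' fun l hl hlP => hP l hl hlP t x hx
  obtain ⟨t₀, x₀, hx₀, hne⟩ : ∃ (t : 𝟙_ (Over (Spec (.of k))) ⟶ G) (x : X.left),
      IsClosed {x} ∧ (pointAction G X t).left x ≠ x := by
    by_contra! h
    exact hnontriv (action_eq_snd h)
  obtain ⟨U, hU⟩ := exists_opens_moved (X := X) t₀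
  -- If `P` were zero, `x₀` and `t₀ x₀` would have the same coordinates.
  obtain ⟨j, hj⟩ : ∃ j, P j ≠ 0 := by
    by_contra! h0
    obtain ⟨w, hw⟩ := hcoords x₀ hx₀
    obtain ⟨c, hc⟩ := horbit t₀ x₀ hx₀ hw
    simp only [h0, mul_zero, add_zero] at hc
    exact hne (hinj (hc.eq hw))
  obtain ⟨p, hp⟩ := exists_point_hasCoords P hj
  let D : Set (Fin (N + 1) → k) := {w | ∃ x ∈ U, IsClosed {x} ∧ HasCoords (φ.left x) w}
  have hD : IsConical (φ.left (genericPoint X.left)) P D := by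
    refine ⟨?_, fun d f hf => ⟨fun h w ⟨x, hxU, hx, hw⟩ => ?_, fun h => ?_⟩,
      fun w ⟨x, hxU, hx, hw⟩ => ?_⟩
    · obtain ⟨w, hw⟩ := hcoords x₀ hx₀
      exact ⟨w, x₀, (hU x₀ hx₀).2 hne, hx₀, hw⟩
    · exact (hw d f hf).1 (vanishes_genericPoint φ h x)
    · refine vanishes_genericPoint_of_closedPoints φ ⟨x₀, (hU x₀ hx₀).2 hne⟩ fun x hxU hx => ?_
      obtain ⟨w, hw⟩ := hcoords x hx
      exact (hw d f hf).2 (h w ⟨x, hxU, hx, hw⟩)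
    · have hinf := infinite_orbit hx ((hU x hx).1 hxU)
      have hex (y) (hy : y ∈ Set.range fun t : 𝟙_ (Over (Spec (.of k))) ⟶ G =>
          (pointAction G X t).left x) : ∃ c, HasCoords (φ.left y) (fun i => w i + c * P i) := by
        obtain ⟨t, rfl⟩ := hy
        exact horbit t x hx hw
      choose! c hc using hex
      -- The parameter `c` determines the coordinates of an orbit point, so an infinite orbit gives
      -- infinitely many parameters.
      refine (hinf.image (f := c) fun y hy y' hy' h => hinj ?_).mono ?_
      · have h1 := hc y hy
        rw [h] at h1
        exact h1.eq (hc y' hy')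
      · rintro _ ⟨y, hy, rfl⟩ d f hf hη
        exact (hc y hy d f hf).1 (vanishes_genericPoint φ hη y)
  -- The image of `φ` is closed and so contains the closure of the image of the generic point: being
  -- on `X` can be tested on polynomials.
  have hrange (q : (Pn k N).left) (hq : ∀ f, Vanishes f (φ.left (genericPoint X.left)) →
      Vanishes f q) : q ∈ Set.range φ.left := by
    have h1 : q ∈ closure {φ.left (genericPoint X.left)} :=
      (ProjectiveSpectrum.le_iff_mem_closure _ (homPrime _) (homPrime q)).1 hq
    exact closure_minimal (by rintro _ rfl; exact ⟨_, rfl⟩)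
      φ.left.isClosedEmbedding.isClosed_range h1
  obtain ⟨v, rfl⟩ := hrange p fun f hf => hD.vanishes_vertex hp hf
  refine ⟨v, D, hp, hD, ⟨hp.isClosed, ⟨v, rfl⟩, ?_⟩, fun t => ?_, fun t x hx _ l hl hlv hlx => ?_⟩
  · rintro _ ⟨z, rfl⟩ hz - y hy
    obtain ⟨w, hw⟩ := hcoords z ((hcl z).2 hz)
    exact hrange y fun f hf => hD.vanishes_line hp hw
      (fun f hf => vanishes_genericPoint φ hf z) hy hf
  -- The vertex moves along `P + c P = (1 + c) P`. Coordinates are never all zero, so `1 + c ≠ 0`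
  -- and this is the same point.
  · obtain ⟨c, hc⟩ := horbit t v ((hcl v).2 hp.isClosed) hp
    have h1 : (fun i => P i + c * P i) = fun i => (1 + c) * P i := by
      ext i
      ring
    rw [h1] at hc
    obtain ⟨i, hi⟩ := hc.ne_zero
    have h2 := hc.smul (inv_ne_zero (left_ne_zero_of_mul hi))
    simp only [inv_mul_cancel_left₀ (left_ne_zero_of_mul hi)] at h2
    exact hinj (h2.eq hp)
  · exact (hP l hl ((hp 1 l hl).1 hlv) t x hx).2 hlx

lemma isProper_of_isProjective (h : IsProjective X) : IsProper X.hom := by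
  obtain ⟨N, φ, hφ⟩ := h
  rw [← Over.w φ]
  infer_instance

end Main

/-! ### A smoothness criterion -/

section Smooth
open MvPolynomial

lemma totalDegree_pderiv_lt {σ k : Type*} [CommRing k] {g : MvPolynomial σ k} (i : σ)
    (hg : 0 < g.totalDegree) : (pderiv i g).totalDegree < g.totalDegree := by
  rw [totalDegree, Finset.sup_lt_iff hg]
  intro m hm
  have h1 : m + Finsupp.single i 1 ∈ g.support := by
    rw [mem_support_iff, coeff_pderiv] at hm
    exact mem_support_iff.2 (left_ne_zero_of_mul hm)
  have h2 := le_totalDegree h1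
  rw [Finsupp.sum_add_index' (fun _ => rfl) (fun _ _ _ => rfl), Finsupp.sum_single_index rfl] at h2
  exact h2

lemma sub_single_add_single {σ : Type*} {m : σ →₀ ℕ} {i : σ} (h : m i ≠ 0) :
    m - Finsupp.single i 1 + Finsupp.single i 1 = m := by
  refine tsub_add_cancel_of_le (Finsupp.single_le_iff.2 ?_)
  exact Nat.one_le_iff_ne_zero.2 h

/-- Over a perfect field of characteristic `p`, a polynomial all of whose partial derivatives
vanish is a `p`-th power. -/
lemma exists_pow_of_pderiv_eq_zero {σ k : Type*} [Field k] {p : ℕ} [CharP k p]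
    [hp : Fact p.Prime] (hroot : ∀ a : k, ∃ b, b ^ p = a) {g : MvPolynomial σ k}
    (hg : ∀ i, pderiv i g = 0) : ∃ h, h ^ p = g := by
  choose ρ hρ using hroot
  -- The coefficient of `∂ᵢ g` coming from the monomial `m` is `m i` times that of `g`, so `m i` is
  -- zero in `k`.
  have hdvd (m : σ →₀ ℕ) (hm : m ∈ g.support) (i : σ) : p ∣ m i := by
    rcases Nat.eq_zero_or_pos (m i) with h0 | h0
    · simp [h0]
    have h1 := sub_single_add_single h0.ne'
    have h2 := congrArg (coeff (m - Finsupp.single i 1)) (hg i)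
    rw [coeff_pderiv, h1, coeff_zero, mul_eq_zero] at h2
    have h3 := h2.resolve_left (mem_support_iff.1 hm)
    rw [← CharP.cast_eq_zero_iff k p]
    have h4 : (m - Finsupp.single i 1 : σ →₀ ℕ) i + 1 = m i := by
      simpa using DFunLike.congr_fun h1 i
    rw [← h4]
    exact_mod_cast h3
  refine ⟨∑ m ∈ g.support, monomial (m.mapRange (· / p) (Nat.zero_div p)) (ρ (coeff m g)), ?_⟩
  rw [sum_pow_char]
  conv_rhs => rw [g.as_sum]
  refine Finset.sum_congr rfl fun m hm => ?_
  rw [monomial_pow, hρ]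
  refine congrArg (fun m => monomial m _) (Finsupp.ext fun i => ?_)
  simp [Nat.mul_div_cancel' (hdvd m hm i)]

/-- Over an algebraically closed field, a prime ideal of a polynomial ring that is stable under
the partial derivatives is zero. -/
lemma eq_bot_of_pderiv_mem {σ k : Type*} [Field k] [IsAlgClosed k]
    (J : Ideal (MvPolynomial σ k)) [hJ : J.IsPrime] (h : ∀ i, ∀ g ∈ J, pderiv i g ∈ J) : J = ⊥ := by
  have key : ∀ d : ℕ, ∀ g ∈ J, g.totalDegree = d → g = 0 := by
    intro d
    induction d using Nat.strong_induction_on with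
    | _ d ih =>
      intro g hg hd
      by_cases h0 : g.totalDegree = 0
      · rw [totalDegree_eq_zero_iff_eq_C] at h0
        by_contra hne
        rw [h0] at hg hne
        have hu : IsUnit (C (coeff 0 g) : MvPolynomial σ k) :=
          (IsUnit.mk0 _ fun h => hne (by rw [h, C_0])).map C
        exact hJ.ne_top (Ideal.eq_top_of_isUnit_mem _ hg hu)
      -- The derivatives lie in `J` and have smaller degree, so they vanish by induction.
      · have hz (i) : pderiv i g = 0 :=
          ih _ (hd ▸ totalDegree_pderiv_lt i (Nat.pos_of_ne_zero h0)) _ (h i g hg) rfl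
        obtain ⟨p, hp⟩ := CharP.exists k
        rcases CharP.char_is_prime_or_zero k p with hp' | rfl
        · have : Fact p.Prime := ⟨hp'⟩
          obtain ⟨f, hf⟩ := exists_pow_of_pderiv_eq_zero
            (fun a => IsAlgClosed.exists_pow_nat_eq a hp'.pos) hz
          have hfJ : f ∈ J := hJ.mem_of_pow_mem p (hf ▸ hg)
          have hf0 : f = 0 := by
            by_cases hfd : f.totalDegree = 0
            · refine absurd ?_ h0
              rw [← hf]
              have := totalDegree_pow f p
              rw [hfd, mul_zero] at this
              exact Nat.le_zero.1 this
            -- A nonconstant root `f` of `g = f ^ p` has strictly smaller degree than `g`, so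
            -- induction applies to it.
            · refine ih _ ?_ f hfJ rfl
              have hfne : f ≠ 0 := by
                rintro rfl
                exact hfd totalDegree_zero
              have h1 : g.totalDegree = f.totalDegree + (f ^ (p - 1)).totalDegree := by
                rw [← totalDegree_mul_of_isDomain hfne (pow_ne_zero _ hfne), ← pow_succ',
                  Nat.sub_add_cancel hp'.one_le, hf]
              have h2 : f ^ (p - 1) = f * f ^ (p - 2) := by
                rw [← pow_succ']
                congr 1
                have := hp'.two_le
                omega
              rw [h2, totalDegree_mul_of_isDomain hfne (pow_ne_zero _ hfne)] at h1
              omega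
          rw [← hf, hf0, zero_pow hp'.ne_zero]
        · have : CharZero k := CharP.charP_to_charZero k
          refine absurd ?_ h0
          rw [← Nat.le_zero, totalDegree, Finset.sup_le_iff]
          intro m hm
          have hm0 : m = 0 := by
            ext i
            by_contra hmi
            have h1 := sub_single_add_single hmi
            have h2 := congrArg (coeff (m - Finsupp.single i 1)) (hz i)
            rw [coeff_pderiv, h1, coeff_zero, mul_eq_zero] at h2
            exact Nat.cast_add_one_ne_zero _ (h2.resolve_left (mem_support_iff.1 hm))
          simp [hm0]
  exact (eq_bot_iff).2 fun g hg => key _ g hg rfl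

lemma derivation_aeval {σ k A M : Type*} [Fintype σ] [CommRing k] [CommRing A] [Algebra k A]
    [AddCommGroup M] [Module A M] [Module k M] (D : Derivation k A M)
    (α : MvPolynomial σ k →ₐ[k] A) (g : MvPolynomial σ k) :
    D (α g) = ∑ i, α (pderiv i g) • D (α (X i)) := by
  classical
  induction g using MvPolynomial.induction_on with
  | C a =>
    have : α (C a) = algebraMap k A a := α.commutes a
    rw [this, D.map_algebraMap]
    simp
  | add f g hf hg => simp only [map_add, hf, hg, add_smul, Finset.sum_add_distrib]
  | mul_X f j hf =>
    simp only [map_mul, Derivation.leibniz, hf, map_add, add_smul, Finset.sum_add_distrib,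
      smul_eq_mul, mul_smul, Finset.smul_sum, pderiv_X]
    have hs : ∑ i, α f • α (Pi.single (M := fun _ => MvPolynomial σ k) i 1 j) • D (α (X i)) =
        α f • D (α (X j)) := by
      rw [Finset.sum_eq_single j (fun i _ hi => by simp [hi.symm]) (by simp)]
      simp
    rw [hs]

variable {k A : Type*} [Field k] [CommRing A] [Algebra k A]

/-- If the elements of `A` are quotients of elements in the image of a polynomial ring, then the
differentials of the variables generate the module of differentials. -/
lemma span_differentials_eq_top {σ : Type*} [Fintype σ] (α : MvPolynomial σ k →ₐ[k] A)
    (hloc : ∀ a, ∃ c s, IsUnit (α s) ∧ a * α s = α c) :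
    Submodule.span A (Set.range fun i => KaehlerDifferential.D k A (α (X i))) = ⊤ := by
  have hα (g) : KaehlerDifferential.D k A (α g) ∈
      Submodule.span A (Set.range fun i => KaehlerDifferential.D k A (α (X i))) := by
    rw [derivation_aeval]
    exact sum_mem fun i _ => Submodule.smul_mem _ _ (Submodule.subset_span ⟨i, rfl⟩)
  rw [eq_top_iff, ← KaehlerDifferential.span_range_derivation, Submodule.span_le]
  rintro _ ⟨a, rfl⟩
  obtain ⟨c, s, hs, has⟩ := hloc a
  -- This is the quotient rule: `α s • da` equals `d(α c) - a • d(α s)`, and `α s` is a unit.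
  have h1 := congrArg (KaehlerDifferential.D k A) has
  rw [Derivation.leibniz] at h1
  have h2 := hα c
  rw [← h1, Submodule.add_mem_iff_right _ (Submodule.smul_mem _ _ (hα s))] at h2
  exact (Submodule.smul_mem_iff_of_isUnit _ hs).1 h2

/-- A lower bound for the rank of the module of differentials. -/
lemma le_rank_of_surjective_snd {M : Type*} [AddCommGroup M] [Module k M] [Module kᵐᵒᵖ M]
    [IsCentralScalar k M] [FiniteDimensional k M]
    (Θ : A →ₐ[k] TrivSqZeroExt k M) (hΘ : Submodule.span k (Set.range fun a => (Θ a).snd) = ⊤)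
    {n : ℕ} (b : Module.Basis (Fin n) A (Ω[A⁄k])) : Module.finrank k M ≤ n := by
  let ev : A →ₐ[k] k := (TrivSqZeroExt.fstHom k k M).comp Θ
  -- With `A` acting on `M` through the value at the point, the second component of `Θ` is a
  -- derivation. It factors through the differentials, so the images of a basis of `Ω` span `M` over
  -- `k`.
  let : Module A M := Module.compHom M ev.toRingHom
  have hsmul (a : A) (m : M) : a • m = (Θ a).fst • m := rfl
  have hst : IsScalarTower k A M := ⟨fun c a m => by
    rw [hsmul, hsmul, map_smul, TrivSqZeroExt.fst_smul, smul_assoc]⟩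
  let D : Derivation k A M := Derivation.mk' (TrivSqZeroExt.sndHom k M ∘ₗ Θ.toLinearMap)
    fun a a' => by
      simp [hsmul]
  have hD (a) : D a = (Θ a).snd := rfl
  let T := D.liftKaehlerDifferential
  have h1 : Submodule.span k (Set.range fun i => T (b i)) = ⊤ := by
    rw [eq_top_iff, ← hΘ, Submodule.span_le]
    rintro _ ⟨a, rfl⟩
    have h2 : (Θ a).snd = T (KaehlerDifferential.D k A a) := by
      rw [← hD]
      exact (D.liftKaehlerDifferential_comp_D a).symm
    dsimp only
    rw [h2, ← b.sum_repr (KaehlerDifferential.D k A a), map_sum]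
    refine sum_mem fun i _ => ?_
    rw [map_smul, hsmul]
    exact Submodule.smul_mem _ _ (Submodule.subset_span ⟨i, rfl⟩)
  have h3 := finrank_range_le_card (R := k) (fun i => T (b i))
  rw [Set.finrank, h1, finrank_top, Fintype.card_fin] at h3
  exact h3

variable {r : ℕ}

/-- The first order expansion at the origin. -/
def firstOrder (k : Type*) [Field k] (r : ℕ) :
    MvPolynomial (Fin r) k →ₐ[k] TrivSqZeroExt k (Fin r → k) :=
  aeval fun j => TrivSqZeroExt.inr (Pi.single j 1)

/-- By `hloc`, `A` is the localization of the image of `α` at the elements that become units. The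
first order expansion descends to the image by `hker` and extends to the localization by `hunit`. -/
lemma exists_firstOrder_lift (α : MvPolynomial (Fin r) k →ₐ[k] A)
    (hloc : ∀ a, ∃ c s, IsUnit (α s) ∧ a * α s = α c)
    (hker : ∀ g, α g = 0 → firstOrder k r g = 0)
    (hunit : ∀ g, IsUnit (α g) → IsUnit (firstOrder k r g)) :
    ∃ Θ : A →ₐ[k] TrivSqZeroExt k (Fin r → k), ∀ g, Θ (α g) = firstOrder k r g := by
  let θ : α.range →ₐ[k] TrivSqZeroExt k (Fin r → k) :=
    AlgHom.liftOfSurjective α.rangeRestrict α.rangeRestrict_surjective (firstOrder k r) fun g hg =>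
      hker g (congrArg Subtype.val hg)
  have hθ (g) : θ (α.rangeRestrict g) = firstOrder k r g :=
    AlgHom.liftOfSurjective_apply _ _ _ _ _
  let M : Submonoid α.range := (IsUnit.submonoid A).comap α.range.val
  have hM : IsLocalization M A := by
    constructor
    constructor
    · exact fun y => y.2
    · intro a
      obtain ⟨c, s, hs, h⟩ := hloc a
      exact ⟨⟨⟨α c, c, rfl⟩, ⟨⟨α s, s, rfl⟩, hs⟩⟩, h⟩
    · intro x y h
      exact ⟨1, by rw [Subtype.ext h]⟩
  have hu (y : M) : IsUnit (θ y) := by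
    obtain ⟨⟨_, g, rfl⟩, hy⟩ := y
    have := hunit g hy
    rw [← hθ] at this
    exact this
  refine ⟨IsLocalization.liftAlgHom (M := M) (f := θ) hu, fun g => ?_⟩
  have := IsLocalization.lift_eq (M := M) (S := A) (g := θ.toRingHom) hu (α.rangeRestrict g)
  exact this.trans (hθ g)

/-- A variety whose tangent space at the origin of `𝔸ʳ` is the whole `kʳ` and which is
smooth there is `𝔸ʳ`. -/
theorem injective_of_standardSmooth [IsAlgClosed k] [IsDomain A] {n : ℕ}
    [Algebra.IsStandardSmoothOfRelativeDimension n k A]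
    (α : MvPolynomial (Fin r) k →ₐ[k] A)
    (hloc : ∀ a, ∃ c s, IsUnit (α s) ∧ a * α s = α c)
    (hker : ∀ g, α g = 0 → firstOrder k r g = 0)
    (hunit : ∀ g, IsUnit (α g) → IsUnit (firstOrder k r g)) :
    r = n ∧ Function.Injective α := by
  have : Algebra.IsStandardSmooth k A :=
    Algebra.IsStandardSmoothOfRelativeDimension.isStandardSmooth n
  have hrank := Algebra.IsStandardSmoothOfRelativeDimension.rank_kaehlerDifferential
    (R := k) (S := A) n
  have hspan := span_differentials_eq_top α hloc
  have hfin : Module.Finite A (Ω[A⁄k]) := ⟨by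
    rw [← hspan]
    exact Submodule.fg_span (Set.finite_range _)⟩
  have b : Module.Basis (Fin n) A (Ω[A⁄k]) :=
    Module.finBasisOfFinrankEq A _ (Module.finrank_eq_of_rank_eq hrank)
  obtain ⟨Θ, hΘ⟩ := exists_firstOrder_lift α hloc hker hunit
  have hX (j) : (Θ (α (X j))).snd = Pi.single j (1 : k) := by
    rw [hΘ, firstOrder, aeval_X, TrivSqZeroExt.snd_inr]
  -- The expansion `Θ` reaches all of `kʳ`, so the differentials have rank at least `r`.
  have hrn : r ≤ n := by
    have h1 : Submodule.span k (Set.range fun a => (Θ a).snd) = ⊤ := by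
      rw [eq_top_iff, ← (Pi.basisFun k (Fin r)).span_eq]
      refine Submodule.span_mono ?_
      rintro _ ⟨j, rfl⟩
      exact ⟨α (X j), by simp [hX]⟩
    simpa using le_rank_of_surjective_snd Θ h1 b
  let f : (Fin r → A) →ₗ[A] (Ω[A⁄k]) :=
    Fintype.linearCombination A fun i => KaehlerDifferential.D k A (α (X i))
  have hf : Function.Surjective f := by
    rw [← LinearMap.range_eq_top, Fintype.range_linearCombination, hspan]
  -- Conversely, the `r` differentials of the variables generate a free module of rank `n`.
  have hnr : n ≤ r := le_of_fin_surjective A (b.equivFun.toLinearMap ∘ₗ f)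
    (b.equivFun.surjective.comp hf)
  obtain rfl : r = n := le_antisymm hrn hnr
  -- After `r = n`, `f` is a surjection between free modules of the same finite rank, hence
  -- injective: the `dxᵢ` are independent.
  have hinj : Function.Injective f :=
    OrzechProperty.injective_of_surjective_of_injective b.equivFun.symm.toLinearMap f
      b.equivFun.symm.injective hf
  refine ⟨rfl, ?_⟩
  have hprime : (RingHom.ker α).IsPrime := RingHom.ker_isPrime _
  refine (RingHom.injective_iff_ker_eq_bot _).2 (eq_bot_of_pderiv_mem (RingHom.ker α) ?_)
  intro i g hg
  have h1 : f (fun i => α (pderiv i g)) = 0 := by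
    have := derivation_aeval (KaehlerDifferential.D k A) α g
    rw [(RingHom.mem_ker).1 hg, map_zero] at this
    simpa [f, Fintype.linearCombination_apply] using this.symm
  rw [← map_zero f] at h1
  exact congrFun (hinj h1) i

end Smooth

/-! ### The linear span of a cone -/

section LinearSpan
attribute [local instance] MvPolynomial.gradedAlgebra
open MvPolynomial
variable {k : Type u} [Field k] {N : ℕ}

lemma aeval_linearForms_linearForms [Infinite k] {n m : ℕ}
    {T : (Fin (n + 1) → k) →ₗ[k] (Fin (m + 1) → k)} {M : (Fin (m + 1) → k) →ₗ[k] (Fin (n + 1) → k)}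
    (hMT : ∀ c, M (T c) = c) (j : Fin (n + 1)) :
    aeval (linearForms T) (linearForms M j) = X j := by
  refine MvPolynomial.funext fun c => ?_
  rw [eval_aeval_linearForms, eval_linearForms, hMT, eval_X]

/-- A subspace containing the nonzero vector `P` is the image of an injective linear map sending
the first basis vector to `P`. -/
lemma exists_parametrization (V : Submodule k (Fin (N + 1) → k)) {P : Fin (N + 1) → k}
    (hP : P ∈ V) (hP0 : P ≠ 0) : ∃ (r : ℕ) (T : (Fin (r + 1) → k) →ₗ[k] (Fin (N + 1) → k))
      (M : (Fin (N + 1) → k) →ₗ[k] (Fin (r + 1) → k)), (∀ c, M (T c) = c) ∧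
      LinearMap.range T = V ∧ T (Pi.single 0 1) = P := by
  obtain ⟨χ, hχ⟩ : ∃ χ : Module.Dual k (Fin (N + 1) → k), χ P = 1 := by
    obtain ⟨i, hi⟩ := Function.ne_iff.1 hP0
    exact ⟨(P i)⁻¹ • LinearMap.proj i, by simpa using inv_mul_cancel₀ hi⟩
  -- `V` is the direct sum of the line of `P` and `V ∩ ker χ`, so `P` followed by a basis of the
  -- latter is a basis of `V`.
  obtain ⟨V₀, hV₀⟩ : ∃ V₀, V₀ = V ⊓ LinearMap.ker χ := ⟨_, rfl⟩
  obtain ⟨r, ⟨b⟩⟩ : ∃ r, Nonempty (Module.Basis (Fin r) k V₀) := ⟨_, ⟨Module.finBasis k V₀⟩⟩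
  obtain ⟨w, hw0, hws⟩ : ∃ w : Fin (r + 1) → Fin (N + 1) → k, w 0 = P ∧
      ∀ i, w (Fin.succ i) = b i := ⟨Fin.cons P fun i => (b i : _ → k), rfl, fun _ => rfl⟩
  have hspan : Submodule.span k (Set.range fun i => (b i : Fin (N + 1) → k)) = V₀ := by
    have := congrArg (Submodule.map V₀.subtype) b.span_eq
    rwa [Submodule.map_span, Submodule.map_top, Submodule.range_subtype, ← Set.range_comp] at this
  have hw : LinearIndependent k w := by
    refine linearIndependent_finSucc.2 ⟨?_, ?_⟩
    · have h1 : Fin.tail w = fun i => (b i : Fin (N + 1) → k) := funext hws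
      rw [h1]
      exact b.linearIndependent.map' V₀.subtype (Submodule.ker_subtype _)
    · have h1 : Fin.tail w = fun i => (b i : Fin (N + 1) → k) := funext hws
      rw [h1, hspan, hw0, hV₀]
      intro h
      exact one_ne_zero (hχ.symm.trans h.2)
  let T := Fintype.linearCombination k w
  have hT : LinearMap.ker T = ⊥ := LinearMap.ker_eq_bot.2 hw.fintypeLinearCombination_injective
  obtain ⟨M, hM⟩ := T.exists_leftInverse_of_injective hT
  refine ⟨_, T, M, fun c => LinearMap.congr_fun hM c, ?_, ?_⟩
  · rw [Fintype.range_linearCombination]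
    refine le_antisymm (Submodule.span_le.2 ?_) fun x hx => ?_
    · rintro _ ⟨i, rfl⟩
      refine Fin.cases (hw0 ▸ hP) (fun i => ?_) i
      rw [hws]
      exact (hV₀.le (b i).2).1
    · have h1 : x - χ x • P ∈ V₀ :=
        hV₀ ▸ ⟨sub_mem hx (V.smul_mem _ hP), by simp [hχ]⟩
      rw [← hspan] at h1
      have h2 : Submodule.span k (Set.range fun i => (b i : Fin (N + 1) → k)) ≤
          Submodule.span k (Set.range w) :=
        Submodule.span_mono (by rintro _ ⟨i, rfl⟩; exact ⟨i.succ, hws i⟩)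
      have h3 := add_mem (h2 h1) ((Submodule.span k (Set.range w)).smul_mem (χ x)
        (Submodule.subset_span ⟨0, rfl⟩))
      rwa [hw0, sub_add_cancel] at h3
  · simp [T, hw0]

lemma eval_linear {l : MvPolynomial (Fin (N + 1)) k} (hl : l ∈ coordRing k N 1)
    (w : Fin (N + 1) → k) : eval w l = ∑ i, coeff (Finsupp.single i 1) l * w i := by
  conv_lhs => rw [linear_eq_sum hl]
  simp

/-- The linear span of the variety with generic point `η`. -/
def linearSpan (η : (Pn k N).left) : Submodule k (Fin (N + 1) → k) where
  carrier := {w | ∀ l ∈ coordRing k N 1, Vanishes l η → eval w l = 0}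
  zero_mem' l hl _ := by
    rw [eval_linear hl]
    simp
  add_mem' {a b} ha hb l hl hη := by
    have h1 := ha l hl hη
    have h2 := hb l hl hη
    rw [eval_linear hl] at h1 h2 ⊢
    simp only [Pi.add_apply, mul_add, Finset.sum_add_distrib, h1, h2, add_zero]
  smul_mem' c w hw l hl hη := by
    have h := eval_mul_of_isHomogeneous hl c w
    rw [hw l hl hη, mul_zero] at h
    exact h

end LinearSpan

/-! ### The tangent space of a cone at its vertex. -/

section Tangent
attribute [local instance] MvPolynomial.gradedAlgebra
open MvPolynomial
variable {k : Type u} [Field k] {N : ℕ}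

/-- First order Taylor expansion at `P`, with increments in a square-zero ideal. -/
lemma aeval_inl_add_inr {σ M : Type*} [Fintype σ] [AddCommGroup M] [Module k M] [Module kᵐᵒᵖ M]
    [IsCentralScalar k M] (P : σ → k) (q : σ → M) (f : MvPolynomial σ k) :
    aeval (fun i => TrivSqZeroExt.inl (P i) + TrivSqZeroExt.inr (q i)) f =
      TrivSqZeroExt.inl (eval P f) + TrivSqZeroExt.inr (∑ i, eval P (pderiv i f) • q i) := by
  classical
  induction f using MvPolynomial.induction_on with
  | C a =>
    have h : aeval (fun i => TrivSqZeroExt.inl (P i) + TrivSqZeroExt.inr (q i)) (C a) =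
      (TrivSqZeroExt.inl a : TrivSqZeroExt k M) := AlgHom.commutes _ a
    rw [h]
    simp
  | add f g hf hg =>
    rw [map_add, hf, hg]
    ext <;> simp [add_smul, Finset.sum_add_distrib]
  | mul_X f j hf =>
    rw [map_mul, hf, aeval_X]
    ext
    · simp
    · have hs : ∑ i, eval P f • eval P (Pi.single (M := fun _ => MvPolynomial σ k) i 1 j) • q i =
          eval P f • q j := by
        rw [Finset.sum_eq_single j (fun i _ hi => by simp [hi.symm]) (by simp)]
        simp
      simp [pderiv_X, add_smul, Finset.sum_add_distrib, Finset.smul_sum, mul_smul, ← hs]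

variable {η : (Pn k N).left} {P : Fin (N + 1) → k} {D : Set (Fin (N + 1) → k)}

/-- The polynomials vanishing on a cone have no linear terms at the vertex along the linear span. -/
lemma IsConical.eval_sum_pderiv [Infinite k] (h : IsConical η P D)
    {f : MvPolynomial (Fin (N + 1)) k} (hf : Vanishes f η) {u : Fin (N + 1) → k}
    (hu : u ∈ linearSpan η) : ∑ i, eval P (pderiv i f) * u i = 0 := by
  -- The differential of `f` at `P`, as a linear form. To vanish on the span it only has to vanish
  -- on `D`.
  let l : MvPolynomial (Fin (N + 1)) k := ∑ i, C (eval P (pderiv i f)) * X i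
  have hl : l ∈ coordRing k N 1 := sum_mem fun _ _ => isHomogeneous_C_mul_X _ _
  have hle (w : Fin (N + 1) → k) : eval w l = ∑ i, eval P (pderiv i f) * w i := by simp [l]
  rw [← hle]
  refine hu l hl ((h.dense 1 l hl).2 fun w hw => ?_)
  let g : Polynomial k := aeval (fun i => Polynomial.C (P i) + Polynomial.X * Polynomial.C (w i)) f
  have hg (b : k) : g.eval b = eval (fun i => b * w i + P i) f := by
    have : (Polynomial.aeval b).comp (aeval (fun i => Polynomial.C (P i) +
        Polynomial.X * Polynomial.C (w i))) = aeval (R := k) fun i => b * w i + P i := by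
      ext i
      simp only [AlgHom.comp_apply, aeval_X, map_add, map_mul, Polynomial.aeval_C,
        Polynomial.aeval_X, Algebra.algebraMap_self, RingHom.id_apply]
      ring
    have h2 := DFunLike.congr_fun this f
    rwa [aeval_eq_eval] at h2
  have hg0 : g = 0 := Polynomial.eq_zero_of_infinite_isRoot g
    (Set.Infinite.mono (s := {0}ᶜ) (fun b hb => (hg b).trans (by
      simpa using h.eval_smul_add hf hw hb 1)) (Set.finite_singleton 0).infinite_compl)
  -- The polynomial `b ↦ f(P + b w)` is zero; putting `b = ε` with `ε² = 0` reads off its linear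
  -- coefficient `l(w)`.
  have h1 : (Polynomial.aeval (TrivSqZeroExt.inr 1 : TrivSqZeroExt k k)).comp
      (aeval (fun i => Polynomial.C (P i) + Polynomial.X * Polynomial.C (w i))) =
      aeval (R := k) fun i => TrivSqZeroExt.inl (P i) + TrivSqZeroExt.inr (w i) := by
    ext i <;> simp [TrivSqZeroExt.algebraMap_eq_inl]
  have h2 := DFunLike.congr_fun h1 f
  have h3 : aeval (fun i => Polynomial.C (P i) + Polynomial.X * Polynomial.C (w i)) f = 0 := hg0
  rw [AlgHom.comp_apply, h3, map_zero, aeval_inl_add_inr] at h2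
  have h4 := congrArg TrivSqZeroExt.snd h2
  rw [hle]
  simpa using h4.symm

lemma IsConical.mem_linearSpan (h : IsConical η P D) {w : Fin (N + 1) → k} (hw : w ∈ D) :
    w ∈ linearSpan η :=
  fun l hl hη => (h.dense 1 l hl).1 hη w hw

lemma IsConical.vertex_mem_linearSpan [Infinite k] (h : IsConical η P D) : P ∈ linearSpan η :=
  fun _ _ hη => h.eval_vertex hη

/-- Every polynomial agrees with a homogeneous one on the affine chart given by a linear form. -/
lemma exists_homogenization {m : MvPolynomial (Fin (N + 1)) k} (hm : m ∈ coordRing k N 1)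
    (f : MvPolynomial (Fin (N + 1)) k) : ∃ d, ∃ f' ∈ coordRing k N d,
      ∀ {B : Type u} [CommRing B] [Algebra k B] (β : MvPolynomial (Fin (N + 1)) k →ₐ[k] B),
        β m = 1 → β f' = β f := by
  refine ⟨f.totalDegree, ∑ d ∈ Finset.range (f.totalDegree + 1),
    homogeneousComponent d f * m ^ (f.totalDegree - d), sum_mem fun d hd => ?_, fun β hβ => ?_⟩
  · have h1 := (homogeneousComponent_isHomogeneous d f).mul
      ((show m.IsHomogeneous 1 from hm).pow (f.totalDegree - d))
    have h2 : d + 1 * (f.totalDegree - d) = f.totalDegree := by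
      have := Finset.mem_range.1 hd
      omega
    rwa [h2] at h1
  · conv_rhs => rw [← sum_homogeneousComponent f]
    simp [hβ]

/-- A homogeneous polynomial that vanishes on an affine chart vanishes. -/
lemma eq_zero_of_dehomogenization_eq_zero [Infinite k] {r d : ℕ}
    {h : MvPolynomial (Fin (r + 1)) k} (hh : h.IsHomogeneous d)
    (h0 : aeval (Fin.cons 1 X : Fin (r + 1) → MvPolynomial (Fin r) k) h = 0) : h = 0 := by
  -- The factor `X 0` disposes of the vectors with `c 0 = 0`, about which the chart says nothing.
  suffices X 0 * h = 0 from (mul_eq_zero.1 this).resolve_left (X_ne_zero 0)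
  refine MvPolynomial.funext fun c => ?_
  rw [map_mul, eval_X, map_zero]
  rcases eq_or_ne (c 0) 0 with hc | hc
  · rw [hc, zero_mul]
  have h1 : c = fun i => c 0 * (Fin.cons 1 fun j => c (Fin.succ j) / c 0 : Fin (r + 1) → k) i := by
    ext i
    refine Fin.cases ?_ (fun j => ?_) i
    · simp
    · simp only [Fin.cons_succ]
      field_simp
  have h2 : (aeval (fun j => c (Fin.succ j) / c 0) : MvPolynomial (Fin r) k →ₐ[k] k).comp
      (aeval (Fin.cons 1 X : Fin (r + 1) → MvPolynomial (Fin r) k)) =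
      aeval (Fin.cons 1 fun j => c (Fin.succ j) / c 0 : Fin (r + 1) → k) := by
    ext i
    refine Fin.cases ?_ (fun j => ?_) i <;> simp
  have h3 := DFunLike.congr_fun h2 h
  rw [AlgHom.comp_apply, h0, map_zero, aeval_eq_eval] at h3
  have h4 : eval c h = c 0 ^ d * eval (Fin.cons 1 fun j => c (Fin.succ j) / c 0) h := by
    conv_lhs => rw [h1]
    exact eval_mul_of_isHomogeneous hh _ _
  rw [h4, ← h3, mul_zero, mul_zero]

/-- A cone that is smooth of dimension `n` at the vertex is a linear subspace of dimension `n`. The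
ring `A` is a localization of the coordinate ring of an affine neighbourhood of the vertex. -/
theorem IsConical.vanishes_iff_of_smooth [IsAlgClosed k] (h : IsConical η P D) {r n : ℕ}
    {T : (Fin (r + 1) → k) →ₗ[k] (Fin (N + 1) → k)} {M : (Fin (N + 1) → k) →ₗ[k] (Fin (r + 1) → k)}
    (hMT : ∀ c, M (T c) = c) (hT : LinearMap.range T = linearSpan η) (hTP : T (Pi.single 0 1) = P)
    {A : Type u} [CommRing A] [IsDomain A] [Algebra k A]
    [Algebra.IsStandardSmoothOfRelativeDimension n k A]
    (H : MvPolynomial (Fin (N + 1)) k →ₐ[k] A) (hH0 : H (linearForms M 0) = 1)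
    (hker : ∀ d, ∀ f ∈ coordRing k N d, H f = 0 ↔ Vanishes f η)
    (hloc : ∀ a, ∃ c s, IsUnit (H s) ∧ a * H s = H c)
    (hunit : ∀ d, ∀ f ∈ coordRing k N d, IsUnit (H f) → eval P f ≠ 0) :
    r = n ∧ ∀ d, ∀ f ∈ coordRing k N d, Vanishes f η ↔ aeval (linearForms T) f = 0 := by
  -- `π` restricts polynomials to the linear span, `ρ` passes to the chart where the first
  -- coordinate is `1`, and `α` maps functions on this chart `𝔸ʳ` to functions on the variety.
  let ρ : MvPolynomial (Fin (r + 1)) k →ₐ[k] MvPolynomial (Fin r) k := aeval (Fin.cons 1 X)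
  let π : MvPolynomial (Fin (N + 1)) k →ₐ[k] MvPolynomial (Fin (r + 1)) k := aeval (linearForms T)
  let α : MvPolynomial (Fin r) k →ₐ[k] A := aeval fun j => H (linearForms M j.succ)
  have hπM (j) : π (linearForms M j) = X j := aeval_linearForms_linearForms hMT j
  have hαρ : α.comp ρ = H.comp (aeval (linearForms M)) := by
    ext j
    refine Fin.cases ?_ (fun j => ?_) j <;> simp [α, ρ, hH0]
  have hHs : H = (H.comp (aeval (linearForms M))).comp π := by
    ext i
    have hl : aeval (linearForms M) (linearForms T i) ∈ coordRing k N 1 := by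
      have : aeval (linearForms M) (linearForms T i) =
          ∑ j, C (T (Pi.single j 1) i) * linearForms M j := by
        simp [linearForms]
      rw [this]
      exact sum_mem fun j _ => by
        rw [C_mul']
        exact Submodule.smul_mem _ _ (linearForms_mem M j)
    have h1 : X i - aeval (linearForms M) (linearForms T i) ∈ coordRing k N 1 :=
      sub_mem (isHomogeneous_X k i) hl
    -- `T ∘ M` is the identity on the range of `T`, which is the span, so this linear form vanishes
    -- on the variety and `H` kills it.
    have h2 := (hker 1 _ h1).2 ((h.dense 1 _ h1).2 fun w hw => by
      have h3 := h.mem_linearSpan hw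
      rw [← hT] at h3
      obtain ⟨c, rfl⟩ := h3
      rw [map_sub, eval_aeval_linearForms, eval_linearForms, hMT, eval_X, sub_self])
    rw [map_sub, sub_eq_zero] at h2
    rw [AlgHom.comp_apply, AlgHom.comp_apply, h2]
    simp [π]
  have hHα : H = (α.comp ρ).comp π := by rw [hαρ]; exact hHs
  have hHα' (f) : α (ρ (π f)) = H f := (DFunLike.congr_fun hHα f).symm
  have hπ0 : ρ (π (linearForms M 0)) = 1 := by
    rw [hπM]
    simp [ρ]
  -- Every polynomial on the chart is the dehomogenization of a form, so the hypotheses on forms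
  -- apply to it.
  have hlift (g : MvPolynomial (Fin r) k) : ∃ d, ∃ f ∈ coordRing k N d, ρ (π f) = g := by
    obtain ⟨d, f', hf', hβ⟩ := exists_homogenization (linearForms_mem M 0)
      (aeval (fun j : Fin r => linearForms M j.succ) g)
    refine ⟨d, f', hf', ?_⟩
    have h1 := hβ (ρ.comp π) hπ0
    have h2 : (ρ.comp π).comp (aeval (fun j : Fin r => linearForms M j.succ)) = AlgHom.id k _ := by
      ext j
      simp [hπM, ρ]
    exact h1.trans (DFunLike.congr_fun h2 g)
  -- Since `T` sends the first basis vector to `P`, the origin of the chart is `P`, and the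
  -- expansion there is the Taylor expansion of `f` at `P` along the span.
  have hΘ (f) : firstOrder k r (ρ (π f)) = TrivSqZeroExt.inl (eval P f) + TrivSqZeroExt.inr
      (∑ i, eval P (pderiv i f) • fun j : Fin r => T (Pi.single j.succ 1) i) := by
    rw [← aeval_inl_add_inr]
    have h1 : ((firstOrder k r).comp ρ).comp π = aeval fun i => TrivSqZeroExt.inl (P i) +
        TrivSqZeroExt.inr fun j : Fin r => T (Pi.single j.succ 1) i := by
      ext i : 1
      have h2 : ∑ j : Fin r, T (Pi.single j.succ 1) i • (Pi.single j 1 : Fin r → k) =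
          fun j : Fin r => T (Pi.single j.succ 1) i := by
        ext j
        simp [Finset.sum_apply, Pi.single_apply]
      rw [aeval_X, ← h2]
      simp [π, ρ, linearForms, Fin.sum_univ_succ, hTP, firstOrder, TrivSqZeroExt.algebraMap_eq_inl,
        TrivSqZeroExt.inr_sum]
      exact Finset.sum_congr rfl fun _ _ => by
        rw [TrivSqZeroExt.inl_mul_inr, TrivSqZeroExt.inr_smul]
    exact DFunLike.congr_fun h1 f
  have hmain := injective_of_standardSmooth (n := n) α (fun a => ?_) (fun g hg => ?_) fun g hg => ?_
  · refine ⟨hmain.1, fun d f hf => ?_⟩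
    rw [← hker d f hf, ← hHα', map_eq_zero_iff α hmain.2]
    refine ⟨fun h => eq_zero_of_dehomogenization_eq_zero (d := d) ?_ h, fun h => ?_⟩
    · have := IsHomogeneous.aeval (n := 1) (show f.IsHomogeneous d from hf) (linearForms T)
        (fun i => linearForms_mem T i)
      simpa using this
    · exact (congrArg ρ h).trans (map_zero ρ)
  · obtain ⟨c, s, hs, has⟩ := hloc a
    exact ⟨ρ (π c), ρ (π s), by rwa [hHα'], by rwa [hHα', hHα']⟩
  · obtain ⟨d, f, hf, rfl⟩ := hlift g
    rw [hHα', hker d f hf] at hg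
    rw [hΘ, h.eval_vertex hg]
    have h1 : ∑ i, eval P (pderiv i f) • (fun j : Fin r => T (Pi.single j.succ 1) i) = 0 := by
      ext j
      have hu : T (Pi.single j.succ 1) ∈ linearSpan η := by
        rw [← hT]
        exact ⟨_, rfl⟩
      simpa using h.eval_sum_pderiv hg hu
    rw [h1]
    simp
  · obtain ⟨d, f, hf, rfl⟩ := hlift g
    rw [hHα'] at hg
    rw [hΘ, TrivSqZeroExt.isUnit_iff_isUnit_fst]
    simpa using hunit d f hf hg

end Tangent

/-! ### Affine charts of a projective variety -/

section Charts
attribute [local instance] MvPolynomial.gradedAlgebra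
open MvPolynomial
variable {k : Type u} [Field k] {N : ℕ} {X : Over (Spec (.of k))}

/-- For a form of degree `d`, evaluating at the functions `X i / m` gives `f / m ^ d`; in the full
localization this is homogeneity, `m ^ d f(X / m) = f(X)`. -/
lemma away_mk_eq_aeval {m : MvPolynomial (Fin (N + 1)) k} (hm : m ∈ coordRing k N 1) {d : ℕ}
    {f : MvPolynomial (Fin (N + 1)) k} (hf : f ∈ coordRing k N d)
    {R : Type*} [CommRing R] (c : k →+* R) (θ : HomogeneousLocalization.Away (coordRing k N) m →+* R)
    (hθ : ∀ a, θ (HomogeneousLocalization.fromZeroRingHom (coordRing k N) _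
      (algebraMap k (coordRing k N 0) a)) = c a) :
    eval₂Hom c (fun i => θ (HomogeneousLocalization.Away.mk (coordRing k N) hm 1
      (MvPolynomial.X i) (by simpa using isHomogeneous_X k i))) f =
      θ (HomogeneousLocalization.Away.mk (coordRing k N) hm d f (by simpa using hf)) := by
  have h1 : c = θ.comp ((HomogeneousLocalization.fromZeroRingHom (coordRing k N) _).comp
      (algebraMap k (coordRing k N 0))) := RingHom.ext fun a => (hθ a).symm
  rw [h1]
  refine (hom_eval₂ f _ θ _).symm.trans (congrArg θ (HomogeneousLocalization.val_injective _ ?_))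
  let v : HomogeneousLocalization.Away (coordRing k N) m →+* Localization (Submonoid.powers m) :=
    algebraMap _ _
  change v _ = _
  have h2 : v.comp ((HomogeneousLocalization.fromZeroRingHom (coordRing k N) _).comp
      (algebraMap k (coordRing k N 0))) =
      (algebraMap (MvPolynomial (Fin (N + 1)) k) (Localization (Submonoid.powers m))).comp C := by
    ext a
    exact (HomogeneousLocalization.val_mk _).trans (Localization.mk_one_eq_algebraMap _)
  rw [hom_eval₂, h2, HomogeneousLocalization.Away.val_mk]
  have h3 : IsUnit (algebraMap (MvPolynomial (Fin (N + 1)) k) (Localization (Submonoid.powers m)) m) :=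
    IsLocalization.map_units (M := Submonoid.powers m) _ ⟨m, Submonoid.mem_powers m⟩
  rw [Localization.mk_eq_mk', IsLocalization.eq_mk'_iff_mul_eq, mul_comm, map_pow]
  have h4 := aeval_mul_of_isHomogeneous (k := k) (R := Localization (Submonoid.powers m)) hf
    (algebraMap _ _ m)
    (fun i => v (HomogeneousLocalization.Away.mk (coordRing k N) hm 1
      (MvPolynomial.X i) (by simpa using isHomogeneous_X k i)))
  have h5 (i) : algebraMap _ _ m * v (HomogeneousLocalization.Away.mk (coordRing k N) hm 1
      (MvPolynomial.X i) (by simpa using isHomogeneous_X k i)) =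
      algebraMap (MvPolynomial (Fin (N + 1)) k) (Localization (Submonoid.powers m))
        (MvPolynomial.X i) := by
    refine (congrArg (algebraMap _ (Localization (Submonoid.powers m)) m * ·)
      (HomogeneousLocalization.Away.val_mk (coordRing k N) 1 hm (MvPolynomial.X i) _)).trans ?_
    rw [Localization.mk_eq_mk', ← pow_one (algebraMap _ _ m), ← map_pow, mul_comm]
    exact IsLocalization.mk'_spec _ _ _
  simp only [h5] at h4
  refine h4.symm.trans ?_
  exact (aeval_algebraMap_apply (Localization (Submonoid.powers m)) MvPolynomial.X f).trans
    (congrArg _ (aeval_X_left_apply f))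

/-- The constants in the ring of functions on an open subset. -/
def scalarsOn (X : Over (Spec (.of k))) (U : X.left.Opens) : k →+* Γ(X.left, U) :=
  (X.left.presheaf.map (homOfLE le_top : U ⟶ ⊤).op).hom.comp (scalars X)

/-- Dehomogenization with respect to `m`, followed by restriction to an open subset of `X`. -/
def chartHom (φ : X ⟶ Pn k N) {m : MvPolynomial (Fin (N + 1)) k} {U : X.left.Opens}
    (hU : U ≤ φ.left ⁻¹ᵁ nonvanishing m) :
    HomogeneousLocalization.Away (coordRing k N) m →+* Γ(X.left, U) :=
  (Proj.awayToSection (coordRing k N) m ≫ φ.left.appLE (nonvanishing m) U hU).hom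

variable (φ : X ⟶ Pn k N) {m : MvPolynomial (Fin (N + 1)) k} {U : X.left.Opens}
    (hU : U ≤ φ.left ⁻¹ᵁ nonvanishing m)

lemma awayToSection_fromZero (a : k) :
    (Proj.awayToSection (coordRing k N) m).hom
      (HomogeneousLocalization.fromZeroRingHom (coordRing k N) _
        (algebraMap k (coordRing k N 0) a)) = scalarsOn (Pn k N) (nonvanishing m) a := by
  refine Subtype.ext (funext fun x => HomogeneousLocalization.val_injective _ ?_)
  refine Eq.trans ?_ (scalars_Pn_val a x.1).symm
  refine (ProjectiveSpectrum.Proj.awayToSection_apply _ m _ _).trans ?_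
  have h0 : HomogeneousLocalization.val (HomogeneousLocalization.fromZeroRingHom (coordRing k N)
      (Submonoid.powers m) (algebraMap k (coordRing k N 0) a)) =
        algebraMap (MvPolynomial (Fin (N + 1)) k) (Localization (Submonoid.powers m)) (C a) := by
    rw [← Localization.mk_one_eq_algebraMap]
    exact HomogeneousLocalization.val_mk _
  rw [h0, IsLocalization.map_eq]
  rfl

lemma chartHom_fromZero (a : k) :
    chartHom φ hU (HomogeneousLocalization.fromZeroRingHom (coordRing k N) _
      (algebraMap k (coordRing k N 0) a)) = scalarsOn X U a := by
  refine (congrArg (φ.left.appLE (nonvanishing m) U hU).hom (awayToSection_fromZero a)).trans ?_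
  have h := Scheme.Hom.map_appLE φ.left (V := U) hU
    (homOfLE le_top : nonvanishing m ⟶ ⊤).op
  refine (congrArg (fun q => q.hom (scalars (Pn k N) a)) h).trans ?_
  exact congrArg (X.left.presheaf.map (homOfLE le_top : U ⟶ ⊤).op).hom (scalars_comp φ a)

lemma mem_basicOpen_chartHom (hm : m ∈ coordRing k N 1) {d : ℕ}
    {f : MvPolynomial (Fin (N + 1)) k} (hf : f ∈ coordRing k N (d • 1)) {x : X.left} (hx : x ∈ U) :
    x ∈ X.left.basicOpen (chartHom φ hU (HomogeneousLocalization.Away.mk _ hm d f hf)) ↔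
      ¬ Vanishes f (φ.left x) := by
  have h1 := Scheme.basicOpen_appLE φ.left U (nonvanishing m) hU
    ((Proj.awayToSection (coordRing k N) m).hom (HomogeneousLocalization.Away.mk _ hm d f hf))
  have h2 : x ∈ X.left.basicOpen (chartHom φ hU (HomogeneousLocalization.Away.mk _ hm d f hf)) ↔
      x ∈ U ∧ φ.left x ∈ (Pn k N).left.basicOpen ((Proj.awayToSection (coordRing k N) m).hom
        (HomogeneousLocalization.Away.mk _ hm d f hf)) := by
    rw [chartHom]
    exact (Set.ext_iff.1 (congrArg (fun V : X.left.Opens => (V : Set X.left)) h1) x)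
  rw [h2, and_iff_right hx]
  exact mem_basicOpen_awayToSection (coordRing k N) hm f hf (φ.left x) (hU hx)

/-- On an integral scheme a function is zero exactly when its nonvanishing locus misses the generic
point. -/
lemma chartHom_eq_zero_iff [IsIntegral X.left] [Nonempty U] (hm : m ∈ coordRing k N 1) {d : ℕ}
    {f : MvPolynomial (Fin (N + 1)) k} (hf : f ∈ coordRing k N (d • 1)) :
    chartHom φ hU (HomogeneousLocalization.Away.mk _ hm d f hf) = 0 ↔
      Vanishes f (φ.left (genericPoint X.left)) := by
  have hη : genericPoint X.left ∈ U :=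
    ((genericPoint_spec X.left).mem_open_set_iff U.2).2 (by simpa using Set.nonempty_coe_sort.1 ‹Nonempty U›)
  rw [← basicOpen_eq_bot_iff, ← not_iff_not, ← mem_basicOpen_chartHom φ hU hm hf hη]
  refine ⟨fun h => ((genericPoint_spec X.left).mem_open_set_iff (X.left.basicOpen _).2).2 ?_,
    fun h h0 => ?_⟩
  · simpa using Opens.ne_bot_iff_nonempty _ |>.1 h
  · rw [h0] at h
    exact h

lemma isAffineOpen_nonvanishing (hm : m ∈ coordRing k N 1) :
    IsAffineOpen (nonvanishing m) :=
  Proj.isAffineOpen_basicOpen (coordRing k N) m hm one_pos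

lemma chartHom_surjective (hφ : IsClosedImmersion φ.left) (hm : m ∈ coordRing k N 1) :
    Function.Surjective (chartHom φ (le_refl (φ.left ⁻¹ᵁ nonvanishing m))) := by
  have h1 : Function.Surjective (φ.left.app (nonvanishing m)) :=
    φ.left.app_surjective _ (isAffineOpen_nonvanishing hm)
  have h2 : Function.Bijective (Proj.awayToSection (coordRing k N) m) :=
    ConcreteCategory.bijective_of_isIso (Proj.basicOpenIsoAway (coordRing k N) m hm one_pos).hom
  rw [chartHom, Scheme.Hom.appLE_eq_app]
  exact h1.comp h2.2

lemma map_chartHom {V : X.left.Opens} (hVU : V ≤ U) (a) :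
    (X.left.presheaf.map (homOfLE hVU).op).hom (chartHom φ hU a) = chartHom φ (hVU.trans hU) a :=
  congrArg (fun q => q.hom ((Proj.awayToSection (coordRing k N) m).hom a))
    (Scheme.Hom.appLE_map φ.left hU (homOfLE hVU).op)

/-- `Spec k` has one point, so the open set of the base is everything. A standard smooth
neighbourhood of `v` and the given `W` share a basic open neighbourhood of `v`, and standard
smoothness survives this localization. -/
lemma exists_standardSmooth_basicOpen {n : ℕ} (hn : SmoothOfRelativeDimension n X.hom) (v : X.left)
    {W : X.left.Opens} (hW : IsAffineOpen W) (hv : v ∈ W) :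
    ∃ g : Γ(X.left, W), v ∈ X.left.basicOpen g ∧
      (scalarsOn X (X.left.basicOpen g)).IsStandardSmoothOfRelativeDimension n := by
  obtain ⟨U', hU', V, hV, hvV, e, h⟩ := hn.exists_isStandardSmoothOfRelativeDimension v
  obtain rfl : U' = ⊤ := by
    refine top_unique fun (y : Spec (.of k)) _ => ?_
    rw [show y = X.hom v from Subsingleton.elim (α := PrimeSpectrum k) _ _]
    exact e hvV
  obtain ⟨f, g, hfg, hvf⟩ := exists_basicOpen_le_affine_inter hV hW v ⟨hvV, hv⟩
  refine ⟨g, hfg ▸ hvf, hfg ▸ ?_⟩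
  have : IsLocalization.Away f Γ(X.left, X.left.basicOpen f) := hV.isLocalization_basicOpen f
  have h1 := (RingHom.isStandardSmoothOfRelativeDimension_stableUnderCompositionWithLocalizationAway
    n).right Γ(X.left, X.left.basicOpen f) f (X.hom.appLE ⊤ V e).hom h
  have h2 := (RingHom.isStandardSmoothOfRelativeDimension_respectsIso
    (n := n)).cancel_left_isIso (Scheme.ΓSpecIso (.of k)).inv
      (X.hom.appLE ⊤ V e ≫ X.left.presheaf.map (homOfLE (X.left.basicOpen_le f)).op)
  have h3 := h2.2 h1
  rw [Scheme.Hom.appLE_map] at h3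
  exact h3

/-- A projective cone that is smooth at the vertex is a linear subspace. -/
theorem exists_linear_parametrization [IsAlgClosed k] [IsIntegral X.left] (hφ : IsClosedImmersion φ.left) {v : X.left}
    {P : Fin (N + 1) → k} {D : Set (Fin (N + 1) → k)} (hP : HasCoords (φ.left v) P)
    (hD : IsConical (φ.left (genericPoint X.left)) P D) {n : ℕ}
    (hn : SmoothOfRelativeDimension n X.hom) :
    ∃ (T : (Fin (n + 1) → k) →ₗ[k] (Fin (N + 1) → k)) (M : (Fin (N + 1) → k) →ₗ[k] (Fin (n + 1) → k)),
      (∀ c, M (T c) = c) ∧ ∀ d, ∀ f ∈ coordRing k N d,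
        Vanishes f (φ.left (genericPoint X.left)) ↔ aeval (linearForms T) f = 0 := by
  have hP0 : P ≠ 0 := by
    rintro rfl
    obtain ⟨i, hi⟩ := hP.ne_zero
    exact hi rfl
  obtain ⟨r, T, M, hMT, hT, hTP⟩ := exists_parametrization _ hD.vertex_mem_linearSpan hP0
  have hm : linearForms M 0 ∈ coordRing k N 1 := linearForms_mem M 0
  -- The first coordinate on the span equals `1` at `P = T e₀`, so the vertex lies in this chart.
  have hv : v ∈ φ.left ⁻¹ᵁ nonvanishing (linearForms M 0) := by
    intro h
    have := (hP 1 _ hm).1 h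
    rw [eval_linearForms, ← hTP, hMT] at this
    simp at this
  have hW : IsAffineOpen (φ.left ⁻¹ᵁ nonvanishing (linearForms M 0)) :=
    (isAffineOpen_nonvanishing hm).preimage φ.left
  obtain ⟨g, hvg, hg⟩ := exists_standardSmooth_basicOpen hn v hW hv
  have hgW : X.left.basicOpen g ≤ φ.left ⁻¹ᵁ nonvanishing (linearForms M 0) := X.left.basicOpen_le g
  have : Nonempty (X.left.basicOpen g) := ⟨⟨v, hvg⟩⟩
  let _ : Algebra k Γ(X.left, X.left.basicOpen g) := (scalarsOn X (X.left.basicOpen g)).toAlgebra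
  have : Algebra.IsStandardSmoothOfRelativeDimension n k Γ(X.left, X.left.basicOpen g) := hg
  have hloc : IsLocalization.Away g Γ(X.left, X.left.basicOpen g) := hW.isLocalization_basicOpen g
  let H : MvPolynomial (Fin (N + 1)) k →ₐ[k] Γ(X.left, X.left.basicOpen g) :=
    aeval fun i => chartHom φ hgW (HomogeneousLocalization.Away.mk (coordRing k N) hm 1
      (MvPolynomial.X i) (by simpa using isHomogeneous_X k i))
  have hH {d : ℕ} {f : MvPolynomial (Fin (N + 1)) k} (hf : f ∈ coordRing k N d) :
      H f = chartHom φ hgW (HomogeneousLocalization.Away.mk (coordRing k N) hm d f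
        (by simpa using hf)) :=
    away_mk_eq_aeval hm hf (scalarsOn X _) (chartHom φ hgW) (chartHom_fromZero φ hgW)
  have hsurj (a : Γ(X.left, φ.left ⁻¹ᵁ nonvanishing (linearForms M 0))) :
      ∃ f, H f = algebraMap _ Γ(X.left, X.left.basicOpen g) a := by
    obtain ⟨b, rfl⟩ := chartHom_surjective φ hφ hm a
    obtain ⟨d, f, hf, rfl⟩ := HomogeneousLocalization.Away.mk_surjective (coordRing k N) hm b
    exact ⟨f, (hH (by simpa using hf)).trans (map_chartHom φ le_rfl hgW _).symm⟩
  suffices h : r = n ∧ ∀ d, ∀ f ∈ coordRing k N d,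
      Vanishes f (φ.left (genericPoint X.left)) ↔ aeval (linearForms T) f = 0 by
    obtain ⟨rfl, h⟩ := h
    exact ⟨T, M, hMT, h⟩
  refine hD.vanishes_iff_of_smooth (n := n) hMT hT hTP H ?_ (fun d f hf => ?_) (fun a => ?_)
    (fun d f hf hu => ?_)
  · rw [hH hm, ← map_one (chartHom φ hgW)]
    congr 1
    refine HomogeneousLocalization.val_injective _ ?_
    rw [HomogeneousLocalization.Away.val_mk, HomogeneousLocalization.val_one]
    simp only [pow_one]
    exact Localization.mk_self (⟨linearForms M 0, _⟩ : Submonoid.powers (linearForms M 0))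
  · rw [hH hf]
    exact chartHom_eq_zero_iff φ hgW hm _
  · obtain ⟨⟨b, _, j, rfl⟩, hb⟩ := IsLocalization.surj (Submonoid.powers g) a
    obtain ⟨c, hc⟩ := hsurj b
    obtain ⟨s, hs⟩ := hsurj (g ^ j)
    refine ⟨c, s, hs ▸ ?_, by rw [hs, hc]; exact hb⟩
    exact IsLocalization.map_units _ (⟨g ^ j, j, rfl⟩ : Submonoid.powers g)
  · rw [hH hf] at hu
    rw [Ne, ← hP d f hf, ← mem_basicOpen_chartHom φ hgW hm (by simpa using hf) hvg,
      Scheme.basicOpen_of_isUnit _ hu]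
    exact hvg

end Charts

/-! ### Linear embeddings of projective spaces -/

lemma range_eq_closure_of_specializes {X Y : Type*} [TopologicalSpace X] [TopologicalSpace Y]
    {f : X → Y} (hf : Topology.IsClosedEmbedding f) {y : X} (hy : ∀ x, y ⤳ x) :
    Set.range f = closure {f y} := by
  refine subset_antisymm ?_ (closure_minimal (by simp) hf.isClosed_range)
  rintro _ ⟨x, rfl⟩
  exact ((hy x).map hf.continuous).mem_closure

section LinearEmbedding
attribute [local instance] MvPolynomial.gradedAlgebra
open MvPolynomial
variable {k : Type u} [Field k] {n N : ℕ}

lemma iSup_nonvanishing : ⨆ i : Fin (N + 1), nonvanishing (MvPolynomial.X i : MvPolynomial _ k) = ⊤ :=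
  top_unique fun x _ => by
    obtain ⟨j, hj⟩ := exists_variable_notMem x
    exact TopologicalSpace.Opens.mem_iSup.2 ⟨j, hj⟩

/-- The generic point of projective space. -/
def genericPrime (k : Type u) [Field k] (n : ℕ) : ProjectiveSpectrum (coordRing k n) where
  asHomogeneousIdeal := ⊥
  isPrime := Ideal.isPrime_bot
  not_irrelevant_le h := by
    have h1 : (MvPolynomial.X 0 : MvPolynomial (Fin (n + 1)) k) ∈ coordRing k n 1 := isHomogeneous_X k 0
    have h2 := h (HomogeneousIdeal.mem_irrelevant_of_mem _ one_pos h1)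
    exact MvPolynomial.X_ne_zero _ (Ideal.mem_bot.1 h2)

lemma genericPrime_specializes (x : (Pn k n).left) :
    (show (Pn k n).left from genericPrime k n) ⤳ x :=
  specializes_iff_mem_closure.2
    ((ProjectiveSpectrum.le_iff_mem_closure _ (genericPrime k n) (homPrime x)).1
      (show (⊥ : HomogeneousIdeal (coordRing k n)) ≤ (homPrime x).asHomogeneousIdeal from bot_le))

/-- The substitution of linear forms as a homomorphism of graded rings. -/
def linearGradedHom (T : (Fin (n + 1) → k) →ₗ[k] (Fin (N + 1) → k)) :
    GradedRingHom (coordRing k N) (coordRing k n) where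
  toRingHom := (aeval (linearForms T)).toRingHom
  map_mem {d f} hf := by
    have := IsHomogeneous.aeval (n := 1) hf (linearForms T) (linearForms_mem T)
    rwa [one_mul] at this

variable {T : (Fin (n + 1) → k) →ₗ[k] (Fin (N + 1) → k)}
  {M : (Fin (N + 1) → k) →ₗ[k] (Fin (n + 1) → k)}

lemma exists_linearGradedHom_eq [Infinite k] (hMT : ∀ c, M (T c) = c) {d : ℕ}
    {f : MvPolynomial (Fin (n + 1)) k} (hf : f ∈ coordRing k n d) :
    ∃ g ∈ coordRing k N d, linearGradedHom T g = f := by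
  refine ⟨aeval (linearForms M) f, (linearGradedHom M).map_mem hf, ?_⟩
  have : ((aeval (linearForms T)).comp (aeval (linearForms M)) : MvPolynomial (Fin (n + 1)) k →ₐ[k] _) =
      AlgHom.id k _ := by
    ext1 j
    exact (congrArg _ (aeval_X _ j)).trans (aeval_linearForms_linearForms hMT j)
  exact DFunLike.congr_fun this f

/-- Surjectivity of the substitution on forms ensures that the induced morphism of `Proj` is defined
everywhere. -/
lemma irrelevant_le_map [Infinite k] (hMT : ∀ c, M (T c) = c) :
    HomogeneousIdeal.irrelevant (coordRing k n) ≤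
      (HomogeneousIdeal.irrelevant (coordRing k N)).map (linearGradedHom T) := by
  refine (HomogeneousIdeal.irrelevant_le _).2 fun i hi f hf => ?_
  obtain ⟨g, hg, rfl⟩ := exists_linearGradedHom_eq hMT hf
  exact Ideal.mem_map_of_mem _ (HomogeneousIdeal.mem_irrelevant_of_mem _ hi hg)

/-- The morphism of projective spaces given by an injective linear map. -/
def linearEmbedding [Infinite k] (hMT : ∀ c, M (T c) = c) : (Pn k n).left ⟶ (Pn k N).left :=
  Proj.map (linearGradedHom T) (irrelevant_le_map hMT)

variable [Infinite k] (hMT : ∀ c, M (T c) = c)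

lemma linearEmbedding_app_val (U : (Pn k N).left.Opens) (s : Γ((Pn k N).left, U)) (x : (Pn k n).left)
    (hx : x ∈ linearEmbedding hMT ⁻¹ᵁ U) :
    HomogeneousLocalization.val ((show Γ(Proj (coordRing k n), linearEmbedding hMT ⁻¹ᵁ U) from
      (linearEmbedding hMT).app U s).1 ⟨x, hx⟩) =
      Localization.localRingHom (homPrime (linearEmbedding hMT x)).asHomogeneousIdeal.toIdeal
        (homPrime x).asHomogeneousIdeal.toIdeal (linearGradedHom T).toRingHom rfl
        (HomogeneousLocalization.val
          ((show Γ(Proj (coordRing k N), U) from s).1 ⟨linearEmbedding hMT x, hx⟩)) :=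
  HomogeneousLocalization.val_localRingHom _

lemma linearEmbedding_hom : linearEmbedding hMT ≫ (Pn k N).hom = (Pn k n).hom := by
  refine ext_of_isAffine ?_
  rw [← cancel_epi (Scheme.ΓSpecIso (.of k)).inv, Scheme.Hom.comp_appTop]
  ext c
  refine Subtype.ext (funext fun x => HomogeneousLocalization.val_injective _ ?_)
  refine Eq.trans ?_ (scalars_Pn_val c x.1).symm
  refine (linearEmbedding_app_val hMT ⊤ (scalars (Pn k N) c) x.1 trivial).trans ?_
  refine (congrArg _ (scalars_Pn_val c _)).trans ?_
  exact (Localization.localRingHom_to_map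
    (homPrime (linearEmbedding hMT x.1)).asHomogeneousIdeal.toIdeal
    (homPrime x.1).asHomogeneousIdeal.toIdeal _ rfl _).trans (congrArg _ (aeval_C _ c))

instance (k : Type u) [Field k] (n : ℕ) : IsReduced (Pn k n).left := by
  have (x : (Pn k n).left) : _root_.IsReduced ((Pn k n).left.presheaf.stalk x) := by
    have : (homPrime x).asHomogeneousIdeal.toIdeal.IsPrime := x.isPrime
    have h1 : IsDomain (LocAt (coordRing k n) x) :=
      IsLocalization.isDomain_localization (homPrime x).asHomogeneousIdeal.toIdeal.primeCompl_le_nonZeroDivisors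
    have h2 : _root_.IsReduced (HomogeneousLocalization.AtPrime (coordRing k n)
        (homPrime x).asHomogeneousIdeal.toIdeal) :=
      isReduced_of_injective (algebraMap _ (LocAt (coordRing k n) x))
        (HomogeneousLocalization.val_injective _)
    exact isReduced_of_injective (Proj.stalkIso' (coordRing k n) x)
      (Proj.stalkIso' (coordRing k n) x).injective
  exact isReduced_of_isReduced_stalk _

lemma linearEmbedding_app_surjective {m : MvPolynomial (Fin (N + 1)) k} (hm : m ∈ coordRing k N 1) :
    Function.Surjective ((linearEmbedding hMT).app (nonvanishing m)) := by
  have h := Proj.awayToSection_comp_appLE (linearGradedHom T) (irrelevant_le_map hMT) hm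
  intro s
  have h2 : Function.Bijective (Proj.awayToSection (coordRing k n) (linearGradedHom T m)) :=
    ConcreteCategory.bijective_of_isIso (Proj.basicOpenIsoAway (coordRing k n) _
      ((linearGradedHom T).map_mem hm) one_pos).hom
  obtain ⟨b, rfl⟩ := h2.2 s
  obtain ⟨d, f, hf, rfl⟩ := HomogeneousLocalization.Away.mk_surjective (coordRing k n)
    ((linearGradedHom T).map_mem hm) b
  obtain ⟨g, hg, rfl⟩ := exists_linearGradedHom_eq hMT hf
  refine ⟨(Proj.awayToSection (coordRing k N) m).hom
    (HomogeneousLocalization.Away.mk (coordRing k N) hm d g hg), ?_⟩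
  have h3 := congrArg (fun q => q.hom (HomogeneousLocalization.Away.mk (coordRing k N) hm d g hg)) h
  rw [← Scheme.Hom.appLE_eq_app]
  refine h3.trans ?_
  exact congrArg (Proj.awayToSection (coordRing k n) (linearGradedHom T m)).hom
    (HomogeneousLocalization.Away.map_mk _ _ _ _ _ _)

instance : IsClosedImmersion (linearEmbedding hMT) := by
  have hX (i) : (MvPolynomial.X i : MvPolynomial (Fin (N + 1)) k) ∈ coordRing k N 1 := isHomogeneous_X k i
  have hP := IsClosedImmersion.hasAffineProperty.{u}
  refine hP.of_iSup_eq_top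
    (fun i : Fin (N + 1) => ⟨nonvanishing (MvPolynomial.X i), isAffineOpen_nonvanishing (hX i)⟩)
    iSup_nonvanishing fun i => ⟨?_, ?_⟩
  · exact isAffineOpen_nonvanishing ((linearGradedHom T).map_mem (hX i))
  · have h := linearEmbedding_app_surjective hMT (hX i)
    have h' {V : (Pn k N).left.Opens} (hV : V = nonvanishing (MvPolynomial.X i)) :
        Function.Surjective ((linearEmbedding hMT).app V) := hV ▸ h
    rw [morphismRestrict_appTop]
    exact (ConcreteCategory.bijective_of_isIso ((Pn k n).left.presheaf.map (eqToHom _).op)).2.comp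
      (h' (Scheme.Opens.ι_image_top (nonvanishing (MvPolynomial.X i))))

/-- Both images are closures of the image of a generic point, and the hypothesis says that these two
image points have the same homogeneous ideal. -/
lemma range_linearEmbedding_eq {X : Over (Spec (.of k))} [IsIntegral X.left] (φ : X ⟶ Pn k N)
    (hφ : IsClosedImmersion φ.left)
    (h : ∀ d, ∀ f ∈ coordRing k N d, Vanishes f (φ.left (genericPoint X.left)) ↔
      aeval (linearForms T) f = 0) :
    Set.range (linearEmbedding hMT) = Set.range φ.left := by
  have h1 : linearEmbedding hMT (genericPrime k n) = φ.left (genericPoint X.left) :=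
    eq_of_vanishes_iff fun d f hf => Ideal.mem_bot.trans (h d f hf).symm
  have h2 : Set.range (linearEmbedding hMT) = closure {linearEmbedding hMT (genericPrime k n)} :=
    range_eq_closure_of_specializes (linearEmbedding hMT).isClosedEmbedding genericPrime_specializes
  rw [h2, h1]
  exact (range_eq_closure_of_specializes φ.left.isClosedEmbedding genericPoint_specializes).symm

end LinearEmbedding

/-- A reduced closed subscheme is determined by its points. -/
lemma exists_iso_of_range_eq {S : Scheme.{u}} {X Y Z : Over S} (f : X ⟶ Z) (g : Y ⟶ Z)
    [IsClosedImmersion f.left] [IsClosedImmersion g.left] [IsReduced X.left] [IsReduced Y.left]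
    (h : Set.range g.left = Set.range f.left) : ∃ e : X ≅ Y, e.hom ≫ g = f := by
  -- Both projections of the fibre product are surjective closed immersions into reduced schemes,
  -- hence isomorphisms.
  have h1 : Surjective (Limits.pullback.fst f.left g.left) := by
    refine ⟨Set.range_eq_univ.1 ?_⟩
    rw [Scheme.Pullback.range_fst, h, Set.preimage_range]
  have h2 : Surjective (Limits.pullback.snd f.left g.left) := by
    refine ⟨Set.range_eq_univ.1 ?_⟩
    rw [Scheme.Pullback.range_snd, ← h, Set.preimage_range]
  have := isIso_of_isClosedImmersion_of_surjective (Limits.pullback.fst f.left g.left)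
  have := isIso_of_isClosedImmersion_of_surjective (Limits.pullback.snd f.left g.left)
  let e : X.left ≅ Y.left := (asIso (Limits.pullback.fst f.left g.left)).symm ≪≫
    asIso (Limits.pullback.snd f.left g.left)
  have he : e.hom ≫ g.left = f.left := by
    simp only [e, Iso.trans_hom, Iso.symm_hom, asIso_hom, asIso_inv, Category.assoc]
    rw [← Limits.pullback.condition, IsIso.inv_hom_id_assoc]
  refine ⟨Over.isoMk e ?_, Over.OverMorphism.ext he⟩
  rw [← Over.w g, reassoc_of% he, Over.w f]

/-! ### Isomorphisms of line bundles -/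

section Modules
open Scheme.Modules

/-- A morphism of modules that is bijective on sections over arbitrarily small open sets is an
isomorphism. -/
lemma isIso_of_bijective_basis {X : Scheme.{u}} {M M' : X.Modules} (γ : M ⟶ M')
    (h : ∀ (x : X) (U : X.Opens), x ∈ U → ∃ V ≤ U, x ∈ V ∧ Function.Bijective (γ.app V)) :
    IsIso γ := by
  let B (V : {V : X.Opens // Function.Bijective (γ.app V)}) : X.Opens := V.1
  have hB : Opens.IsBasis (Set.range B) :=
    Opens.isBasis_iff_nbhd.2 fun {U x} hx => by
      obtain ⟨V, hVU, hxV, hV⟩ := h x U hx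
      exact ⟨V, ⟨⟨V, hV⟩, rfl⟩, hxV, hVU⟩
  let F : TopCat.Sheaf Ab X := ⟨M.presheaf, M.isSheaf⟩
  let G : TopCat.Sheaf Ab X := ⟨M'.presheaf, M'.isSheaf⟩
  let δ : F ⟶ G := ⟨γ.mapPresheaf⟩
  have hδ : IsIso δ := TopCat.Sheaf.isIso_iff_isIso_basis hB fun V =>
    (ConcreteCategory.isIso_iff_bijective _).2 V.2
  have h1 : IsIso ((toPresheaf X).map γ) :=
    inferInstanceAs (IsIso ((TopCat.Sheaf.forget Ab X).map δ))
  exact isIso_of_reflects_iso γ (toPresheaf X)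

/-- A line bundle is locally free of rank one. -/
lemma IsLineBundle.exists_generator {X : Scheme.{u}} {L : X.Modules} (hL : IsLineBundle L) (x : X) :
    ∃ U : X.Opens, x ∈ U ∧ ∀ V ≤ U, ∃ s : Γ(L, V),
      Function.Bijective fun c : Γ(X, V) => c • s := by
  obtain ⟨U, hx, hσ⟩ := hL x
  obtain ⟨σ⟩ : Nonempty (L.restrict U.ι ≅ structureModule U) := hσ
  refine ⟨U, hx, fun V hV => ?_⟩
  obtain ⟨W, rfl⟩ : ∃ W : (U : Scheme.{u}).Opens, V = U.ι ''ᵁ W := by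
    refine ⟨U.ι ⁻¹ᵁ V, ?_⟩
    rw [Scheme.Hom.image_preimage_eq_opensRange_inf, Scheme.Opens.opensRange_ι, inf_eq_right.2 hV]
  let s : Γ(L.restrict U.ι, W) := σ.inv.app W (1 : Γ((U : Scheme.{u}), W))
  let s' : Γ(L, U.ι ''ᵁ W) := s
  refine ⟨s', ?_⟩
  have h1 : Function.Bijective (σ.inv.app W) := ConcreteCategory.bijective_of_isIso _
  have h2 (c : Γ((U : Scheme.{u}), W)) : σ.inv.app W c = (c • s : Γ(L.restrict U.ι, W)) := by
    refine Eq.trans ?_ (Hom.app_smul σ.inv c (1 : Γ((U : Scheme.{u}), W)))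
    exact congrArg _ (mul_one c).symm
  have h3 : Function.Bijective (U.ι.appIso W).inv := ConcreteCategory.bijective_of_isIso _
  have h4 : (fun c : Γ((U : Scheme.{u}), W) => ((U.ι.appIso W).inv c • s' : Γ(L, U.ι ''ᵁ W))) =
      σ.inv.app W := funext fun c => (h2 c).symm
  exact (Function.Bijective.of_comp_iff (fun c : Γ(X, U.ι ''ᵁ W) => c • s') h3).1
    (show Function.Bijective fun c : Γ((U : Scheme.{u}), W) =>
      ((U.ι.appIso W).inv c • s' : Γ(L, U.ι ''ᵁ W)) from h4 ▸ h1)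

/-- The pullback along an isomorphism is the pushforward along its inverse. -/
def pullbackIsoPushforward {X Y : Scheme.{u}} (e : X ≅ Y) (M : Y.Modules) :
    (pullback e.hom).obj M ≅ (pushforward e.inv).obj M :=
  -- An isomorphism is an open immersion, so its pullback is restriction. Writing `M` as the
  -- pushforward along `e.hom` of its pushforward along `e.inv`, the restriction cancels the outer
  -- one.
  ((restrictFunctorIsoPullback e.hom).symm.app M) ≪≫
    (restrictFunctor e.hom).mapIso ((pushforwardId Y).symm.app M ≪≫
      (pushforwardCongr e.inv_hom_id.symm).app M ≪≫ (pushforwardComp e.inv e.hom).symm.app M) ≪≫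
    (restrictFunctorAdjCounitIso e.hom).app ((pushforward e.inv).obj M)

end Modules

/-! ### The restriction of `𝒪(1)` to a linear subspace. -/

section LinearPullback
attribute [local instance] MvPolynomial.gradedAlgebra
open MvPolynomial Scheme.Modules
variable {k : Type u} [Field k] [Infinite k] {n N : ℕ} {T : (Fin (n + 1) → k) →ₗ[k] (Fin (N + 1) → k)}
  {M : (Fin (N + 1) → k) →ₗ[k] (Fin (n + 1) → k)} (hMT : ∀ c, M (T c) = c)

/-- The map of local rings given by a linear embedding. -/
def linearLocalHom (x : (Pn k n).left) :
    LocAt (coordRing k N) (linearEmbedding hMT x) →+* LocAt (coordRing k n) x :=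
  Localization.localRingHom (homPrime (linearEmbedding hMT x)).asHomogeneousIdeal.toIdeal
    (homPrime x).asHomogeneousIdeal.toIdeal (linearGradedHom T).toRingHom rfl

/-- The pullback of sections of `𝒪(1)` along a linear embedding. -/
def linearPullSection (U : (Pn k N).left.Opens) :
    Γ(O1 k N, U) →+ Γ(O1 k n, linearEmbedding hMT ⁻¹ᵁ U) where
  toFun f := (⟨fun x => linearLocalHom hMT x.1 (secVal f (linearEmbedding hMT x.1) x.2), fun x => by
    obtain ⟨V, hx, i, j, r, s, hr, hs, hsV, hV⟩ :=
      (show twistSections (coordRing k N) 1 U from f).2 ⟨linearEmbedding hMT x.1, x.2⟩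
    refine ⟨linearEmbedding hMT ⁻¹ᵁ V, hx, homOfLE fun y hy => i.le hy, j,
      linearGradedHom T r, linearGradedHom T s, (linearGradedHom T).map_mem hr,
      (linearGradedHom T).map_mem hs, fun y => hsV ⟨linearEmbedding hMT y.1, y.2⟩, fun y => ?_⟩
    refine (congrArg (linearLocalHom hMT y.1) (hV ⟨linearEmbedding hMT y.1, y.2⟩)).trans ?_
    rw [Localization.mk_eq_mk']
    refine (Localization.localRingHom_mk'
      (homPrime (linearEmbedding hMT y.1)).asHomogeneousIdeal.toIdeal
      (homPrime y.1).asHomogeneousIdeal.toIdeal _ rfl _ _).trans ?_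
    rw [Localization.mk_eq_mk']
    rfl⟩ : twistSections (coordRing k n) 1 (linearEmbedding hMT ⁻¹ᵁ U))
  map_zero' := secVal_ext fun x hx => map_zero (linearLocalHom hMT x)
  map_add' f g := secVal_ext fun x hx => map_add (linearLocalHom hMT x) _ _

/-- The pullback of sections of `𝒪(1)` along a linear embedding, as a morphism of modules. -/
def linearPull : O1 k N ⟶ (pushforward (linearEmbedding hMT)).obj (O1 k n) :=
  moduleHomMk (linearPullSection hMT) (fun U r f => secVal_ext fun x hx => by
    refine (map_mul (linearLocalHom hMT x) _ _).trans ?_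
    exact congrArg (· * _) (linearEmbedding_app_val hMT U r x hx).symm)
    (fun U V i f => rfl)

lemma linearPull_linSection (l : coordRing k N 1) :
    (linearPull hMT).app ⊤ (linSection l) =
      linSection ⟨linearGradedHom T l, (linearGradedHom T).map_mem l.2⟩ :=
  secVal_ext fun x _ => Localization.localRingHom_to_map
    (homPrime (linearEmbedding hMT x)).asHomogeneousIdeal.toIdeal
    (homPrime x).asHomogeneousIdeal.toIdeal _ rfl _

variable {X : Scheme.{u}} {L : X.Modules} (φ : X ⟶ (Pn k N).left)
  (e : X ≅ (Pn k n).left)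

/-- The map is the adjoint of the explicit pullback of fractions `linearPull`, transported by `ψ`.
Its effect on linear forms is the only information about it that is used later. -/
lemma exists_hom_pushforward (ψ : (pullback φ).obj (O1 k N) ≅ L)
    (he : e.hom ≫ linearEmbedding hMT = φ) : ∃ γ : L ⟶ (pushforward e.inv).obj (O1 k n),
    ∀ l : coordRing k N 1, γ.app ⊤ (ψ.hom.app ⊤ (pullSection φ _ (linSection l))) =
      (linSection ⟨linearGradedHom T l, (linearGradedHom T).map_mem l.2⟩ : Γ(O1 k n, ⊤)) := by
  have he' : linearEmbedding hMT = e.inv ≫ φ := by rw [← he, e.inv_hom_id_assoc]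
  let α : O1 k N ⟶ (pushforward φ).obj ((pushforward e.inv).obj (O1 k n)) :=
    linearPull hMT ≫ (pushforwardCongr he').hom.app _ ≫ (pushforwardComp e.inv φ).inv.app _
  let β := ((pullbackPushforwardAdjunction φ).homEquiv _ _).symm α
  have hβ : (pullbackPushforwardAdjunction φ).homEquiv _ _ β = α := Equiv.apply_symm_apply _ _
  refine ⟨ψ.inv ≫ β, fun l => ?_⟩
  have h1 (m) : ψ.inv.app ⊤ (ψ.hom.app ⊤ m) = m :=
    congrArg (fun g : _ ⟶ (pullback φ).obj (O1 k N) => g.app ⊤ m) ψ.hom_inv_id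
  refine (congrArg (β.app ⊤) (h1 _)).trans ?_
  have h2 : β.app ⊤ (pullSection φ _ (linSection l)) = α.app ⊤ (linSection l) :=
    congrArg (fun g : O1 k N ⟶ (pushforward φ).obj ((pushforward e.inv).obj (O1 k n)) =>
      g.app ⊤ (linSection l)) hβ
  refine h2.trans ?_
  have h3 := linearPull_linSection hMT l
  refine secVal_ext fun x hx => ?_
  exact congrArg (fun f : Γ(O1 k n, ⊤) => secVal f x trivial) h3

/-- A line bundle that is the restriction of `𝒪(1)` to a linear subspace is `𝒪(1)`. -/
theorem pullback_iso_of_linear (hL : IsLineBundle L) (ψ : (pullback φ).obj (O1 k N) ≅ L)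
    (he : e.hom ≫ linearEmbedding hMT = φ) :
    Nonempty ((pullback e.hom).obj (O1 k n) ≅ L) := by
  obtain ⟨γ, hγ⟩ := exists_hom_pushforward hMT φ e ψ he
  suffices IsIso γ from ⟨pullbackIsoPushforward e _ ≪≫ (asIso γ).symm⟩
  refine isIso_of_bijective_basis γ fun x U₀ hx₀ => ?_
  obtain ⟨U, hxU, hU⟩ := hL.exists_generator x
  obtain ⟨j, hj⟩ := exists_variable_notMem (e.hom x)
  have hY : (MvPolynomial.X j : MvPolynomial (Fin (n + 1)) k) ∈ coordRing k n 1 := isHomogeneous_X k j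
  -- A linear form on `ℙᴺ` restricting to the variable `X j`, so that `γ` is known on the
  -- restriction of `l`.
  obtain ⟨l, hl, hlY⟩ := exists_linearGradedHom_eq hMT hY
  obtain ⟨V, hV⟩ : ∃ V, V = U₀ ⊓ (U ⊓ e.hom ⁻¹ᵁ nonvanishing (MvPolynomial.X j)) := ⟨_, rfl⟩
  obtain ⟨t, ht⟩ := hU V (hV.le.trans (inf_le_right.trans inf_le_left))
  refine ⟨V, hV.le.trans inf_le_left, hV ▸ ⟨hx₀, hxU, hj⟩, ?_⟩
  have hVY : e.inv ⁻¹ᵁ V ≤ nonvanishing (MvPolynomial.X j) := fun y hy => by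
    have h1 := (hV.le hy).2.2
    have h2 : e.hom (e.inv y) = y := congrArg (fun g : (Pn k n).left ⟶ (Pn k n).left => g y) e.inv_hom_id
    rwa [← h2]
  let Y : coordRing k n 1 := ⟨MvPolynomial.X j, hY⟩
  let β : Γ(X, V) →+* Γ((Pn k n).left, e.inv ⁻¹ᵁ V) := (e.inv.app V).hom
  have hβ : Function.Bijective β := ConcreteCategory.bijective_of_isIso (e.inv.app V)
  have hsmul (c : Γ(X, V)) (m : Γ(L, V)) : γ.app V (c • m) =
      (β c • (show Γ(O1 k n, e.inv ⁻¹ᵁ V) from γ.app V m) : Γ(O1 k n, e.inv ⁻¹ᵁ V)) :=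
    Hom.app_smul γ c m
  obtain ⟨b, hb⟩ := ht.2 (L.presheaf.map (homOfLE le_top : V ⟶ ⊤).op
    (ψ.hom.app ⊤ (pullSection φ _ (linSection ⟨l, hl⟩))))
  obtain ⟨a, ha⟩ := exists_smul_linOn Y hVY (γ.app V t)
  have h1 : γ.app V (b • t) = linOn Y (e.inv ⁻¹ᵁ V) := by
    refine (congrArg (γ.app V) hb).trans ?_
    have h2 := ConcreteCategory.congr_hom (γ.mapPresheaf.naturality (homOfLE le_top : V ⟶ ⊤).op)
      (ψ.hom.app ⊤ (pullSection φ _ (linSection ⟨l, hl⟩)))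
    refine h2.trans ?_
    refine (congrArg (((pushforward e.inv).obj (O1 k n)).presheaf.map
      (homOfLE le_top : V ⟶ ⊤).op) (hγ ⟨l, hl⟩)).trans ?_
    refine secVal_ext fun y hy => ?_
    exact congrArg (algebraMap _ (LocAt (coordRing k n) y)) hlY
  -- The restriction of `l` is `b t` for the generator `t`, and `γ` maps it to `Y`. As `γ t = a Y`,
  -- this gives `β(b) a = 1`.
  have hba : IsUnit a := by
    refine IsUnit.of_mul_eq_one (β b) (smul_linOn_injective Y hVY ?_)
    rw [one_smul, mul_comm, mul_smul, ha]
    exact (hsmul b t).symm.trans h1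
  -- In terms of the generators `t` and `Y`, the map `γ` is the ring isomorphism `β` followed by
  -- multiplication by the unit `a`.
  have h3 : (γ.app V ∘ fun c : Γ(X, V) => c • t) = (fun g => g • linOn Y (e.inv ⁻¹ᵁ V)) ∘
      (fun g => g * a) ∘ β := funext fun c => by
    refine (hsmul c t).trans ?_
    change _ = (β c * a) • linOn Y _
    rw [mul_smul, ha]
  refine (Function.Bijective.of_comp_iff _ ht).1 ?_
  rw [h3]
  refine Function.Bijective.comp ⟨fun g g' h => smul_linOn_injective Y hVY h,
    exists_smul_linOn Y hVY⟩ (Function.Bijective.comp ?_ hβ)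
  exact Units.mulRight_bijective hba.unit

end LinearPullback

end

end GaCone

/-! ### The main theorem. -/

theorem mainTheorem8 {k : Type u} [Field k] [IsAlgClosed k]
    (X : Over (Spec (.of k))) [IsIntegral X.left] (hnormal : IsNormal X.left)
    (hproj : IsProjective X)
    [AddModObj (Ga (Spec (.of k))) X] (hnontriv : action (Ga (Spec (.of k))) X ≠ snd _ X)
    (L : X.left.Modules) (hL : IsLineBundle L) (hva : IsVeryAmple L)
    (Φ : Linearization (Ga (Spec (.of k))) X L)
    (W : Submodule k (H0 L)) (hW : Module.finrank k (H0 L ⧸ W) = 1)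
    (hfix : ∀ t : 𝟙_ (Over (Spec (.of k))) ⟶ Ga (Spec (.of k)), ∀ s ∈ W, Φ.act t s = s) :
    (∀ (N : ℕ) (φ : X ⟶ Pn k N), IsEmbeddingBy L φ →
      ∃ v : X.left, IsConeWithVertex (Set.range φ.left) (φ.left v) ∧
        (∀ t : 𝟙_ (Over (Spec (.of k))) ⟶ Ga (Spec (.of k)), (pointAction (Ga (Spec (.of k))) X t).left v = v) ∧
        (∀ t : 𝟙_ (Over (Spec (.of k))) ⟶ Ga (Spec (.of k)), ∀ x : X.left, IsClosed {x} → x ≠ v →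
          φ.left ((pointAction (Ga (Spec (.of k))) X t).left x) ∈ line (φ.left v) (φ.left x))) ∧
    (∀ n : ℕ, SmoothOfRelativeDimension n X.hom →
      ∃ e : X ≅ Pn k n, Nonempty ((Scheme.Modules.pullback e.hom.left).obj (O1 k n) ≅ L)) := by
  have : IsProper X.hom := isProper_of_isProjective hproj
  refine ⟨fun N φ ⟨hφ, ⟨ψ⟩⟩ => ?_, fun n hn => ?_⟩
  · obtain ⟨P, hP⟩ := exists_direction Φ W hW hfix φ ψ
    obtain ⟨v, _, _, _, h1, h2, h3⟩ := exists_vertex hnontriv φ hφ hP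
    exact ⟨v, h1, h2, h3⟩
  · obtain ⟨N, φ, hφ, ⟨ψ⟩⟩ := hva
    -- Very ampleness only provides an immersion; as `X` is proper, its image is closed and it is a
    -- closed immersion.
    have hproper : IsProper φ.left := by
      have : IsProper (φ.left ≫ (Pn k N).hom) := by
        rw [Over.w φ]
        infer_instance
      exact IsProper.of_comp φ.left (Pn k N).hom
    have hclosed : IsClosedImmersion φ.left :=
      IsClosedImmersion.of_isPreimmersion φ.left φ.left.isClosedMap.isClosed_range
    obtain ⟨P, hP⟩ := exists_direction Φ W hW hfix φ ψ
    obtain ⟨v, D, hv, hD, -⟩ := exists_vertex hnontriv φ hclosed hP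
    obtain ⟨T, M, hMT, hT⟩ := exists_linear_parametrization φ hclosed hv hD hn
    let ι : Pn k n ⟶ Pn k N := Over.homMk (linearEmbedding hMT) (linearEmbedding_hom hMT)
    have : IsClosedImmersion ι.left := inferInstanceAs (IsClosedImmersion (linearEmbedding hMT))
    obtain ⟨e, he⟩ := exists_iso_of_range_eq φ ι
      (range_linearEmbedding_eq hMT φ hclosed hT)
    exact ⟨e, pullback_iso_of_linear hMT φ.left ((Over.forget _).mapIso e) hL ψ
      (congrArg (fun f : X ⟶ Pn k N => f.left) he)⟩
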